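/- **Setting.** Let $K$ be a field, $d_1,\dots,d_k\ge 0$ integers, and let $S$ be the rational normal scroll given by the $2\times 2$ minors $f_{\alpha\beta}=z_\alpha z_{\beta+1}-z_{\alpha+1}z_\beta$ of the matrix with columns $(z_\alpha,z_{\alpha+1})=(z^{(i)}_j,z^{(i)}_{j+1})$, $1\le i\le k$, $0\le j<d_i$. It is parametrised by $z^{(i)}_j=z^{(i)}s^{d_i-j}t^j$, where $(s:t;z^{(1)}:\dots:z^{(k)})$ are the coordinates on a projective bundle $\widetilde S$ over $\mathbb P^1$. Let $P^{(1)},\dots,P^{(l)}$, $l\le k$, be equations of divisors of type $2H-b_nR$ ($b_n\ge 0$) forming a complete intersection on $\widetilde S$; that is, $P^{(n)}$ is quadratic in the $z^{(i)}$ and of total degree $-b_n$, where $z^{(i)}$ has weight $-d_i$ and $s,t$ have weight $1$; write $p^{(n)}_{\delta_i+\delta_{i'},j}$ for the coefficient of $s^{d_i+d_{i'}-b_n-j}t^jz^{(i)}z^{(i')}$ in $P^{(n)}$. Let $P^{(n)}_m(z)$, $0\le m\le b_n$, be quadratic forms in the $z^{(i)}_j$ that restrict to $s^{b_n-m}t^mP^{(n)}$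 on the scroll and are obtained by rolling factors: $P^{(n)}_m=\sum_\alpha p^{(n)}_{\alpha,m}z_\alpha$ and $P^{(n)}_{m+1}=\sum_\alpha p^{(n)}_{\alpha,m}z_{\alpha+1}$ for $0\le m<b_n$, with linear forms $p^{(n)}_{\alpha,m}$ in the $z$-variables. Let $X$ be the affine cone defined by the $f_{\alpha\beta}$ and all $P^{(n)}_m$. Let $\zeta^{(i)}_j$ ($0<j<d_i$) be variables, put $\zeta^{(i)}_0=\zeta^{(i)}_{d_i}=0$, and deform the scroll to the scroll with columns $(z_\alpha,z_{\alpha+1}+\zeta_{\alpha+1})$. Let $\rho^{(n,i)}_j$ ($1\le n\le l$, $1\le i\le k$, $0\le j\le d_i-b_n$) be further variables. Let $L\subset K[\zeta,\rho]$ be the ideal generated by the *lifting conditions*: for all $n$, all $i$ and all $r$ with $0<r<b_n-d_i$, $$\sum_{i'=1}^k\ \sum_{j=0}^{d_i+d_{i'}-b_n}(1+\delta_{ii'})\,p^{(n)}_{\delta_i+\delta_{i'},j}\,\zeta^{(i')}_{j+r}=0,$$ where the factor $1+\delta_{ii'}$ is $2$ if $i=i'$ and $1$ otherwise. Let $$P'^{(n)}_m(z,\zeta,\rho)=Q^{(n)}_m(z,\zeta)+\sum_{i}\sum_{j=0}^{d_i-b_n}\rho^{(n,i)}_j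 z^{(i)}_{j+m}\qquad(0\le m\le b_n),$$ where the $Q^{(n)}_m$ are bilinear over $K$ in $z$ and $\zeta$ and are a first-order lift of the deformation of the scroll: on the scroll, and modulo $L$, $$sQ^{(n)}_{m+1}-tQ^{(n)}_m=s\sum_\alpha p^{(n)}_{\alpha,m}\zeta_{\alpha+1}\qquad(0\le m<b_n).$$ Put $\mathfrak m=(\zeta,\rho)\subset K[\zeta,\rho]$. The *infinitesimal deformation defined by the $P'^{(n)}_m$* is the one over $K[\zeta,\rho]/(L+\mathfrak m^2)$ given by the minors of the deformed scroll matrix and the $P^{(n)}_m+P'^{(n)}_m$. For an ideal $J$ with $L\subset J\subset L+\mathfrak m^2$, an *extension over $K[\zeta,\rho]/J$* is an ideal of $(K[\zeta,\rho]/J)[z]$ with quotient flat over $K[\zeta,\rho]/J$ which reduces to the ideal of the infinitesimal deformation modulo $L+\mathfrak m^2$. It is *graded* if it is the image of an ideal of $K[\zeta,\rho][z]$ that is homogeneous for the grading in which all variables $z,\zeta,\rho$ have degree $1$. **Proposition 3.2.** The maximal extension of the infinitesimal deformation defined by the $P'^{(n)}_m$ lives over the base given, inside the linear space of the lifting conditions,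 by the $\sum_n\max(b_n-1,0)$ base equations $$P'^{(n)}_m(\zeta,\zeta,\rho)-P^{(n)}_m(\zeta)=0,\qquad 1\le n\le l,\quad 1\le m\le b_n-1 .$$ Precisely, let $\mathfrak a\subset K[\zeta,\rho]$ be the ideal generated by $L$ and the left hand sides of the base equations. Then $\mathfrak a$ is the smallest homogeneous ideal $J$ such that there is a graded extension over $K[\zeta,\rho]/J$. Moreover, if there is an extension (graded or not) over $K[\zeta,\rho]/J$ for an arbitrary ideal $J$ with $L\subset J\subset L+\mathfrak m^2$, then $\mathfrak a\subset J+\mathfrak m^3$. -/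

import Mathlib

open MvPolynomial

noncomputable section

namespace RollingFactors

/-! ### Families of affine schemes -/

/-- Base change, along a ring homomorphism `A → R`, of the family with ideal `I ⊆ A[z]`. -/
def restrict {A R σ : Type*} [CommRing A] [CommRing R] (φ : A →+* R)
    (I : Ideal (MvPolynomial σ A)) : Ideal (MvPolynomial σ R) :=
  I.map (map φ)

/-- The base change along `A → R` of the family with ideal `I ⊆ A[z]` is flat over `R`. -/
def IsFlatFamily {A R σ : Type*} [CommRing A] [CommRing R] (φ : A →+* R)
    (I : Ideal (MvPolynomial σ A)) : Prop :=
  Module.Flat R (MvPolynomial σ R ⧸ restrict φ I)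

/-- The ideal `I` of `K[σ]` is homogeneous for the standard grading. -/
def IsHomogeneousIdeal {K σ : Type*} [CommRing K] (I : Ideal (MvPolynomial σ K)) : Prop :=
  letI := MvPolynomial.gradedAlgebra (σ := σ) (R := K)
  I.IsHomogeneous (homogeneousSubmodule σ K)

/-! ### The scroll -/

/-- The coordinates `z^(i)_j` (`0 ≤ j ≤ d i`) of the projective space containing the scroll of type
`d = (d 0, …, d (k-1))`. -/
abbrev ZVar {k : ℕ} (d : Fin k → ℕ) : Type := (i : Fin k) × Fin (d i + 1)

/-- The columns `α = (z^(i)_j, z^(i)_{j+1})` (`0 ≤ j < d i`) of the scroll matrix. -/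
abbrev Col {k : ℕ} (d : Fin k → ℕ) : Type := (i : Fin k) × Fin (d i)

/-- The index of the entry `z_α` in the top row of the column `α`. -/
def Col.top {k : ℕ} {d : Fin k → ℕ} (α : Col d) : ZVar d := ⟨α.1, α.2.castSucc⟩

/-- The index of the entry `z_{α+1}` in the bottom row of the column `α`. -/
def Col.bot {k : ℕ} {d : Fin k → ℕ} (α : Col d) : ZVar d := ⟨α.1, α.2.succ⟩

/-- The bihomogeneous coordinates `s, t, z^(1), …, z^(k)` of the projective bundle over `ℙ¹`
whose image is the scroll. -/
abbrev CoxVar (k : ℕ) : Type := Fin 2 ⊕ Fin k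

/-- The coordinate `s`. -/
def sVar (k : ℕ) : CoxVar k := Sum.inl 0

/-- The coordinate `t`. -/
def tVar (k : ℕ) : CoxVar k := Sum.inl 1

/-- The substitution `z^(i)_j = z^(i) s^{d i - j} t^j`, over any coefficient ring. -/
def toCox (R : Type*) [CommRing R] {k : ℕ} (d : Fin k → ℕ) :
    MvPolynomial (ZVar d) R →ₐ[R] MvPolynomial (CoxVar k) R :=
  aeval fun z => X (Sum.inr z.1) * X (sVar k) ^ (d z.1 - (z.2 : ℕ)) * X (tVar k) ^ (z.2 : ℕ)

/-- `P(s, t, z^(i))` is the equation of a divisor in `|2H - bR|`: it is quadratic in the `z^(i)`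
and has total degree `-b`, where `s, t` have weight `1` and `z^(i)` has weight `-d i`. -/
def IsDivisorEquation {K : Type*} [Field K] {k : ℕ} (d : Fin k → ℕ) (b : ℕ)
    (P : MvPolynomial (CoxVar k) K) : Prop :=
  IsWeightedHomogeneous (Sum.elim (fun _ => 0) (fun _ => 1) : CoxVar k → ℕ) P 2 ∧
  IsWeightedHomogeneous (Sum.elim (fun _ => 1) (fun i => -(d i : ℤ)) : CoxVar k → ℤ) P (-(b : ℤ))

/-- The equations `P_1, …, P_l` cut out a complete intersection: they form a regular sequence
over each of the two charts `s ≠ 0` and `t ≠ 0` of `ℙ¹`.  As the rings are Cohen-Macaulay and the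
zero section `z = 0` has codimension `k`, this says that `l ≤ k` and that the equations form
a regular sequence in each local ring of their common zero scheme in the projective bundle
(equivalently, that this scheme is empty or has codimension `l`). -/
def IsCompleteIntersection {K : Type*} [Field K] {k l : ℕ}
    (P : Fin l → MvPolynomial (CoxVar k) K) : Prop :=
  RingTheory.Sequence.IsWeaklyRegular
    (Localization.Away (X (sVar k) : MvPolynomial (CoxVar k) K)) (List.ofFn P) ∧
  RingTheory.Sequence.IsWeaklyRegular
    (Localization.Away (X (tVar k) : MvPolynomial (CoxVar k) K)) (List.ofFn P)

/-! ### The additional equations -/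

/-- A complete intersection of divisors of type `2H - (b n) R`, `n = 1, …, l`, on the scroll of
type `d`, with additional equations `P^(n)_m` (`0 ≤ m ≤ b n`) obtained by rolling factors. -/
structure QuadricSystem (K : Type*) [Field K] (k l : ℕ) where
  /-- the degrees of the scroll -/
  d : Fin k → ℕ
  /-- the `n`-th divisor is of type `2H - (b n) R` -/
  b : Fin l → ℕ
  /-- the equations on the scroll -/
  P : Fin l → MvPolynomial (CoxVar k) K
  isDivisorEquation : ∀ n, IsDivisorEquation d (b n) (P n)
  isCompleteIntersection : IsCompleteIntersection P
  /-- the additional equations `P^(n)_m` -/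
  eqn : Fin l → ℕ → MvPolynomial (ZVar d) K
  /-- the coefficients `p^(n)_{α,m}` by which one rolls from `P^(n)_m` to `P^(n)_{m+1}` -/
  roll : Fin l → ℕ → Col d → MvPolynomial (ZVar d) K
  eqn_homogeneous : ∀ n m, m ≤ b n → (eqn n m).IsHomogeneous 2
  roll_homogeneous : ∀ n m α, m < b n → (roll n m α).IsHomogeneous 1
  toCox_eqn : ∀ n m, m ≤ b n →
    toCox K d (eqn n m) = X (sVar k) ^ (b n - m) * X (tVar k) ^ m * P n
  eqn_eq : ∀ n m, m < b n → eqn n m = ∑ α, roll n m α * X α.top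
  eqn_succ : ∀ n m, m < b n → eqn n (m + 1) = ∑ α, roll n m α * X α.bot

namespace QuadricSystem

variable {K : Type*} [Field K] {k l : ℕ} (D : QuadricSystem K k l)

/-! ### The deformation variables -/

/-- Indices of the deformation variables `ζ^(i)_j`, `0 < j < d i`, of the scroll: the pair `(i, j)`
stands for `ζ^(i)_{j+1}`. -/
abbrev ZetaIdx : Type := (i : Fin k) × Fin (D.d i - 1)

/-- Indices of the variables `ρ^(n,i)_j`, `0 ≤ j ≤ d i - b n`, of the pure rolling factors
deformations. -/
abbrev RhoIdx : Type := (n : Fin l) × (i : Fin k) × Fin (D.d i + 1 - D.b n)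

/-- The ring `K[ζ, ρ]`. -/
abbrev Base : Type _ := MvPolynomial (D.ZetaIdx ⊕ D.RhoIdx) K

/-- The variable `ζ^(i)_j`; in particular `ζ^(i)_0 = ζ^(i)_{d i} = 0`. -/
def zeta (i : Fin k) (j : ℕ) : D.Base :=
  if h : 0 < j ∧ j < D.d i then X (Sum.inl ⟨i, ⟨j - 1, by omega⟩⟩) else 0

/-- The point `z = ζ`, that is `z^(i)_j = ζ^(i)_j`. -/
def zetaPt (z : ZVar D.d) : D.Base := D.zeta z.1 z.2

/-- The coefficient `p^(n)_{δ_i+δ_i',j}` of `s^{d i + d i' - b n - j} t^j z^(i) z^(i')` in `P^(n)`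
(where `b n + j ≤ d i + d i'`). -/
def coef (n : Fin l) (i i' : Fin k) (j : ℕ) : K :=
  (D.P n).coeff (Finsupp.single (sVar k) (D.d i + D.d i' - D.b n - j) +
    Finsupp.single (tVar k) j + Finsupp.single (Sum.inr i) 1 + Finsupp.single (Sum.inr i') 1)

/-- The left hand side of the linear lifting equation of `P^(n)` with indices `I = δ_i` and `r`. -/
def liftingForm (n : Fin l) (i : Fin k) (r : ℕ) : D.Base :=
  ∑ i' : Fin k, ∑ j ∈ Finset.range (D.d i + D.d i' + 1 - D.b n),
    C ((if i' = i then 2 else 1) * D.coef n i i' j) * D.zeta i' (j + r)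

/-- The ideal of `K[ζ, ρ]` generated by the lifting conditions, `0 < r < b n - d i`. -/
def liftingIdeal : Ideal D.Base :=
  Ideal.span {g | ∃ n i r, 0 < r ∧ r + D.d i < D.b n ∧ g = D.liftingForm n i r}

/-- The ideal of the origin in `K[ζ, ρ]`. -/
def originIdeal : Ideal D.Base := Ideal.span (Set.range X)

/-! ### Perturbations of the equations -/

/-- The bilinear form `∑ q z v · ζ_v · z` in the `z`-variables and the `ζ`-variables. -/
def bilin (q : ZVar D.d → D.ZetaIdx → K) : MvPolynomial (ZVar D.d) D.Base :=
  ∑ z, C (∑ v, C (q z v) * X (Sum.inl v)) * X z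

/-- The coordinate `z^(i)_j`, for `j ≤ d i`. -/
def zCoord (i : Fin k) (j : ℕ) : MvPolynomial (ZVar D.d) D.Base :=
  if h : j < D.d i + 1 then X ⟨i, ⟨j, h⟩⟩ else 0

/-- The pure rolling factors perturbation `∑ ρ^(n,i)_j z^(i)_{j+m}` of `P^(n)_m`. -/
def purePart (n : Fin l) (m : ℕ) : MvPolynomial (ZVar D.d) D.Base :=
  ∑ i : Fin k, ∑ j : Fin (D.d i + 1 - D.b n),
    C (X (Sum.inr ⟨n, i, j⟩)) * D.zCoord i (j + m)

/-- First order perturbations of the additional equations, compatible with the deformation `ζ` of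
the scroll whenever the lifting conditions are satisfied: the bilinear forms `Q^(n)_m(z, ζ)` satisfy
`s Q_{m+1} - t Q_m = s ∑_α p_{α,m} ζ_{α+1}` on the scroll, modulo the lifting conditions. -/
structure FirstOrderLift where
  /-- the coefficients of the `Q^(n)_m` -/
  q : Fin l → ℕ → ZVar D.d → D.ZetaIdx → K
  lift : ∀ n m, m < D.b n →
    X (sVar k) * toCox D.Base D.d (D.bilin (q n (m + 1)))
      - X (tVar k) * toCox D.Base D.d (D.bilin (q n m))
      - X (sVar k) * toCox D.Base D.d
          (∑ α : Col D.d, map C (D.roll n m α) * C (D.zetaPt α.bot))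
      ∈ D.liftingIdeal.map (C : D.Base →+* MvPolynomial (CoxVar k) D.Base)

variable {D}

/-- The perturbation `P'^(n)_m(z, ζ, ρ)` of `P^(n)_m`. -/
def FirstOrderLift.pert (F : D.FirstOrderLift) (n : Fin l) (m : ℕ) :
    MvPolynomial (ZVar D.d) D.Base :=
  D.bilin (F.q n m) + D.purePart n m

variable (D) in
/-- The `2 × 2` minor in the columns `α, β` of the deformed scroll matrix with columns
`(z_α, z_{α+1} + ζ_{α+1})`. -/
def deformedMinor (α β : Col D.d) : MvPolynomial (ZVar D.d) D.Base :=
  X α.top * (X β.bot + C (D.zetaPt β.bot)) - (X α.bot + C (D.zetaPt α.bot)) * X β.top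

/-- The equations of the infinitesimal deformation: the minors of the deformed scroll matrix and
the `P^(n)_m + P'^(n)_m`. -/
def FirstOrderLift.equations (F : D.FirstOrderLift) : Ideal (MvPolynomial (ZVar D.d) D.Base) :=
  Ideal.span ({g | ∃ α β, g = D.deformedMinor α β} ∪
    {g | ∃ n m, m ≤ D.b n ∧ g = map C (D.eqn n m) + F.pert n m})

/-- The left hand side `P'_m(ζ, ζ, ρ) - P_m(ζ)` of a base equation. -/
def FirstOrderLift.baseEquation (F : D.FirstOrderLift) (n : Fin l) (m : ℕ) : D.Base :=
  eval D.zetaPt (F.pert n m) - aeval D.zetaPt (D.eqn n m)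

/-- The ideal generated by the lifting conditions and the base equations, `1 ≤ m ≤ b n - 1`. -/
def FirstOrderLift.baseIdeal (F : D.FirstOrderLift) : Ideal D.Base :=
  D.liftingIdeal ⊔ Ideal.span {g | ∃ n m, 1 ≤ m ∧ m + 1 ≤ D.b n ∧ g = F.baseEquation n m}

/-- The infinitesimal deformation, over `K[ζ, ρ]` modulo the lifting conditions and the square of
the ideal of the origin, extends over the base `K[ζ, ρ] ⧸ J` as the flat family with equations `I`.
(The ideal of the family is the image of `I` in `(K[ζ, ρ] ⧸ J)[z]`; each ideal is of this form.) -/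
structure FirstOrderLift.IsExtension (F : D.FirstOrderLift) (J : Ideal D.Base)
    (I : Ideal (MvPolynomial (ZVar D.d) D.Base)) : Prop where
  lifting_le : D.liftingIdeal ≤ J
  le_first_order : J ≤ D.liftingIdeal ⊔ D.originIdeal ^ 2
  flat : IsFlatFamily (Ideal.Quotient.mk J) I
  first_order :
    restrict (Ideal.Quotient.mk (D.liftingIdeal ⊔ D.originIdeal ^ 2)) I =
      restrict (Ideal.Quotient.mk (D.liftingIdeal ⊔ D.originIdeal ^ 2)) F.equations

/-- The ideal `J` of `K[ζ, ρ]` is homogeneous. -/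
def BaseHomogeneous (J : Ideal D.Base) : Prop :=
  IsHomogeneousIdeal J

/-- The ideal `I` of `K[ζ, ρ][z]` is homogeneous, all variables `z, ζ, ρ` having degree `1`. -/
def FamilyHomogeneous (I : Ideal (MvPolynomial (ZVar D.d) D.Base)) : Prop :=
  IsHomogeneousIdeal (I.comap (sumAlgEquiv K (ZVar D.d) (D.ZetaIdx ⊕ D.RhoIdx)))

end QuadricSystem

end RollingFactors

end

/-! Everything turns on one identity. For fixed `n`, write `p_α` for the rolling coefficients from
`P_m` to `P_{m+1}` and `π_α` for the coefficient of `z_α` in `P'_m`. The first-order condition says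
that, modulo the lifting ideal `L`, the `π_α` are also the coefficients of `z_{α+1}` in `P'_{m+1} -
∑ p_α ζ_{α+1}`. Expanding `∑ (p_α + π_α) f_{αβ}` with the deformed minors `f_{αβ}` then gives,
modulo `L`, `(P_m + P'_m)(z_{β+1} + ζ_{β+1}) - (P_{m+1} + P'_{m+1}) z_β = ∑ (p_α + π_α) f_{αβ} +
B_{m+1} z_β` with `B_{m+1} = P'_{m+1}(ζ, ζ, ρ) - P_{m+1}(ζ)` (`roll_mem`). So `B_{m+1}` is the
obstruction to rolling from `m` to `m + 1`. It can be added to the next equation as a constant, but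
for `m + 1 < b` this spoils the following roll; at the last index nothing follows. Hence only `1 ≤ m
≤ b - 1` gives conditions.

Existence. Over the base equations, the system with its last equations corrected rolls exactly
(`isRollingFamily`). Any such family is free (`free_familyIdeal`): its initial forms are those of
the cone (`free_of_initialForms`), because every relation between leading forms lifts. For the
scroll this is seen from an explicit parametrisation (`chart_initialForm`). A relation between the
`P^(n)_m` on the scroll amounts to sections `H_n` with `∑ H_n P^(n) = 0` in the Cox ring. The
equations form a regular sequence on both charts, and as `b_n ≥ 0`, local cohomology at `s = t = 0`
does not interfere in the weights that occur (`sections_initialIdeal`). So the relation is built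
from Koszul relations, which lift trivially, and from relations between the `s^{b-m} t^m`, which are
generated by swaps and rolls (`linked_of_invariant`) and lift by rolling (`mapFamily_mem_liftable`).

Necessity. Let an ideal `I` define an extension over `J`, and put `𝔪 = (ζ, ρ)`. Insert into the
identity above lifts to `I` of the minors and equations. What remains is an element of `I + J[z]`
with coefficients in `L + 𝔪²`; by flatness (`mem_mul_of_flat`) its coefficients in `z`-degree at
most one lie in `J + 𝔪³`. Its linear part is a relation among `z_β`, `z_{β+1}` and the `p_α`.
Multiplying by `p_β` and summing over `β`, the skew contribution of the minors cancels, leaving `a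
P_m + c P_{m+1} = 0`, which forces `a = c = 0` (`eq_zero_of_alternating`). Here `a` compares
`B_{m+1}` with the constant error of equation `m + 1`, and `c` is the constant error of equation
`m`. An interior equation is rolled both into and out of, so its `B_m` vanishes modulo `J + 𝔪³`.
When `J` is homogeneous, comparing quadratic parts removes `𝔪³`. -/

noncomputable section

namespace RollingFactors

/-! ### The filtration of a polynomial ring by the degree -/

/-- The polynomials of degree less than `q`. -/
def degreeLT (R σ : Type*) [CommRing R] (q : ℕ) : Submodule R (MvPolynomial σ R) :=
  restrictSupport R {e | e.degree < q}

section degreeLT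

variable {R σ : Type*} [CommRing R] {p f : MvPolynomial σ R} {a b e q : ℕ}

lemma monomial_eq_smul (u : σ →₀ ℕ) (r : R) :
    (monomial u r : MvPolynomial σ R) = r • monomial u 1 := by
  rw [smul_monomial, smul_eq_mul, mul_one]

lemma mem_degreeLT : p ∈ degreeLT R σ q ↔ ∀ e, coeff e p ≠ 0 → e.degree < q := by
  rw [degreeLT, mem_restrictSupport_iff]
  exact ⟨fun h e he => h (by simpa using he), fun h e he => h e (by simpa using he)⟩

lemma degreeLT_mono (h : a ≤ b) : degreeLT R σ a ≤ degreeLT R σ b := fun _ hp =>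
  mem_degreeLT.2 fun e he => (mem_degreeLT.1 hp e he).trans_le h

lemma IsHomogeneous.mem_degreeLT (hp : p.IsHomogeneous a) : p ∈ degreeLT R σ (a + 1) :=
  RollingFactors.mem_degreeLT.2 fun e he => by
    have := hp he
    have h := DFunLike.congr_fun (Finsupp.degree_eq_weight_one (σ := σ) (R := ℕ)) e
    have h' : e.degree = a := h.trans this
    omega

lemma mul_mem_degreeLT (hp : p ∈ degreeLT R σ (a + 1)) (hf : f ∈ degreeLT R σ b) :
    p * f ∈ degreeLT R σ (a + b) := by
  classical
  rw [mem_degreeLT] at *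
  intro e he
  rw [coeff_mul] at he
  obtain ⟨⟨u, v⟩, huv, hne⟩ := Finset.exists_ne_zero_of_sum_ne_zero he
  have h1 := hp u (left_ne_zero_of_mul hne)
  have h2 := hf v (right_ne_zero_of_mul hne)
  have huv : u + v = e := Finset.HasAntidiagonal.mem_antidiagonal.1 huv
  rw [← huv, map_add]
  change u.degree < _ at h1
  change v.degree < _ at h2
  omega

lemma mul_mem_degreeLT' (hp : p ∈ degreeLT R σ a) (hf : f ∈ degreeLT R σ (b + 1)) :
    p * f ∈ degreeLT R σ (a + b) := by
  rw [mul_comm, add_comm]; exact mul_mem_degreeLT hf hp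

lemma C_mul_mem_degreeLT (r : R) (hp : p ∈ degreeLT R σ a) : C r * p ∈ degreeLT R σ a := by
  rw [C_mul']; exact Submodule.smul_mem _ _ hp

lemma homogeneousComponent_of_mem_degreeLT (hp : p ∈ degreeLT R σ q) (h : q ≤ e) :
    homogeneousComponent e p = 0 :=
  homogeneousComponent_eq_zero' _ _ fun d hd => by
    have := mem_degreeLT.1 hp d (by simpa using hd)
    omega

lemma sub_homogeneousComponent_mem (hp : p ∈ degreeLT R σ (q + 1)) :
    p - homogeneousComponent q p ∈ degreeLT R σ q := by
  classical
  rw [mem_degreeLT] at *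
  intro e he
  rw [coeff_sub, coeff_homogeneousComponent] at he
  split_ifs at he with h
  · simp at he
  · have := hp e (by simpa using he)
    omega

lemma exists_mem_degreeLT (p : MvPolynomial σ R) : ∃ q, p ∈ degreeLT R σ q :=
  ⟨p.totalDegree + 1, mem_degreeLT.2 fun e he => by
    have := le_totalDegree (mem_support_iff.2 he)
    exact Nat.lt_succ_of_le this⟩

lemma homogeneousComponent_mul (hf : f.IsHomogeneous b) :
    homogeneousComponent (a + b) (p * f) = homogeneousComponent a p * f := by
  classical
  induction p using MvPolynomial.induction_on' with
  | monomial u r =>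
    have h1 : (monomial u r : MvPolynomial σ R).IsHomogeneous u.degree := isHomogeneous_monomial _ rfl
    rw [homogeneousComponent_of_mem (h1.mul hf), homogeneousComponent_of_mem h1]
    by_cases h : u.degree = a <;> simp [h]
  | add p q hp hq => rw [add_mul, map_add, map_add, hp, hq, add_mul]

lemma homogeneousComponent_mul_of_lt (hf : f.IsHomogeneous b) (h : a < b) :
    homogeneousComponent a (p * f) = 0 := by
  classical
  induction p using MvPolynomial.induction_on' with
  | monomial u r =>
    have h1 : (monomial u r : MvPolynomial σ R).IsHomogeneous u.degree := isHomogeneous_monomial _ rfl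
    rw [homogeneousComponent_of_mem (h1.mul hf), if_neg (by omega)]
  | add p q hp hq => rw [add_mul, map_add, hp, hq, add_zero]

end degreeLT

/-! ### Coefficientwise application of a linear form -/

section mapCoeff

variable {K R σ : Type*} [Field K] [CommRing R] [Algebra K R]

/-- The linear form `lam` applied to the coefficients of a polynomial. -/
def mapCoeff (σ : Type*) (lam : R →ₗ[K] K) : MvPolynomial σ R →ₗ[K] MvPolynomial σ K where
  toFun p := AddMonoidAlgebra.map lam.toAddMonoidHom p
  map_add' p q := by
    ext e
    exact map_add lam _ _
  map_smul' c p := by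
    ext e
    exact map_smul lam _ _

@[simp] lemma coeff_mapCoeff (lam : R →ₗ[K] K) (p : MvPolynomial σ R) (e : σ →₀ ℕ) :
    coeff e (mapCoeff σ lam p) = lam (coeff e p) := rfl

lemma mapCoeff_mul_map (lam : R →ₗ[K] K) (p : MvPolynomial σ R) (f : MvPolynomial σ K) :
    mapCoeff σ lam (p * map (algebraMap K R) f) = mapCoeff σ lam p * f := by
  classical
  ext e
  rw [coeff_mapCoeff, coeff_mul, coeff_mul, map_sum]
  refine Finset.sum_congr rfl fun x _ => ?_
  rw [coeff_map, coeff_mapCoeff, mul_comm (coeff x.1 p), ← Algebra.smul_def, map_smul, smul_eq_mul,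
    mul_comm]

/-- Linear forms separate the elements of `R`, and applying one to coefficients commutes with
multiplication by polynomials over `K`. Questions over `R` about ideals defined over `K` can thus be
moved to the field. -/
lemma mapCoeff_mem {I : Ideal (MvPolynomial σ K)} (lam : R →ₗ[K] K) {p : MvPolynomial σ R}
    (hp : p ∈ I.map (map (algebraMap K R))) : mapCoeff σ lam p ∈ I := by
  suffices h : ∀ g, mapCoeff σ lam (g * p) ∈ I by simpa using h 1
  refine Submodule.span_induction (p := fun p _ => ∀ g, mapCoeff σ lam (g * p) ∈ I) ?_ ?_ ?_ ?_ hp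
  · rintro _ ⟨f, hf, rfl⟩ g
    rw [mapCoeff_mul_map]
    exact I.mul_mem_left _ hf
  · intro g; simp
  · intro x y _ _ hx hy g
    rw [mul_add, map_add]; exact I.add_mem (hx g) (hy g)
  · intro c x _ hx g
    rw [smul_eq_mul, ← mul_assoc]; exact hx _

end mapCoeff

/-! ### A criterion for freeness -/

section Free

variable {K R σ : Type*} [Field K] [CommRing R] [Algebra K R]

/-- If the initial forms of the elements of `I` are the same as those of the homogeneous ideal
`I₀`, defined over a field, then the quotient by `I` is free. -/
theorem free_of_initialForms {I₀ : Ideal (MvPolynomial σ K)} {I : Ideal (MvPolynomial σ R)}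
    (hlift : ∀ f ∈ I₀, ∀ e, ∃ x ∈ I,
      x - map (algebraMap K R) (homogeneousComponent e f) ∈ degreeLT R σ e)
    (hinit : ∀ e, ∀ x ∈ I, x ∈ degreeLT R σ (e + 1) →
      homogeneousComponent e x ∈ I₀.map (map (algebraMap K R))) :
    Module.Free R (MvPolynomial σ R ⧸ I) := by
  classical
  -- Monomials forming a `K`-basis of the quotient by `I₀`; the same monomials will be an `R`-basis
  -- of the quotient by `I`.
  obtain ⟨κ, a, ha, hspan, hind⟩ := exists_linearIndependent' K
    (fun u : σ →₀ ℕ => Ideal.Quotient.mk I₀ (monomial u 1))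
  have hfind : ∀ c : κ →₀ K, (c.sum fun j r => monomial (a j) r) ∈ I₀ → c = 0 := by
    intro c hc
    refine linearIndependent_iff.1 hind c ?_
    rw [← Ideal.Quotient.eq_zero_iff_mem] at hc
    rw [← hc, Finsupp.linearCombination_apply, Finsupp.sum, Finsupp.sum, map_sum]
    refine Finset.sum_congr rfl fun j _ => ?_
    rw [monomial_eq_smul]; rfl
  let v : κ → MvPolynomial σ R ⧸ I := fun j => Ideal.Quotient.mk I (monomial (a j) 1)
  have hv : ∀ c : κ →₀ R, Finsupp.linearCombination R v c =
      Ideal.Quotient.mk I (c.sum fun j r => monomial (a j) r) := by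
    intro c
    rw [Finsupp.linearCombination_apply, Finsupp.sum, Finsupp.sum, map_sum]
    refine Finset.sum_congr rfl fun j _ => ?_
    rw [monomial_eq_smul]; rfl
  have hcoeff : ∀ (c : κ →₀ R) (j : κ), coeff (a j) (c.sum fun j r => monomial (a j) r) = c j := by
    intro c j
    rw [Finsupp.sum, coeff_sum]
    simp only [coeff_monomial, ha.eq_iff]
    rw [Finset.sum_ite_eq']
    simp +contextual
  have hli : LinearIndependent R v := by
    rw [linearIndependent_iff]
    intro c hc
    rw [hv, Ideal.Quotient.eq_zero_iff_mem] at hc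
    suffices H : ∀ q, (c.sum fun j r => monomial (a j) r) ∈ degreeLT R σ q → c = 0 by
      obtain ⟨q, hq⟩ := exists_mem_degreeLT (c.sum fun j r => monomial (a j) r)
      exact H q hq
    intro q
    induction q with
    | zero =>
      intro hq
      ext j
      by_contra hne
      exact absurd (mem_degreeLT.1 hq (a j) (by rwa [hcoeff])) (by omega)
    | succ q ih =>
      intro hq
      -- The top-degree part of a relation lies in the extension of `I₀`. A linear form turns it
      -- into a relation over `K` between basis monomials, so every linear form kills the top
      -- coefficients.
      have h1 := hinit q _ hc hq
      have h2 : ∀ j, (a j).degree = q → c j = 0 := by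
        intro j hj
        rw [← Module.forall_dual_apply_eq_zero_iff K]
        intro lam
        have h3 := mapCoeff_mem lam h1
        let c' : κ →₀ K := (c.filter fun j => (a j).degree = q).mapRange lam (map_zero _)
        have h4 : mapCoeff σ lam (homogeneousComponent q (c.sum fun j r => monomial (a j) r)) =
            c'.sum fun j r => monomial (a j) r := by
          ext e
          rw [coeff_mapCoeff, coeff_homogeneousComponent]
          by_cases he : e ∈ Set.range a
          · obtain ⟨i, rfl⟩ := he
            rw [hcoeff]
            have : coeff (a i) (c'.sum fun j r => monomial (a j) r) = c' i := by
              rw [Finsupp.sum, coeff_sum]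
              simp only [coeff_monomial, ha.eq_iff]
              rw [Finset.sum_ite_eq']
              simp +contextual
            rw [this]
            simp only [c', Finsupp.mapRange_apply, Finsupp.filter_apply]
          · have h5 : ∀ {S : Type _} [CommRing S] (c : κ →₀ S),
                coeff e (c.sum fun j r => monomial (a j) r) = 0 := by
              intro S _ c
              rw [Finsupp.sum, coeff_sum]
              refine Finset.sum_eq_zero fun j _ => ?_
              rw [coeff_monomial, if_neg]
              rintro rfl
              exact he ⟨j, rfl⟩
            have h6 : coeff e (c'.sum fun j r => monomial (a j) r) = 0 := by
              rw [Finsupp.sum, coeff_sum]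
              refine Finset.sum_eq_zero fun j _ => ?_
              rw [coeff_monomial, if_neg]
              rintro rfl
              exact he ⟨j, rfl⟩
            rw [h5, h6]
            simp
        rw [h4] at h3
        have := DFunLike.congr_fun (hfind c' h3) j
        simpa [c', hj] using this
      refine ih (mem_degreeLT.2 fun e he => ?_)
      have h3 := mem_degreeLT.1 hq e he
      rw [Finsupp.sum, coeff_sum] at he
      obtain ⟨j, _, hj⟩ := Finset.exists_ne_zero_of_sum_ne_zero he
      rw [coeff_monomial] at hj
      split_ifs at hj with hje
      · have : (a j).degree ≠ q := fun h => hj (h2 j h)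
        rw [hje] at this
        omega
      · exact absurd rfl hj
  have hsp : ⊤ ≤ Submodule.span R (Set.range v) := by
    have key : ∀ q, ∀ p ∈ degreeLT R σ q, Ideal.Quotient.mk I p ∈ Submodule.span R (Set.range v) := by
      intro q
      induction q with
      | zero =>
        intro p hp
        have : p = 0 := by
          ext e
          by_contra hne
          exact absurd (mem_degreeLT.1 hp e hne) (by omega)
        rw [this, map_zero]; exact Submodule.zero_mem _
      | succ q ih =>
        have hmono : ∀ u : σ →₀ ℕ, u.degree < q + 1 →
            Ideal.Quotient.mk I (monomial u 1) ∈ Submodule.span R (Set.range v) := by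
          intro u hu
          by_cases hu' : u.degree < q
          · refine ih _ (mem_degreeLT.2 fun e he => ?_)
            rw [coeff_monomial] at he
            split_ifs at he with h
            · rwa [← h]
            · exact absurd rfl he
          have huq : u.degree = q := by omega
          have h1 : Ideal.Quotient.mk I₀ (monomial u 1) ∈ Submodule.span K
              (Set.range ((fun u : σ →₀ ℕ => Ideal.Quotient.mk I₀ (monomial u 1)) ∘ a)) := by
            rw [hspan]; exact Submodule.subset_span ⟨u, rfl⟩
          obtain ⟨c, hc⟩ := (Finsupp.mem_span_range_iff_exists_finsupp).1 h1
          have h2 : monomial u 1 - c.sum (fun j r => monomial (a j) r) ∈ I₀ := by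
            rw [← Ideal.Quotient.eq, ← hc, Finsupp.sum, Finsupp.sum, map_sum]
            refine Finset.sum_congr rfl fun j _ => ?_
            rw [monomial_eq_smul]; rfl
          -- The degree-`q` part of the rewriting over `K` lifts to an element of `I`. Modulo `I`
          -- the monomial is therefore a combination of basis monomials plus terms of lower degree.
          obtain ⟨x, hx, hxd⟩ := hlift _ h2 q
          have h3 : map (algebraMap K R) (homogeneousComponent q
              (monomial u 1 - c.sum (fun j r => monomial (a j) r))) =
              monomial u 1 - ∑ j ∈ c.support with (a j).degree = q,
                monomial (a j) (algebraMap K R (c j)) := by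
            have hm : ∀ (u : σ →₀ ℕ) (r : K), homogeneousComponent q (monomial u r) =
                if u.degree = q then monomial u r else 0 := by
              intro u r
              have h1 : (monomial u r : MvPolynomial σ K).IsHomogeneous u.degree :=
                isHomogeneous_monomial _ rfl
              rw [homogeneousComponent_of_mem h1]
              simp only [eq_comm]
            rw [map_sub, hm, if_pos huq, map_sub, map_monomial, map_one, Finsupp.sum, map_sum,
              map_sum, Finset.sum_filter]
            congr 1
            refine Finset.sum_congr rfl fun j _ => ?_
            rw [hm]
            split_ifs
            · rw [map_monomial]
            · rw [map_zero]
          rw [h3] at hxd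
          have h4 := ih _ hxd
          rw [map_sub, map_sub, Ideal.Quotient.eq_zero_iff_mem.2 hx, zero_sub,
            Submodule.neg_mem_iff] at h4
          rw [← sub_add_cancel (Ideal.Quotient.mk I (monomial u 1)) (Ideal.Quotient.mk I
            (∑ j ∈ c.support with (a j).degree = q, monomial (a j) (algebraMap K R (c j))))]
          refine Submodule.add_mem _ h4 ?_
          rw [map_sum]
          refine Submodule.sum_mem _ fun j _ => ?_
          rw [monomial_eq_smul]
          exact Submodule.smul_mem _ _ (Submodule.subset_span (Set.mem_range_self j))
        intro p hp
        rw [p.as_sum, map_sum]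
        refine Submodule.sum_mem _ fun u hu => ?_
        rw [monomial_eq_smul]
        exact Submodule.smul_mem _ _ (hmono u (mem_degreeLT.1 hp u (by simpa using hu)))
    rintro x -
    obtain ⟨p, rfl⟩ := Ideal.Quotient.mk_surjective x
    obtain ⟨q, hq⟩ := exists_mem_degreeLT p
    exact key q p hq
  exact Module.Free.of_basis (Module.Basis.mk hli hsp)

end Free

/-! ### Bihomogeneous elements of the Cox ring -/

section Weighted

variable {R σ M : Type*} [CommRing R] [AddCommGroup M] {w : σ → M} {p f : MvPolynomial σ R} {a b : M}

lemma weightedHomogeneousComponent_mul (hf : IsWeightedHomogeneous w f b) :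
    weightedHomogeneousComponent w a (p * f) = weightedHomogeneousComponent w (a - b) p * f := by
  classical
  induction p using MvPolynomial.induction_on' with
  | monomial u r =>
    have h1 : IsWeightedHomogeneous w (monomial u r) (Finsupp.weight w u) :=
      isWeightedHomogeneous_monomial _ _ _ rfl
    rw [weightedHomogeneousComponent_of_mem (h1.mul hf), weightedHomogeneousComponent_of_mem h1]
    by_cases h : a - b = Finsupp.weight w u
    · rw [if_pos h, if_pos (by rw [← h]; abel)]
    · rw [if_neg h, if_neg (fun h' => h (by rw [h']; abel)), zero_mul]
  | add p q hp hq => rw [add_mul, map_add, map_add, hp, hq, add_mul]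

/-- A homogeneous element of an ideal generated by homogeneous elements is a combination of these
with homogeneous coefficients. -/
lemma exists_homogeneous_coeffs {ι : Type*} [Fintype ι] {g : ι → MvPolynomial σ R} {D : ι → M}
    (hg : ∀ i, IsWeightedHomogeneous w (g i) (D i)) (hp : IsWeightedHomogeneous w p a)
    (hmem : p ∈ Ideal.span (Set.range g)) :
    ∃ c : ι → MvPolynomial σ R, (∀ i, IsWeightedHomogeneous w (c i) (a - D i)) ∧
      p = ∑ i, c i * g i := by
  obtain ⟨c, hc⟩ := (Submodule.mem_span_range_iff_exists_fun _).1 hmem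
  refine ⟨fun i => weightedHomogeneousComponent w (a - D i) (c i), fun i =>
    weightedHomogeneousComponent_isWeightedHomogeneous _ _, ?_⟩
  rw [← weightedHomogeneousComponent_eq_self hp, ← hc, map_sum]
  refine Finset.sum_congr rfl fun i _ => ?_
  rw [smul_eq_mul, weightedHomogeneousComponent_mul (hg i)]

/-- The ideal `I` is stable under taking weighted homogeneous components. -/
def ComponentStable (w : σ → M) (I : Ideal (MvPolynomial σ R)) : Prop :=
  ∀ p ∈ I, ∀ a, weightedHomogeneousComponent w a p ∈ I

lemma componentStable_span {S : Set (MvPolynomial σ R)}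
    (hS : ∀ f ∈ S, ∃ b, IsWeightedHomogeneous w f b) : ComponentStable w (Ideal.span S) := by
  intro p hp a
  suffices h : ∀ g a, weightedHomogeneousComponent w a (g * p) ∈ Ideal.span S by simpa using h 1 a
  refine Submodule.span_induction
    (p := fun p _ => ∀ g a, weightedHomogeneousComponent w a (g * p) ∈ Ideal.span S) ?_ ?_ ?_ ?_ hp
  · intro f hf g a
    obtain ⟨b, hb⟩ := hS f hf
    rw [weightedHomogeneousComponent_mul hb]
    exact Ideal.mul_mem_left _ _ (Ideal.subset_span hf)
  · intro g a; simp
  · intro x y _ _ hx hy g a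
    rw [mul_add, map_add]; exact Ideal.add_mem _ (hx g a) (hy g a)
  · intro c x _ hx g a
    rw [smul_eq_mul, ← mul_assoc]; exact hx _ _

/-- A homogeneous element of `I + (f)` is congruent modulo `I` to a multiple of `f` with homogeneous
coefficient. -/
lemma ComponentStable.exists_sub_mul_mem {I : Ideal (MvPolynomial σ R)} (hI : ComponentStable w I)
    (hf : IsWeightedHomogeneous w f b) (hp : IsWeightedHomogeneous w p a)
    (hmem : p ∈ I ⊔ Ideal.span {f}) :
    ∃ c, IsWeightedHomogeneous w c (a - b) ∧ p - c * f ∈ I := by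
  obtain ⟨x, hx, y, hy, hxy⟩ := Submodule.mem_sup.1 hmem
  obtain ⟨c, rfl⟩ := Ideal.mem_span_singleton'.1 hy
  refine ⟨weightedHomogeneousComponent w (a - b) c,
    weightedHomogeneousComponent_isWeightedHomogeneous _ _, ?_⟩
  rw [← weightedHomogeneousComponent_mul hf, ← weightedHomogeneousComponent_eq_self hp,
    ← map_sub, ← hxy, add_sub_cancel_right]
  exact hI x hx a

end Weighted

variable {K : Type*} [Field K] {k l : ℕ}

/-- The bidegrees of the Cox coordinates of the scroll: the degree in the `z^(i)`, and the weight for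
which `s, t` have weight `1` and `z^(i)` has weight `-d i`. -/
def bidegree (d : Fin k → ℕ) : CoxVar k → ℤ × ℤ :=
  Sum.elim (fun _ => (0, 1)) (fun i => (1, -(d i : ℤ)))

lemma weight_bidegree (d : Fin k → ℕ) (e : CoxVar k →₀ ℕ) :
    Finsupp.weight (bidegree d) e =
      (((Finsupp.weight (Sum.elim (fun _ => 0) (fun _ => 1) : CoxVar k → ℕ) e : ℕ) : ℤ),
        Finsupp.weight (Sum.elim (fun _ => 1) (fun i => -(d i : ℤ)) : CoxVar k → ℤ) e) := by
  rw [Finsupp.weight_apply, Finsupp.weight_apply, Finsupp.weight_apply, Finsupp.sum, Finsupp.sum,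
    Finsupp.sum]
  ext
  · simp only [Prod.fst_sum, Nat.cast_sum]
    refine Finset.sum_congr rfl fun i _ => ?_
    cases i <;> simp [bidegree]
  · simp only [Prod.snd_sum]
    refine Finset.sum_congr rfl fun i _ => ?_
    cases i <;> simp [bidegree]

lemma weight_bidegree_snd (d : Fin k → ℕ) (e : CoxVar k →₀ ℕ) :
    (Finsupp.weight (bidegree d) e).2 = (e (sVar k) : ℤ) + e (tVar k) -
      ∑ i, (d i : ℤ) * e (Sum.inr i) := by
  rw [weight_bidegree]
  dsimp only
  rw [Finsupp.weight_apply, Finsupp.sum_fintype _ _ (by simp), Fintype.sum_sum_type,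
    Fin.sum_univ_two]
  simp [sVar, tVar, sub_eq_add_neg, mul_comm]

lemma weight_bidegree_fst (d : Fin k → ℕ) (e : CoxVar k →₀ ℕ) :
    (Finsupp.weight (bidegree d) e).1 = ∑ i, (e (Sum.inr i) : ℤ) := by
  rw [weight_bidegree]
  dsimp only
  rw [Finsupp.weight_apply, Finsupp.sum_fintype _ _ (by simp), Fintype.sum_sum_type,
    Fin.sum_univ_two]
  simp

lemma IsDivisorEquation.bidegree {d : Fin k → ℕ} {b : ℕ} {P : MvPolynomial (CoxVar k) K}
    (h : IsDivisorEquation d b P) :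
    IsWeightedHomogeneous (bidegree d) P (2, -(b : ℤ)) := by
  intro e he
  rw [weight_bidegree, h.1 he, h.2 he]
  rfl

lemma isWeightedHomogeneous_sVar (d : Fin k → ℕ) :
    IsWeightedHomogeneous (bidegree d) (X (sVar k) : MvPolynomial (CoxVar k) K) (0, 1) :=
  isWeightedHomogeneous_X _ _ _

lemma isWeightedHomogeneous_tVar (d : Fin k → ℕ) :
    IsWeightedHomogeneous (bidegree d) (X (tVar k) : MvPolynomial (CoxVar k) K) (0, 1) :=
  isWeightedHomogeneous_X _ _ _

/-- A homogeneous element of positive weight lies in the ideal `(s, t)`. -/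
lemma exists_eq_of_weight_pos {d : Fin k → ℕ} {x : MvPolynomial (CoxVar k) K} {q r : ℤ} (hr : 1 ≤ r)
    (hx : IsWeightedHomogeneous (bidegree d) x (q, r)) :
    ∃ a b, IsWeightedHomogeneous (bidegree d) a (q, r - 1) ∧
      IsWeightedHomogeneous (bidegree d) b (q, r - 1) ∧ x = X (tVar k) * a - X (sVar k) * b := by
  have hmem : x ∈ Ideal.span (X '' {sVar k, tVar k} : Set (MvPolynomial (CoxVar k) K)) := by
    rw [mem_ideal_span_X_image]
    intro e he
    by_contra! hcon
    -- The `z^(i)` have weight `-d i ≤ 0`, so a monomial containing neither `s` nor `t` cannot have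
    -- positive weight.
    have h1 := weight_bidegree_snd d e
    rw [hx (by simpa using he), hcon _ (by simp), hcon _ (by simp)] at h1
    have h2 : 0 ≤ ∑ i, (d i : ℤ) * e (Sum.inr i) := Finset.sum_nonneg fun i _ => by positivity
    simp only [Nat.cast_zero] at h1
    omega
  rw [Set.image_pair, Ideal.mem_span_pair] at hmem
  obtain ⟨a, b, hab⟩ := hmem
  refine ⟨weightedHomogeneousComponent (bidegree d) (q, r - 1) b,
    -weightedHomogeneousComponent (bidegree d) (q, r - 1) a,
    weightedHomogeneousComponent_isWeightedHomogeneous _ _,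
    (weightedHomogeneousComponent_isWeightedHomogeneous _ _).neg, ?_⟩
  have h1 := weightedHomogeneousComponent_mul (p := a) (a := (q, r)) (isWeightedHomogeneous_sVar (K := K) d)
  have h2 := weightedHomogeneousComponent_mul (p := b) (a := (q, r)) (isWeightedHomogeneous_tVar (K := K) d)
  rw [← weightedHomogeneousComponent_eq_self hx, ← hab, map_add, h1, h2]
  simp only [Prod.mk_sub_mk, sub_zero]
  ring

/-! ### Local cohomology of the complete intersection at `s = t = 0` -/

/-- The ideal generated by the first `n` equations. -/
def initialIdeal (P : Fin l → MvPolynomial (CoxVar k) K) (n : ℕ) :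
    Ideal (MvPolynomial (CoxVar k) K) :=
  Ideal.span {f | ∃ i : Fin l, (i : ℕ) < n ∧ f = P i}

lemma initialIdeal_zero (P : Fin l → MvPolynomial (CoxVar k) K) : initialIdeal P 0 = ⊥ := by
  rw [initialIdeal, Ideal.span_eq_bot]
  rintro _ ⟨i, hi, -⟩
  omega

lemma initialIdeal_succ (P : Fin l → MvPolynomial (CoxVar k) K) (n : Fin l) :
    initialIdeal P (n + 1) = initialIdeal P n ⊔ Ideal.span {P n} := by
  rw [initialIdeal, initialIdeal, ← Ideal.span_union]
  congr 1
  ext f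
  constructor
  · rintro ⟨i, hi, rfl⟩
    rcases (Nat.lt_succ_iff_lt_or_eq).1 hi with h | h
    · exact Or.inl ⟨i, h, rfl⟩
    · right; rw [Fin.ext h]; rfl
  · rintro (⟨i, hi, rfl⟩ | h)
    · exact ⟨i, by omega, rfl⟩
    · exact ⟨n, by omega, h⟩

section Chart

variable {P : Fin l → MvPolynomial (CoxVar k) K}

/-- Regularity is assumed only after inverting `y`; clearing denominators costs a power of `y`. -/
lemma exists_pow_mul_mem {y : MvPolynomial (CoxVar k) K}
    (h : RingTheory.Sequence.IsWeaklyRegular (Localization.Away y) (List.ofFn P))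
    (n : Fin l) {g : MvPolynomial (CoxVar k) K} (hg : g * P n ∈ initialIdeal P n) :
    ∃ N, y ^ N * g ∈ initialIdeal P n := by
  have hlen : (n : ℕ) < (List.ofFn P).length := by simp
  have h1 := h.regular_mod_prev n hlen
  have hof : Ideal.ofList ((List.ofFn P).take n) = initialIdeal P n := by
    rw [Ideal.ofList, initialIdeal]
    congr 1
    ext f
    simp only [Set.mem_ofPred_eq, List.mem_take_iff_getElem, List.getElem_ofFn, List.length_ofFn]
    constructor
    · rintro ⟨i, hi, rfl⟩
      exact ⟨⟨i, by omega⟩, by simp; omega, rfl⟩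
    · rintro ⟨i, hi, rfl⟩
      exact ⟨i, by omega, rfl⟩
  rw [hof, List.getElem_ofFn, isSMulRegular_quotient_iff_mem_of_smul_mem] at h1
  have h2 := h1 (algebraMap _ _ g) (by
    rw [Ideal.smul_top_eq_map, Submodule.restrictScalars_mem, Algebra.smul_def, ← map_mul, mul_comm]
    exact Ideal.mem_map_of_mem _ hg)
  rw [Ideal.smul_top_eq_map, Submodule.restrictScalars_mem,
    IsLocalization.algebraMap_mem_map_algebraMap_iff (Submonoid.powers y)] at h2
  obtain ⟨_, ⟨N, rfl⟩, hN⟩ := h2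
  exact ⟨N, hN⟩

variable {d : Fin k → ℕ} {b : Fin l → ℕ}

lemma componentStable_initialIdeal (hP : ∀ n, IsDivisorEquation d (b n) (P n)) (n : ℕ) :
    ComponentStable (bidegree d) (initialIdeal P n) :=
  componentStable_span (by
    rintro _ ⟨i, -, rfl⟩
    exact ⟨_, (hP i).bidegree⟩)

/-- The ideal `I` has no sections supported on `s = t = 0`, in weights at least `-1`. -/
def SectionsSeparated (d : Fin k → ℕ) (I : Ideal (MvPolynomial (CoxVar k) K)) : Prop :=
  ∀ (g : MvPolynomial (CoxVar k) K) (q r : ℤ), -1 ≤ r → IsWeightedHomogeneous (bidegree d) g (q, r) →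
    X (sVar k) * g ∈ I → X (tVar k) * g ∈ I → g ∈ I

/-- Sections modulo `I` of weight at least `-1` can be glued from the two charts. -/
def SectionsGlue (d : Fin k → ℕ) (I : Ideal (MvPolynomial (CoxVar k) K)) : Prop :=
  ∀ (u v : MvPolynomial (CoxVar k) K) (q r : ℤ), 0 ≤ r →
    IsWeightedHomogeneous (bidegree d) u (q, r) → IsWeightedHomogeneous (bidegree d) v (q, r) →
    X (tVar k) * u - X (sVar k) * v ∈ I →
    ∃ y, IsWeightedHomogeneous (bidegree d) y (q, r - 1) ∧ u - X (sVar k) * y ∈ I ∧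
      v - X (tVar k) * y ∈ I

lemma SectionsSeparated.mem_of_pow {I : Ideal (MvPolynomial (CoxVar k) K)}
    (hI : SectionsSeparated d I) (N : ℕ) : ∀ (a b : ℕ), a + b ≤ N →
    ∀ (g : MvPolynomial (CoxVar k) K) (q r : ℤ), -1 ≤ r →
    IsWeightedHomogeneous (bidegree d) g (q, r) →
    X (sVar k) ^ a * g ∈ I → X (tVar k) ^ b * g ∈ I → g ∈ I := by
  induction N with
  | zero =>
    intro a b hab g q r _ _ ha _
    obtain rfl : a = 0 := by omega
    simpa using ha
  | succ N ih =>
    intro a b hab g q r hr hg ha hb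
    rcases a with _ | a
    · simpa using ha
    rcases b with _ | b
    · simpa using hb
    have hs := (isWeightedHomogeneous_sVar (K := K) d).mul hg
    have ht := (isWeightedHomogeneous_tVar (K := K) d).mul hg
    simp only [Prod.mk_add_mk, zero_add] at hs ht
    refine hI g q r hr hg (ih a (b + 1) (by omega) _ q (1 + r) (by omega) hs ?_ ?_)
      (ih (a + 1) b (by omega) _ q (1 + r) (by omega) ht ?_ ?_)
    · rw [← mul_assoc, ← pow_succ]; exact ha
    · rw [mul_left_comm]; exact I.mul_mem_left _ hb
    · rw [mul_left_comm]; exact I.mul_mem_left _ ha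
    · rw [← mul_assoc, ← pow_succ]; exact hb

lemma mem_initialIdeal_of_mul_mem (hP : IsCompleteIntersection P) (n : Fin l)
    (hsep : SectionsSeparated d (initialIdeal P n)) {g : MvPolynomial (CoxVar k) K} {q r : ℤ}
    (hr : -1 ≤ r) (hg : IsWeightedHomogeneous (bidegree d) g (q, r))
    (hmem : g * P n ∈ initialIdeal P n) : g ∈ initialIdeal P n := by
  obtain ⟨N, hN⟩ := exists_pow_mul_mem hP.1 n hmem
  obtain ⟨M, hM⟩ := exists_pow_mul_mem hP.2 n hmem
  exact hsep.mem_of_pow (N + M) N M le_rfl g q r hr hg hN hM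

/-- In the polynomial ring `s` is a prime not dividing `t`, so `t u = s v` forces `s ∣ u`. -/
lemma sections_bot : SectionsSeparated (K := K) d ⊥ ∧ SectionsGlue (K := K) d ⊥ := by
  constructor
  · intro g q r _ _ hs _
    simpa using hs
  · intro u v q r _ hu hv h
    rw [Ideal.mem_bot, sub_eq_zero] at h
    have h1 : (X (sVar k) : MvPolynomial (CoxVar k) K) ∣ X (tVar k) * u := ⟨v, h⟩
    rcases (X_prime (R := K) (i := sVar k)).dvd_or_dvd h1 with h2 | ⟨y, rfl⟩
    · rw [X_dvd_X] at h2
      rcases h2 with h2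
      simp [sVar, tVar] at h2
    · have h3 : v = X (tVar k) * y := by
        refine mul_left_cancel₀ (X_ne_zero (sVar k)) ?_
        rw [← h]; ring
      subst h3
      have h4 := weightedHomogeneousComponent_mul (p := y) (a := (q, r))
        (isWeightedHomogeneous_sVar (K := K) d)
      rw [mul_comm y, weightedHomogeneousComponent_eq_self hu, mul_comm] at h4
      have h5 := mul_right_cancel₀ (X_ne_zero (sVar k)) h4
      refine ⟨y, ?_, by simp, by simp⟩
      rw [h5]
      have := weightedHomogeneousComponent_isWeightedHomogeneous (w := bidegree d) ((q, r) - (0, 1)) y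
      simpa only [Prod.mk_sub_mk, sub_zero] using this

/-- The vanishing of local cohomology: sections modulo the first `n` equations, of weight at least
`-1`, are determined on the charts and glue. -/
theorem sections_initialIdeal (hd : ∀ n, IsDivisorEquation d (b n) (P n))
    (hP : IsCompleteIntersection P) (n : ℕ) (hn : n ≤ l) :
    SectionsSeparated d (initialIdeal P n) ∧ SectionsGlue d (initialIdeal P n) := by
  induction n with
  | zero => rw [initialIdeal_zero]; exact sections_bot
  | succ n ih =>
    obtain ⟨hsep, hglue⟩ := ih (by omega)
    set m : Fin l := ⟨n, by omega⟩
    have hst := componentStable_initialIdeal hd n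
    have hPm := (hd m).bidegree
    have hs := isWeightedHomogeneous_sVar (K := K) d
    have ht := isWeightedHomogeneous_tVar (K := K) d
    have hsucc : initialIdeal P (n + 1) = initialIdeal P n ⊔ Ideal.span {P m} :=
      initialIdeal_succ P m
    have hadd : ∀ x c, x - c * P m ∈ initialIdeal P n → x ∈ initialIdeal P (n + 1) := by
      intro x c h
      rw [hsucc, ← sub_add_cancel x (c * P m)]
      exact Submodule.add_mem_sup h (Ideal.mem_span_singleton'.2 ⟨c, rfl⟩)
    constructor
    · intro g q r hr hg h1 h2
      rw [hsucc] at h1 h2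
      obtain ⟨u, hu, hu'⟩ := hst.exists_sub_mul_mem hPm (hs.mul hg) h1
      obtain ⟨v, hv, hv'⟩ := hst.exists_sub_mul_mem hPm (ht.mul hg) h2
      simp only [Prod.mk_add_mk, Prod.mk_sub_mk] at hu hv
      have h3 : (X (tVar k) * u - X (sVar k) * v) * P m ∈ initialIdeal P n := by
        have : (X (tVar k) * u - X (sVar k) * v) * P m =
          X (sVar k) * (X (tVar k) * g - v * P m) - X (tVar k) * (X (sVar k) * g - u * P m) := by ring
        rw [this]
        exact sub_mem (Ideal.mul_mem_left _ _ hv') (Ideal.mul_mem_left _ _ hu')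
      -- The weights of `u` and `v` are `r + 1 + b m`. Since `b m ≥ 0` and `r ≥ -1`, they are
      -- nonnegative, which is what gluing modulo the previous equations asks for.
      have h4 := mem_initialIdeal_of_mul_mem hP m hsep (by omega)
        ((ht.mul hu).sub (hs.mul hv)) h3
      obtain ⟨y, hy, hy1, hy2⟩ := hglue u v _ _ (by omega) hu hv h4
      refine hadd g y (hsep _ q r hr (hg.sub ?_) ?_ ?_)
      · have := hy.mul hPm
        simp only [Prod.mk_add_mk] at this
        rwa [show (0 + q - 2 + 2 : ℤ) = q by ring,
          show (1 + r - -(b m : ℤ) - 1 + -(b m : ℤ)) = r by ring] at this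
      · have : X (sVar k) * (g - y * P m) = (X (sVar k) * g - u * P m) +
          (u - X (sVar k) * y) * P m := by ring
        rw [this]
        exact add_mem hu' (Ideal.mul_mem_right _ _ hy1)
      · have : X (tVar k) * (g - y * P m) = (X (tVar k) * g - v * P m) +
          (v - X (tVar k) * y) * P m := by ring
        rw [this]
        exact add_mem hv' (Ideal.mul_mem_right _ _ hy2)
    · intro u v q r hr hu hv h
      rw [hsucc] at h
      obtain ⟨x, hx, hx'⟩ := hst.exists_sub_mul_mem hPm ((ht.mul hu).sub (hs.mul hv)) h
      simp only [Prod.mk_add_mk, Prod.mk_sub_mk] at hx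
      -- The coefficient of `P m` has weight `r + 1 + b m ≥ 1`, hence can be written `t y - s z`.
      -- Replacing `u`, `v` by `u - y P`, `v - z P` makes them compatible modulo the previous
      -- equations alone.
      obtain ⟨y, z, hy, hz, rfl⟩ := exists_eq_of_weight_pos (by omega) hx
      have hyP := hy.mul hPm
      have hzP := hz.mul hPm
      simp only [Prod.mk_add_mk] at hyP hzP
      have e1 : (0 + q - 2 + 2 : ℤ) = q := by ring
      have e2 : (1 + r - -(b m : ℤ) - 1 + -(b m : ℤ)) = r := by ring
      rw [e1, e2] at hyP hzP
      obtain ⟨c, hc, hc1, hc2⟩ := hglue (u - y * P m) (v - z * P m) q r hr (hu.sub hyP) (hv.sub hzP)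
        (by convert hx' using 1; ring)
      refine ⟨c, hc, hadd _ y ?_, hadd _ z ?_⟩
      · convert hc1 using 1; ring
      · convert hc2 using 1; ring

/-- Multiplication by an equation is injective modulo the previous ones, in weights at least `-1`. -/
theorem mem_initialIdeal_of_mul_mem' (hd : ∀ n, IsDivisorEquation d (b n) (P n))
    (hP : IsCompleteIntersection P) (n : Fin l) {g : MvPolynomial (CoxVar k) K} {q r : ℤ}
    (hr : -1 ≤ r) (hg : IsWeightedHomogeneous (bidegree d) g (q, r))
    (hmem : g * P n ∈ initialIdeal P n) : g ∈ initialIdeal P n :=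
  mem_initialIdeal_of_mul_mem hP n (sections_initialIdeal hd hP n n.2.le).1 hr hg hmem

/-- The equations of a complete intersection do not vanish. -/
theorem IsCompleteIntersection.ne_zero (hd : ∀ n, IsDivisorEquation d (b n) (P n))
    (hP : IsCompleteIntersection P) (n : Fin l) : P n ≠ 0 := by
  intro h
  -- If `P n` were zero, regularity would put `1` into the ideal of the previous equations, which
  -- have no constant term because they are quadratic in the `z^(i)`.
  have h1 := mem_initialIdeal_of_mul_mem' hd hP n (g := 1) (q := 0) (r := 0) (by norm_num)
    (isWeightedHomogeneous_one K _) (by rw [h, mul_zero]; exact Ideal.zero_mem _)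
  have h2 : initialIdeal P n ≤ 
      RingHom.ker (constantCoeff : MvPolynomial (CoxVar k) K →+* K) := by
    rw [initialIdeal, Ideal.span_le]
    rintro _ ⟨i, -, rfl⟩
    rw [SetLike.mem_coe, RingHom.mem_ker, constantCoeff_eq]
    by_contra hne
    have := (hd i).bidegree hne
    simp [Prod.ext_iff] at this
  have := h2 h1
  rw [RingHom.mem_ker, map_one] at this
  exact one_ne_zero this

end Chart

/-! ### Monomials on the scroll -/

section Monomials

variable {k : ℕ} {d : Fin k → ℕ} {b : ℕ}

/-- The exponents of the `z^(i)` in the restriction of a monomial to the scroll. -/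
def content (u : ZVar d →₀ ℕ) : Fin k →₀ ℕ := u.mapDomain Sigma.fst

/-- The exponent of `t` in the restriction of a monomial to the scroll. -/
def tExponent (u : ZVar d →₀ ℕ) : ℕ := Finsupp.weight (fun z : ZVar d => (z.2 : ℕ)) u

lemma content_add (u v : ZVar d →₀ ℕ) : content (u + v) = content u + content v :=
  Finsupp.mapDomain_add

lemma content_single (z : ZVar d) : content (Finsupp.single z 1) = Finsupp.single z.1 1 :=
  Finsupp.mapDomain_single

lemma tExponent_add (u v : ZVar d →₀ ℕ) : tExponent (u + v) = tExponent u + tExponent v :=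
  map_add _ _ _

lemma tExponent_single (z : ZVar d) : tExponent (Finsupp.single z 1) = z.2 := by
  rw [tExponent, Finsupp.weight_single, one_smul]

lemma degree_content (u : ZVar d →₀ ℕ) : (content u).degree = u.degree :=
  Finsupp.degree_mapDomain _ _

/-- The monomials `z^u e_m` and `z^u' e_m'` are linked by a sequence of moves: exchanging top and
bottom entries of two columns, and rolling. -/
inductive Linked (d : Fin k → ℕ) (b : ℕ) : (ZVar d →₀ ℕ) → ℕ → (ZVar d →₀ ℕ) → ℕ → Prop
  | refl (u : ZVar d →₀ ℕ) (m : ℕ) : Linked d b u m u m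
  | symm {u m u' m'} : Linked d b u m u' m' → Linked d b u' m' u m
  | trans {u m u' m' u'' m''} : Linked d b u m u' m' → Linked d b u' m' u'' m'' →
      Linked d b u m u'' m''
  | swap (u : ZVar d →₀ ℕ) (m : ℕ) (α β : Col d) :
      Linked d b (u + Finsupp.single α.top 1 + Finsupp.single β.bot 1) m
        (u + Finsupp.single α.bot 1 + Finsupp.single β.top 1) m
  | roll (u : ZVar d →₀ ℕ) (m : ℕ) (hm : m < b) (α : Col d) :
      Linked d b (u + Finsupp.single α.bot 1) m (u + Finsupp.single α.top 1) (m + 1)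

namespace Linked

variable {u u' : ZVar d →₀ ℕ} {m m' : ℕ}

lemma add_right (h : Linked d b u m u' m') (v : ZVar d →₀ ℕ) :
    Linked d b (u + v) m (u' + v) m' := by
  induction h with
  | refl => exact .refl _ _
  | symm _ ih => exact ih.symm
  | trans _ _ ih1 ih2 => exact ih1.trans ih2
  | swap u m α β =>
    have := swap (b := b) (u + v) m α β
    convert this using 1 <;> abel
  | roll u m hm α =>
    have := roll (b := b) (u + v) m hm α
    convert this using 1 <;> abel

lemma invariant (h : Linked d b u m u' m') :
    content u = content u' ∧ tExponent u + m = tExponent u' + m' ∧ (m ≤ b ↔ m' ≤ b) := by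
  induction h with
  | refl => simp
  | symm _ ih => exact ⟨ih.1.symm, ih.2.1.symm, ih.2.2.symm⟩
  | trans _ _ ih1 ih2 =>
    exact ⟨ih1.1.trans ih2.1, ih1.2.1.trans ih2.2.1, ih1.2.2.trans ih2.2.2⟩
  | swap u m α β =>
    simp only [content_add, content_single, tExponent_add, tExponent_single, Col.top, Col.bot,
      Fin.val_castSucc, Fin.val_succ]
    exact ⟨trivial, by omega, trivial⟩
  | roll u m hm α =>
    simp only [content_add, content_single, tExponent_add, tExponent_single, Col.top, Col.bot,
      Fin.val_castSucc, Fin.val_succ]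
    exact ⟨trivial, by omega, by omega⟩

end Linked

/-- The factor `t` needed to raise the marked variable is borrowed from `e_m` by rolling back or,
when `m = 0`, from another variable of positive index by a swap. -/
lemma exists_linked_succ (u : ZVar d →₀ ℕ) (m : ℕ) (hm : m ≤ b) (α : Col d)
    (h : 0 < tExponent u + m) :
    ∃ v m', Linked d b (u + Finsupp.single α.top 1) m (v + Finsupp.single α.bot 1) m' := by
  rcases m with _ | m
  · have h1 : ∃ z, u z ≠ 0 ∧ (z.2 : ℕ) ≠ 0 := by
      by_contra! hcon
      rw [tExponent, Finsupp.weight_apply, Finsupp.sum, add_zero,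
        Finset.sum_eq_zero (fun z hz => by
          rw [hcon z (Finsupp.mem_support_iff.1 hz), smul_zero])] at h
      exact lt_irrefl _ h
    obtain ⟨⟨i, j⟩, hz, hj⟩ := h1
    have hz' : (⟨i, j⟩ : ZVar d) = Col.bot ⟨i, ⟨j - 1, by have := j.2; simp only at hj; omega⟩⟩ := by
      simp only [Col.bot, Sigma.mk.injEq, heq_eq_eq, true_and]
      ext
      simp only [Fin.succ_mk] at hj ⊢
      omega
    rw [hz'] at hz
    set β : Col d := ⟨i, ⟨j - 1, by have := j.2; simp only at hj; omega⟩⟩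
    have hle : Finsupp.single β.bot 1 ≤ u := by
      rw [Finsupp.single_le_iff]; omega
    refine ⟨u - Finsupp.single β.bot 1 + Finsupp.single β.top 1, 0, ?_⟩
    have := Linked.swap (b := b) (u - Finsupp.single β.bot 1) 0 α β
    rwa [add_right_comm, tsub_add_cancel_of_le hle, add_right_comm (u - _)] at this
  · exact ⟨u, m, (Linked.roll u m (by omega) α).symm⟩

lemma exists_linked_single (i : Fin k) (j₀ : Fin (d i + 1)) (n : ℕ) :
    ∀ (u : ZVar d →₀ ℕ) (m : ℕ) (j : Fin (d i + 1)), m ≤ b → (j : ℕ) + n = j₀ →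
    (j₀ : ℕ) ≤ tExponent u + j + m →
    ∃ v m', Linked d b (u + Finsupp.single ⟨i, j⟩ 1) m (v + Finsupp.single ⟨i, j₀⟩ 1) m' := by
  induction n with
  | zero =>
    intro u m j _ hj _
    obtain rfl : j = j₀ := Fin.ext (by omega)
    exact ⟨u, m, .refl _ _⟩
  | succ n ih =>
    intro u m j hm hj h
    have hlt : (j : ℕ) < d i := by omega
    let α : Col d := ⟨i, ⟨j, hlt⟩⟩
    have htop : α.top = ⟨i, j⟩ := rfl
    obtain ⟨v, m', hv⟩ := exists_linked_succ u m hm α (by omega)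
    have hinv := hv.invariant
    simp only [tExponent_add, tExponent_single, Col.top, Col.bot, Fin.val_castSucc, Fin.val_succ,
      α] at hinv
    obtain ⟨v', m'', hv'⟩ := ih v m' α.bot.2 (hinv.2.2.1 hm) (by
      simp only [α, Col.bot, Fin.val_succ]; omega) (by
      simp only [α, Col.bot, Fin.val_succ]; omega)
    exact ⟨v', m'', hv.trans hv'⟩

/-- Monomials with the same restriction to the scroll are linked. -/
theorem linked_of_invariant (q : ℕ) : ∀ (u u' : ZVar d →₀ ℕ) (m m' : ℕ), u.degree = q → m ≤ b → m' ≤ b →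
    content u = content u' → tExponent u + m = tExponent u' + m' → Linked d b u m u' m' := by
  induction q with
  | zero =>
    intro u u' m m' hu hm hm' hc ht
    obtain rfl : u = 0 := (Finsupp.degree_eq_zero_iff u).1 hu
    obtain rfl : u' = 0 := by
      rw [← Finsupp.degree_eq_zero_iff, ← degree_content, ← hc, degree_content, hu]
    obtain rfl : m = m' := by omega
    exact .refl _ _
  | succ q ih =>
    intro u u' m m' hu hm hm' hc ht
    have hne : u ≠ 0 := by rintro rfl; simp at hu
    obtain ⟨⟨i, j⟩, hz⟩ := Finsupp.ne_iff.1 hne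
    have hle : Finsupp.single (⟨i, j⟩ : ZVar d) 1 ≤ u := by
      rw [Finsupp.single_le_iff]; exact Nat.one_le_iff_ne_zero.2 hz
    obtain ⟨v, rfl⟩ : ∃ v, u = v + Finsupp.single ⟨i, j⟩ 1 := ⟨_, (tsub_add_cancel_of_le hle).symm⟩
    have hci : content u' i ≠ 0 := by
      rw [← hc, content_add, content_single]; simp
    have h1 : ∃ j', u' ⟨i, j'⟩ ≠ 0 := by
      have h2 : i ∈ (u'.mapDomain Sigma.fst).support := Finsupp.mem_support_iff.2 hci
      classical
      obtain ⟨⟨i', j'⟩, hz', rfl⟩ := Finset.mem_image.1 (Finsupp.mapDomain_support h2)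
      exact ⟨j', by simpa using hz'⟩
    obtain ⟨j', hz'⟩ := h1
    have hle' : Finsupp.single (⟨i, j'⟩ : ZVar d) 1 ≤ u' := by
      rw [Finsupp.single_le_iff]; omega
    obtain ⟨v', rfl⟩ : ∃ v, u' = v + Finsupp.single ⟨i, j'⟩ 1 :=
      ⟨_, (tsub_add_cancel_of_le hle').symm⟩
    simp only [tExponent_add, tExponent_single] at ht
    -- The largest index that a factor `z^(i)` can reach. It depends only on the total exponent of
    -- `t`, hence is the same for both monomials; once both contain this factor it is split off.
    let j₀ : Fin (d i + 1) := ⟨min (d i) (tExponent v + j + m), by omega⟩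
    have hj := j.2
    have hj' := j'.2
    obtain ⟨y, n, hy⟩ := exists_linked_single (b := b) i j₀ (j₀ - j) v m j hm
      (by simp only [j₀]; omega) (by simp only [j₀]; omega)
    obtain ⟨y', n', hy'⟩ := exists_linked_single (b := b) i j₀ (j₀ - j') v' m' j' hm'
      (by simp only [j₀]; omega) (by simp only [j₀]; omega)
    have i1 := hy.invariant
    have i2 := hy'.invariant
    have hcc : content y = content y' := by
      have := i1.1.symm.trans (hc.trans i2.1)
      rw [content_add, content_add] at this
      exact add_right_cancel this
    refine hy.trans (.trans ((ih y y' n n' ?_ (i1.2.2.1 hm) (i2.2.2.1 hm') hcc ?_).add_right _)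
      hy'.symm)
    · have := congrArg Finsupp.degree i1.1
      rw [degree_content, degree_content, hu, map_add, Finsupp.degree_single] at this
      omega
    · have e1 := i1.2.1
      have e2 := i2.2.1
      simp only [tExponent_add, tExponent_single] at e1 e2
      omega

/-- The exponent of the restriction of a monomial to the chart `s = 1` of the scroll. -/
def chartExponent (u : ZVar d →₀ ℕ) : CoxVar k →₀ ℕ :=
  (content u).mapDomain Sum.inr + Finsupp.single (tVar k) (tExponent u)

lemma chartExponent_add (u v : ZVar d →₀ ℕ) :
    chartExponent (u + v) = chartExponent u + chartExponent v := by
  simp only [chartExponent, content_add, tExponent_add, Finsupp.mapDomain_add, Finsupp.single_add]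
  abel

lemma chartExponent_eq {u u' : ZVar d →₀ ℕ} {m m' : ℕ}
    (h : chartExponent u + Finsupp.single (tVar k) m = chartExponent u' + Finsupp.single (tVar k) m') :
    content u = content u' ∧ tExponent u + m = tExponent u' + m' := by
  constructor
  · ext i
    have := DFunLike.congr_fun h (Sum.inr i)
    simpa [chartExponent, Finsupp.mapDomain_apply Sum.inr_injective, tVar] using this
  · have := DFunLike.congr_fun h (tVar k)
    simp only [chartExponent, Finsupp.add_apply] at this
    rw [Finsupp.mapDomain_of_notMem_range _ _ (by simp [tVar]),
      Finsupp.mapDomain_of_notMem_range _ _ (by simp [tVar])] at this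
    simpa using this

end Monomials

/-- In a fibre of `π` all vectors agree modulo `W`, so only the sum of their coefficients matters.
In the applications the vectors are monomials and `π` is the restriction to the chart of the scroll.
-/
lemma sum_smul_mem_of_fibers {ι κ R M : Type*} [Ring R] [AddCommGroup M] [Module R M]
    (s : Finset ι) (c : ι → R) (e : ι → M) (π : ι → κ) (W : Submodule R M)
    (hW : ∀ i ∈ s, ∀ j ∈ s, π i = π j → e i - e j ∈ W)
    (hc : ∀ x, ∀ t : Finset ι, (∀ i, i ∈ t ↔ i ∈ s ∧ π i = x) → ∑ i ∈ t, c i = 0) :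
    ∑ i ∈ s, c i • e i ∈ W := by
  classical
  rw [← Finset.sum_fiberwise_of_maps_to (t := s.image π) (g := π)
    (fun i hi => Finset.mem_image_of_mem _ hi)]
  refine Submodule.sum_mem _ fun x hx => ?_
  obtain ⟨j, hj, rfl⟩ := Finset.mem_image.1 hx
  have h0 := hc (π j) (s.filter fun i => π i = π j) (by simp)
  have : ∑ i ∈ s with π i = π j, c i • e i = ∑ i ∈ s with π i = π j, c i • (e i - e j) := by
    simp only [smul_sub, Finset.sum_sub_distrib]
    rw [← Finset.sum_smul, h0, zero_smul, sub_zero]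
  rw [this]
  refine Submodule.sum_mem _ fun i hi => Submodule.smul_mem _ _ ?_
  rw [Finset.mem_filter] at hi
  exact hW i hi.1 j hj hi.2

/-! ### The chart `s = 1` of the deformed scroll -/

section Chart

variable {R : Type*} [CommRing R] {k : ℕ} (d : Fin k → ℕ)

/-- The minors of the deformed scroll matrix, over any ring. -/
def scrollMinor (ζ : Fin k → ℕ → R) (α β : Col d) : MvPolynomial (ZVar d) R :=
  X α.top * (X β.bot + C (ζ β.1 (β.2 + 1))) - (X α.bot + C (ζ α.1 (α.2 + 1))) * X β.top

/-- The ideal of the deformed scroll. -/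
def scrollIdeal (ζ : Fin k → ℕ → R) : Ideal (MvPolynomial (ZVar d) R) :=
  Ideal.span {g | ∃ α β, g = scrollMinor d ζ α β}

variable {d}

/-- Parametrisation of the chart `s = 1` of the deformed scroll. -/
def chart (ζ : Fin k → ℕ → R) : MvPolynomial (ZVar d) R →ₐ[R] MvPolynomial (CoxVar k) R :=
  aeval fun z => X (Sum.inr z.1) * X (tVar k) ^ (z.2 : ℕ) -
    ∑ c ∈ Finset.range z.2, C (ζ z.1 (c + 1)) * X (tVar k) ^ ((z.2 : ℕ) - 1 - c)

/-- The sum in `chart` is the solution of the recursion `z_{j+1} + ζ_{j+1} = t z_j`. The rows of the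
deformed matrix become proportional, and the minors vanish. -/
lemma chart_bot (ζ : Fin k → ℕ → R) (α : Col d) :
    chart ζ (X α.bot) + C (ζ α.1 (α.2 + 1)) = X (tVar k) * chart ζ (X α.top) := by
  simp only [chart, aeval_X, Col.bot, Col.top, Fin.val_succ, Fin.val_castSucc]
  rw [Finset.sum_range_succ, mul_sub, Finset.mul_sum]
  have : ∑ c ∈ Finset.range (α.2 : ℕ), C (ζ α.1 (c + 1)) * X (tVar k) ^ ((α.2 : ℕ) + 1 - 1 - c) =
      ∑ c ∈ Finset.range (α.2 : ℕ), X (tVar k) * (C (ζ α.1 (c + 1)) * X (tVar k) ^ ((α.2 : ℕ) - 1 - c)) := by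
    refine Finset.sum_congr rfl fun c hc => ?_
    rw [Finset.mem_range] at hc
    rw [mul_left_comm, ← pow_succ']
    congr 2
    omega
  rw [this]
  simp only [add_tsub_cancel_right, tsub_self, pow_zero, mul_one]
  ring

lemma chart_mem_scrollIdeal (ζ : Fin k → ℕ → R) {x : MvPolynomial (ZVar d) R}
    (hx : x ∈ scrollIdeal d ζ) : chart ζ x = 0 := by
  rw [← RingHom.mem_ker]
  refine (Ideal.span_le (I := RingHom.ker (chart ζ))).2 ?_ hx
  rintro _ ⟨α, β, rfl⟩
  rw [SetLike.mem_coe, RingHom.mem_ker, scrollMinor, map_sub, map_mul, map_mul, map_add, map_add]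
  have hC : ∀ r, chart (d := d) ζ (C r) = C r := fun r => by rw [chart, aeval_C]; rfl
  rw [hC, hC, chart_bot, chart_bot]
  ring

lemma chart_zero_X (z : ZVar d) : chart (0 : Fin k → ℕ → R) (X z) =
    X (Sum.inr z.1) * X (tVar k) ^ (z.2 : ℕ) := by
  rw [chart, aeval_X]; simp

lemma chart_zero_monomial (u : ZVar d →₀ ℕ) (r : R) :
    chart (0 : Fin k → ℕ → R) (monomial u r) = monomial (chartExponent u) r := by
  induction u using Finsupp.induction_linear generalizing r with
  | zero =>
    have : chartExponent (0 : ZVar d →₀ ℕ) = 0 := by simp [chartExponent, content, tExponent]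
    rw [this]
    change chart 0 (C r) = C r
    rw [chart, aeval_C]; rfl
  | add u v hu hv =>
    have := congrArg₂ (· * ·) (hu r) (hv 1)
    rw [← map_mul, monomial_mul, monomial_mul, mul_one, ← chartExponent_add] at this
    exact this
  | single z n =>
    induction n generalizing r with
    | zero =>
      have : chartExponent (Finsupp.single z 0 : ZVar d →₀ ℕ) = 0 := by
        simp [chartExponent, content, tExponent]
      rw [this, Finsupp.single_zero]
      change chart 0 (C r) = C r
      rw [chart, aeval_C]; rfl
    | succ n ih =>
      have h1 : (monomial (Finsupp.single z 1) 1 : MvPolynomial (ZVar d) R) = X z := rfl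
      have h2 : (monomial (chartExponent (Finsupp.single z 1)) 1 : MvPolynomial (CoxVar k) R) =
          X (Sum.inr z.1) * X (tVar k) ^ (z.2 : ℕ) := by
        rw [chartExponent, content_single, tExponent_single, Finsupp.mapDomain_single, X_pow_eq_monomial,
          X, monomial_mul, one_mul]
      rw [Finsupp.single_add, chartExponent_add, ← mul_one r, ← monomial_mul, ← monomial_mul, map_mul,
        ih, h1, h2, chart_zero_X]

/-- The equations of the scroll are the minors. -/
theorem mem_scrollIdeal_of_chart {x : MvPolynomial (ZVar d) R}
    (hx : chart (0 : Fin k → ℕ → R) x = 0) : x ∈ scrollIdeal d (0 : Fin k → ℕ → R) := by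
  -- For `b = 0` rolling is impossible, so links consist of swaps, and each swap is a multiple of a
  -- minor.
  have hlink : ∀ {u m u' m'}, Linked d 0 u m u' m' →
      monomial u 1 - monomial u' 1 ∈ scrollIdeal d (0 : Fin k → ℕ → R) := by
    intro u m u' m' h
    induction h with
    | refl => rw [sub_self]; exact Ideal.zero_mem _
    | symm _ ih => rw [← neg_sub]; exact neg_mem ih
    | trans _ _ ih1 ih2 => rw [← sub_add_sub_cancel]; exact add_mem ih1 ih2
    | swap u m α β =>
      have : (monomial (u + Finsupp.single α.top 1 + Finsupp.single β.bot 1) 1 -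
          monomial (u + Finsupp.single α.bot 1 + Finsupp.single β.top 1) 1 : MvPolynomial (ZVar d) R) =
          monomial u 1 * scrollMinor d 0 α β := by
        rw [← mul_one (1 : R), ← monomial_mul, ← monomial_mul, ← mul_one (1 : R), ← monomial_mul,
          ← monomial_mul, scrollMinor]
        simp only [Pi.zero_apply, C_0, add_zero, mul_one, X]
        ring
      rw [this]
      exact Ideal.mul_mem_left _ _ (Ideal.subset_span ⟨α, β, rfl⟩)
    | roll u m hm α => omega
  rw [x.as_sum]
  have := sum_smul_mem_of_fibers x.support (fun u => coeff u x) (fun u => monomial u 1) chartExponent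
    ((scrollIdeal d (0 : Fin k → ℕ → R)).restrictScalars R) (by
      intro u _ u' _ h
      have h1 := chartExponent_eq (u := u) (u' := u') (m := 0) (m' := 0) (by rw [h])
      exact hlink (linked_of_invariant (b := 0) _ u u' 0 0 rfl le_rfl le_rfl h1.1 h1.2)) (by
      intro e t ht
      have h1 : coeff e (chart (0 : Fin k → ℕ → R) x) = 0 := by rw [hx, coeff_zero]
      classical
      rw [x.as_sum, map_sum, coeff_sum] at h1
      simp only [chart_zero_monomial, coeff_monomial] at h1
      rw [← Finset.sum_filter] at h1
      rw [← h1]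
      refine Finset.sum_congr ?_ fun _ _ => rfl
      ext u
      rw [ht, Finset.mem_filter])
  simp only [← monomial_eq_smul] at this
  exact this

/-- The degrees in the `z^(i)`. -/
def fibreWeight (k : ℕ) : CoxVar k → ℤ := Sum.elim (fun _ => 0) (fun _ => 1)

/-- Each coordinate is parametrised by a term of fibre degree one plus `ζ`-terms of fibre degree
zero, so `ζ` cannot contribute to the top degree. -/
lemma chart_initialForm (ζ : Fin k → ℕ → R) {x : MvPolynomial (ZVar d) R} {e : ℕ}
    (hx : x ∈ degreeLT R (ZVar d) (e + 1)) :
    weightedHomogeneousComponent (fibreWeight k) (e : ℤ) (chart ζ x) =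
      chart (0 : Fin k → ℕ → R) (homogeneousComponent e x) := by
  have key : ∀ (u : ZVar d →₀ ℕ) (r : R), ∃ n, (monomial u r : MvPolynomial (ZVar d) R).IsHomogeneous n ∧
      ∀ e : ℕ, n ≤ e → weightedHomogeneousComponent (fibreWeight k) (e : ℤ) (chart ζ (monomial u r)) =
      chart (0 : Fin k → ℕ → R) (homogeneousComponent e (monomial u r)) := by
    intro u r
    refine induction_on_monomial (motive := fun p : MvPolynomial (ZVar d) R => ∃ n, p.IsHomogeneous n ∧
      ∀ e : ℕ, n ≤ e → weightedHomogeneousComponent (fibreWeight k) (e : ℤ) (chart ζ p) =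
      chart (0 : Fin k → ℕ → R) (homogeneousComponent e p)) ?_ ?_ u r
    · intro a
      refine ⟨0, isHomogeneous_C _ _, fun e _ => ?_⟩
      have hC : ∀ ζ : Fin k → ℕ → R, chart (d := d) ζ (C a) = C a := fun ζ => by
        rw [chart, aeval_C]; rfl
      classical
      rw [hC, weightedHomogeneousComponent_of_mem (isWeightedHomogeneous_C _ a),
        homogeneousComponent_of_mem (isHomogeneous_C _ a)]
      split_ifs with h1 h2 h2
      · rw [hC]
      · omega
      · omega
      · rw [map_zero]
    · rintro p z ⟨n, hp, ih⟩
      refine ⟨n + 1, hp.mul (isHomogeneous_X _ _), fun e he => ?_⟩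
      obtain ⟨e, rfl⟩ : ∃ e', e = e' + 1 := ⟨e - 1, by omega⟩
      have hA : IsWeightedHomogeneous (fibreWeight k) (X (Sum.inr z.1) * X (tVar k) ^ (z.2 : ℕ) :
          MvPolynomial (CoxVar k) R) 1 := by
        have h1 := (isWeightedHomogeneous_X R (fibreWeight k) (Sum.inr z.1)).mul
          ((isWeightedHomogeneous_X R (fibreWeight k) (tVar k)).pow z.2)
        simpa [fibreWeight, tVar] using h1
      have hB : IsWeightedHomogeneous (fibreWeight k) (∑ c ∈ Finset.range z.2, C (ζ z.1 (c + 1)) *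
          X (tVar k) ^ ((z.2 : ℕ) - 1 - c) : MvPolynomial (CoxVar k) R) 0 := by
        refine IsWeightedHomogeneous.sum _ _ _ fun c _ => ?_
        have h1 := ((isWeightedHomogeneous_X R (fibreWeight k) (tVar k)).pow
          ((z.2 : ℕ) - 1 - c)).C_mul (ζ z.1 (c + 1))
        simpa [fibreWeight, tVar] using h1
      rw [map_mul (chart ζ), homogeneousComponent_mul (isHomogeneous_X _ _), map_mul (chart 0),
        chart_zero_X, ← ih e (by omega)]
      have hX : chart ζ (X z) = X (Sum.inr z.1) * X (tVar k) ^ (z.2 : ℕ) -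
          ∑ c ∈ Finset.range z.2, C (ζ z.1 (c + 1)) * X (tVar k) ^ ((z.2 : ℕ) - 1 - c) := by
        rw [chart, aeval_X]
      rw [hX, mul_sub, map_sub, weightedHomogeneousComponent_mul hA, weightedHomogeneousComponent_mul hB]
      have h0 : weightedHomogeneousComponent (fibreWeight k) (((e + 1 : ℕ) : ℤ) - 0) (chart ζ p) = 0 := by
        rw [sub_zero, ih (e + 1) (by omega)]
        classical
        rw [homogeneousComponent_of_mem hp, if_neg (by omega), map_zero]
      rw [h0, zero_mul, sub_zero, Nat.cast_add, Nat.cast_one, add_sub_cancel_right]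
  rw [x.as_sum]
  simp only [map_sum]
  refine Finset.sum_congr rfl fun u hu => ?_
  obtain ⟨n, hn, h⟩ := key u (coeff u x)
  refine h e ?_
  have h1 : (monomial u (coeff u x)).IsHomogeneous u.degree := isHomogeneous_monomial _ rfl
  have h2 := hn.inj_right h1 (by simpa using hu)
  have h3 := mem_degreeLT.1 hx u (by simpa using hu)
  omega

/-- The initial forms of the equations of the deformed scroll vanish on the scroll. -/
theorem initialForm_mem_scrollIdeal (ζ : Fin k → ℕ → R) {x : MvPolynomial (ZVar d) R} {e : ℕ}
    (hx : x ∈ scrollIdeal d ζ) (hdeg : x ∈ degreeLT R (ZVar d) (e + 1)) :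
    homogeneousComponent e x ∈ scrollIdeal d (0 : Fin k → ℕ → R) := by
  refine mem_scrollIdeal_of_chart ?_
  rw [← chart_initialForm ζ hdeg, chart_mem_scrollIdeal ζ hx, map_zero]

end Chart

/-! ### Sections of twists on the scroll -/

section Sections

variable {K : Type*} [CommRing K] {k : ℕ} {d : Fin k → ℕ}

lemma toCox_isWeightedHomogeneous {p : MvPolynomial (ZVar d) K} {q : ℕ} (hp : p.IsHomogeneous q) :
    IsWeightedHomogeneous (bidegree d) (toCox K d p) ((q : ℤ), (0 : ℤ)) := by
  have key : ∀ u : ZVar d →₀ ℕ, ∀ r, IsWeightedHomogeneous (bidegree d) (toCox K d (monomial u r))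
      ((u.degree : ℤ), (0 : ℤ)) := by
    intro u r
    rw [toCox, aeval_monomial, algebraMap_eq, Finsupp.prod, Finsupp.degree_apply]
    refine IsWeightedHomogeneous.C_mul ?_ r
    have h := IsWeightedHomogeneous.prod (w := bidegree d) u.support (fun z : ZVar d =>
      ((X (Sum.inr z.1) * X (sVar k) ^ (d z.1 - (z.2 : ℕ)) * X (tVar k) ^ (z.2 : ℕ)) ^ u z :
        MvPolynomial (CoxVar k) K)) (fun z => ((u z : ℤ), (0 : ℤ))) (by
      intro z _
      have h := ((((isWeightedHomogeneous_X K (bidegree d) (Sum.inr z.1)).mul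
        ((isWeightedHomogeneous_X K (bidegree d) (sVar k)).pow (d z.1 - (z.2 : ℕ)))).mul
        ((isWeightedHomogeneous_X K (bidegree d) (tVar k)).pow (z.2 : ℕ))).pow (u z))
      convert h using 1
      have := z.2.2
      ext
      · simp [bidegree, sVar, tVar]
      · simp only [bidegree, sVar, tVar, Sum.elim_inr, Sum.elim_inl, Prod.snd_add, Prod.smul_snd]
        simp only [nsmul_eq_mul]
        push_cast [Nat.cast_sub (show (z.2 : ℕ) ≤ d z.1 by omega)]
        ring)
    convert h using 1
    ext
    · simp [Prod.fst_sum]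
    · simp [Prod.snd_sum]
  rw [p.as_sum, map_sum]
  refine IsWeightedHomogeneous.sum _ _ _ fun u hu => ?_
  have h1 : u.degree = q := by
    have := hp (mem_support_iff.1 hu)
    rw [← this]
    exact DFunLike.congr_fun (Finsupp.degree_eq_weight_one (σ := ZVar d) (R := ℕ)) u
  rw [← h1]
  exact key u _

/-- The choice is greedy: each `z^(i)` takes as many factors `t` as it can hold, is filled up to
total exponent `d i` with `s`, and the surplus is `s^{r-m} t^m`. -/
lemma exists_monomial_of_weight (N : ℕ) : ∀ (e : CoxVar k →₀ ℕ) (r : ℕ), ∑ i, e (Sum.inr i) = N →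
    e (sVar k) + e (tVar k) = ∑ i, d i * e (Sum.inr i) + r →
    ∃ (u : ZVar d →₀ ℕ) (m : ℕ), m ≤ r ∧ u.degree = N ∧
      toCox K d (monomial u 1) * (X (sVar k) ^ (r - m) * X (tVar k) ^ m) = monomial e 1 := by
  induction N with
  | zero =>
    intro e r h0 h1
    have hz : ∀ i, e (Sum.inr i) = 0 := fun i =>
      (Finset.sum_eq_zero_iff.1 h0) i (Finset.mem_univ i)
    simp only [hz, mul_zero, Finset.sum_const_zero, zero_add] at h1
    refine ⟨0, e (tVar k), by omega, by simp, ?_⟩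
    rw [show (monomial (0 : ZVar d →₀ ℕ) (1 : K)) = 1 from rfl, map_one, one_mul,
      X_pow_eq_monomial, X_pow_eq_monomial, monomial_mul, one_mul]
    have : Finsupp.single (sVar k) (r - e (tVar k)) + Finsupp.single (tVar k) (e (tVar k)) = e := by
      refine Finsupp.ext fun x => ?_
      rcases x with x | i
      · fin_cases x
        · change _ = e (sVar k)
          simp [sVar, tVar] at h1 ⊢; omega
        · simp [sVar, tVar]
      · simp [sVar, tVar, hz i]
    rw [this]
  | succ N ih =>
    intro e r h0 h1
    obtain ⟨i, hi⟩ : ∃ i, e (Sum.inr i) ≠ 0 := by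
      by_contra! hcon
      simp [hcon] at h0
    set j := min (e (tVar k)) (d i) with hj
    have hle : d i * e (Sum.inr i) ≤ ∑ i, d i * e (Sum.inr i) :=
      Finset.single_le_sum (f := fun i => d i * e (Sum.inr i)) (fun _ _ => Nat.zero_le _)
        (Finset.mem_univ i)
    have hdi : d i ≤ d i * e (Sum.inr i) := Nat.le_mul_of_pos_right _ (Nat.pos_of_ne_zero hi)
    let v : CoxVar k →₀ ℕ := Finsupp.single (Sum.inr i) 1 + Finsupp.single (sVar k) (d i - j) +
      Finsupp.single (tVar k) j
    have hvi : ∀ i', v (Sum.inr i') = if i' = i then 1 else 0 := by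
      intro i'
      simp [v, sVar, tVar, Finsupp.single_apply, eq_comm]
    have hvs : v (sVar k) = d i - j := by simp [v, sVar, tVar]
    have hvt : v (tVar k) = j := by simp [v, sVar, tVar]
    have hv : v ≤ e := by
      intro x
      rcases x with x | i'
      · fin_cases x
        · exact hvs.le.trans (show d i - j ≤ e (sVar k) by omega)
        · exact hvt.le.trans (show j ≤ e (tVar k) by omega)
      · rw [hvi]
        split_ifs with h
        · subst h; omega
        · exact Nat.zero_le _
    obtain ⟨f, hf⟩ : ∃ f, e = f + v := ⟨e - v, (tsub_add_cancel_of_le hv).symm⟩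
    have hfx : ∀ x, e x = f x + v x := fun x => DFunLike.congr_fun hf x
    simp only [hfx, hvi, Finset.sum_add_distrib, Finset.sum_ite_eq', Finset.mem_univ,
      if_true, mul_add, mul_ite, mul_one, mul_zero, hvs, hvt] at h0 h1
    obtain ⟨u, m, hm, hu, hum⟩ := ih f r (by omega) (by omega)
    refine ⟨u + Finsupp.single ⟨i, ⟨j, by omega⟩⟩ 1, m, hm, by simp [hu], ?_⟩
    have h2 : (monomial (u + Finsupp.single ⟨i, ⟨j, by omega⟩⟩ 1) 1 : MvPolynomial (ZVar d) K) =
      monomial u 1 * X ⟨i, ⟨j, by omega⟩⟩ := by rw [X, monomial_mul, one_mul]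
    have h3 : toCox K d (X ⟨i, ⟨j, by omega⟩⟩) = monomial v 1 := by
      rw [toCox, aeval_X]
      dsimp only
      rw [X_pow_eq_monomial, X_pow_eq_monomial, X, monomial_mul, monomial_mul, one_mul, one_mul]
    rw [h2, map_mul, h3, mul_right_comm, hum, monomial_mul, one_mul, hf]

/-- The sections of `q H + (a + b) R` are sums of products of sections of `q H`, `a R`, `b R`. -/
theorem exists_sections {G : MvPolynomial (CoxVar k) K} {q : ℤ} {a b : ℕ}
    (hG : IsWeightedHomogeneous (bidegree d) G (q, (a : ℤ) + b)) :
    ∃ g : Fin (a + 1) → Fin (b + 1) → MvPolynomial (ZVar d) K,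
      (∀ m m' u, coeff u (g m m') ≠ 0 → (u.degree : ℤ) = q) ∧
      G = ∑ m, ∑ m', toCox K d (g m m') * (X (sVar k) ^ (a - (m : ℕ)) * X (tVar k) ^ (m : ℕ)) *
        (X (sVar k) ^ (b - (m' : ℕ)) * X (tVar k) ^ (m' : ℕ)) := by
  classical
  have key : ∀ e ∈ G.support, ∃ g : Fin (a + 1) → Fin (b + 1) → MvPolynomial (ZVar d) K,
      (∀ m m' u, coeff u (g m m') ≠ 0 → (u.degree : ℤ) = q) ∧
      monomial e (coeff e G) = ∑ m, ∑ m', toCox K d (g m m') *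
        (X (sVar k) ^ (a - (m : ℕ)) * X (tVar k) ^ (m : ℕ)) *
        (X (sVar k) ^ (b - (m' : ℕ)) * X (tVar k) ^ (m' : ℕ)) := by
    intro e he
    have hw := hG (mem_support_iff.1 he)
    have h1 := weight_bidegree_fst d e
    have h2 := weight_bidegree_snd d e
    rw [hw] at h1 h2
    dsimp only at h1 h2
    obtain ⟨u, n, hn, hu, hun⟩ := exists_monomial_of_weight (K := K) (d := d) _ e (a + b) rfl (by
      zify; linarith)
    -- The surplus `s^{a+b-n} t^n` is divided between the two twists, the first receiving as many
    -- factors `t` as possible.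
    let m₀ : Fin (a + 1) := ⟨min n a, by omega⟩
    let m₁ : Fin (b + 1) := ⟨n - min n a, by omega⟩
    refine ⟨fun m m' => if m = m₀ ∧ m' = m₁ then monomial u (coeff e G) else 0, ?_, ?_⟩
    · intro m m' v hv
      dsimp only at hv
      split_ifs at hv
      · rw [coeff_monomial] at hv
        split_ifs at hv with huv
        · rw [← huv, hu, h1]; push_cast; rfl
        · exact absurd rfl hv
      · simp at hv
    · rw [Finset.sum_eq_single m₀, Finset.sum_eq_single m₁]
      · beta_reduce
        rw [if_pos ⟨rfl, rfl⟩]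
        have e1 : (monomial e (coeff e G) : MvPolynomial (CoxVar k) K) = C (coeff e G) * monomial e 1 := by
          rw [C_mul_monomial, mul_one]
        have e2 : toCox K d (monomial u (coeff e G)) = C (coeff e G) * toCox K d (monomial u 1) := by
          rw [← mul_one (coeff e G), ← C_mul_monomial, map_mul, mul_one, toCox, aeval_C]; rfl
        rw [e1, e2, ← hun]
        have e3 : a + b - n = (a - min n a) + (b - (n - min n a)) := by omega
        have e4 : (X (tVar k) ^ n : MvPolynomial (CoxVar k) K) =
            X (tVar k) ^ min n a * X (tVar k) ^ (n - min n a) := by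
          rw [← pow_add]; congr 1; omega
        simp only [m₀, m₁]
        rw [e3, e4, pow_add]
        ring
      · intro m' _ h
        beta_reduce
        rw [if_neg (by tauto), map_zero, zero_mul, zero_mul]
      · simp
      · intro m _ h
        refine Finset.sum_eq_zero fun m' _ => ?_
        beta_reduce
        rw [if_neg (by tauto), map_zero, zero_mul, zero_mul]
      · simp
  choose! g hg hg' using key
  refine ⟨fun m m' => ∑ e ∈ G.support, g e m m', ?_, ?_⟩
  · intro m m' u hu
    rw [coeff_sum] at hu
    obtain ⟨e, he, hne⟩ := Finset.exists_ne_zero_of_sum_ne_zero hu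
    exact hg e he m m' u hne
  · conv_lhs => rw [G.as_sum, Finset.sum_congr rfl hg']
    rw [Finset.sum_comm]
    refine Finset.sum_congr rfl fun m _ => ?_
    rw [Finset.sum_comm]
    refine Finset.sum_congr rfl fun m' _ => ?_
    rw [map_sum, Finset.sum_mul, Finset.sum_mul]

lemma toCox_scrollIdeal {x : MvPolynomial (ZVar d) K} (hx : x ∈ scrollIdeal d (0 : Fin k → ℕ → K)) :
    toCox K d x = 0 := by
  rw [← RingHom.mem_ker]
  refine (Ideal.span_le (I := RingHom.ker (toCox K d))).2 ?_ hx
  rintro _ ⟨α, β, rfl⟩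
  rw [SetLike.mem_coe, RingHom.mem_ker, scrollMinor]
  have h : ∀ α : Col d, X (sVar k) * toCox K d (X α.bot) = X (tVar k) * toCox K d (X α.top) := by
    intro α
    have := α.2.2
    simp only [toCox, aeval_X, Col.bot, Col.top, Fin.val_succ, Fin.val_castSucc]
    rw [show d α.1 - (α.2 : ℕ) = (d α.1 - ((α.2 : ℕ) + 1)) + 1 by omega]
    ring
  have hs : ∀ y : MvPolynomial (CoxVar k) K, X (sVar k) * y = 0 → y = 0 := by
    intro y hy
    ext e
    have := congrArg (coeff (Finsupp.single (sVar k) 1 + e)) hy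
    rwa [coeff_X_mul, coeff_zero] at this
  apply hs
  simp only [Pi.zero_apply, C_0, add_zero, map_sub, map_mul]
  rw [mul_sub, mul_left_comm, h, ← mul_assoc (X (sVar k)), h]
  ring

/-- Setting `s = 1`. -/
lemma chart_eq_zero_of_toCox {b : ℕ} {h : Fin (b + 1) → MvPolynomial (ZVar d) K}
    (hh : ∑ m, toCox K d (h m) * (X (sVar k) ^ (b - (m : ℕ)) * X (tVar k) ^ (m : ℕ)) = 0) :
    ∑ m, chart (0 : Fin k → ℕ → K) (h m) * X (tVar k) ^ (m : ℕ) = 0 := by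
  let φ : MvPolynomial (CoxVar k) K →ₐ[K] MvPolynomial (CoxVar k) K :=
    aeval (Sum.elim (fun j => if j = 0 then 1 else X (tVar k)) (fun i => X (Sum.inr i)))
  have hs : φ (X (sVar k)) = 1 := by simp [φ, sVar]
  have ht : φ (X (tVar k)) = X (tVar k) := by simp [φ, tVar]
  have hc : φ.comp (toCox K d) = chart 0 := by
    ext1 z
    rw [AlgHom.comp_apply, toCox, aeval_X, chart_zero_X, map_mul, map_mul, map_pow, map_pow, hs, ht]
    simp [φ]
  have := congrArg φ hh
  rw [map_sum, map_zero] at this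
  rw [← this]
  refine Finset.sum_congr rfl fun m _ => ?_
  rw [map_mul, map_mul, map_pow, map_pow, hs, ht, one_pow, one_mul, ← hc]
  rfl

end Sections

namespace QuadricSystem

/-! ### Lifting the syzygies -/

variable {K : Type*} [Field K] {k l : ℕ} (D : QuadricSystem K k l)

/-- Indices of the additional equations `P^(n)_m`. -/
abbrev EqnIdx : Type := (n : Fin l) × Fin (D.b n + 1)

variable {R : Type*} [CommRing R]

variable (ζ : Fin k → ℕ → R) (E : Fin l → ℕ → MvPolynomial (ZVar D.d) R)

/-- The combination of the equations with coefficients `h`. -/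
def combination : (D.EqnIdx → MvPolynomial (ZVar D.d) R) →ₗ[MvPolynomial (ZVar D.d) R]
    MvPolynomial (ZVar D.d) R :=
  Fintype.linearCombination _ fun i : D.EqnIdx => E i.1 i.2

lemma combination_apply (h : D.EqnIdx → MvPolynomial (ZVar D.d) R) :
    D.combination E h = ∑ i, h i * E i.1 i.2 := rfl

lemma combination_single (i : D.EqnIdx) (p : MvPolynomial (ZVar D.d) R) :
    D.combination E (Pi.single i p) = p * E i.1 i.2 := by
  rw [combination, Fintype.linearCombination_apply_single, smul_eq_mul]

/-- The families of coefficients that become relations between the equations `E` of a rolling family,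
on the deformed scroll, after adding terms of degree less than `q`. -/
def liftable (q : ℕ) : Submodule R (D.EqnIdx → MvPolynomial (ZVar D.d) R) where
  carrier := {g | ∃ h : D.EqnIdx → MvPolynomial (ZVar D.d) R,
    (∀ i, h i - g i ∈ degreeLT R (ZVar D.d) q) ∧ D.combination E h ∈ scrollIdeal D.d ζ}
  add_mem' := by
    rintro g g' ⟨h, hg, hE⟩ ⟨h', hg', hE'⟩
    refine ⟨h + h', fun i => ?_, by rw [map_add]; exact add_mem hE hE'⟩
    rw [Pi.add_apply, Pi.add_apply, add_sub_add_comm]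
    exact add_mem (hg i) (hg' i)
  zero_mem' := ⟨0, fun i => by simp, by simp⟩
  smul_mem' := by
    rintro c g ⟨h, hg, hE⟩
    refine ⟨C c • h, fun i => ?_, by rw [map_smul]; exact Ideal.mul_mem_left _ _ hE⟩
    rw [Pi.smul_apply, Pi.smul_apply, smul_eq_mul, ← C_mul', ← mul_sub]
    exact C_mul_mem_degreeLT _ (hg i)

variable {D ζ E}

lemma single_sub_mem_degreeLT {q : ℕ} {j : D.EqnIdx} {p p' : MvPolynomial (ZVar D.d) R}
    (h : p - p' ∈ degreeLT R (ZVar D.d) q) (i : D.EqnIdx) :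
    (Pi.single j p : D.EqnIdx → _) i - (Pi.single j p' : D.EqnIdx → _) i ∈ degreeLT R (ZVar D.d) q := by
  rw [← Pi.sub_apply, ← Pi.single_sub]
  by_cases hij : i = j
  · subst hij; rwa [Pi.single_eq_same]
  · rw [Pi.single_eq_of_ne hij]; exact zero_mem _

lemma mul_C_mul_mem_degreeLT {u : ZVar D.d →₀ ℕ} (r : R) :
    monomial u 1 * C r ∈ degreeLT R (ZVar D.d) (u.degree + 1) := by
  rw [mul_comm]
  exact C_mul_mem_degreeLT _ (IsHomogeneous.mem_degreeLT (isHomogeneous_monomial _ rfl))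

/-- The family with the entry `p` at `P^(n)_m`. -/
def entry (D : QuadricSystem K k l) (n : Fin l) (m : ℕ) (p : MvPolynomial (ZVar D.d) R) :
    D.EqnIdx → MvPolynomial (ZVar D.d) R :=
  if h : m < D.b n + 1 then Pi.single ⟨n, ⟨m, h⟩⟩ p else 0

lemma entry_fin (n : Fin l) (m : Fin (D.b n + 1)) (p : MvPolynomial (ZVar D.d) R) :
    D.entry n m p = Pi.single ⟨n, m⟩ p := by
  rw [entry, dif_pos m.2]

lemma combination_entry {n : Fin l} {m : ℕ} (hm : m ≤ D.b n) (p : MvPolynomial (ZVar D.d) R) :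
    D.combination E (D.entry n m p) = p * E n m := by
  rw [entry, dif_pos (by omega), combination_single]

lemma entry_sub_mem_degreeLT {q : ℕ} {n : Fin l} {m : ℕ} {p p' : MvPolynomial (ZVar D.d) R}
    (h : p - p' ∈ degreeLT R (ZVar D.d) q) (i : D.EqnIdx) :
    D.entry n m p i - D.entry n m p' i ∈ degreeLT R (ZVar D.d) q := by
  rw [entry, entry]
  split_ifs
  · exact single_sub_mem_degreeLT h i
  · simp

variable [Algebra K R]

/-- A family of inhomogeneous equations over `R` with leading forms the `P^(n)_m`, compatible with
rolling factors on the deformed scroll. -/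
structure IsRollingFamily (D : QuadricSystem K k l) (ζ : Fin k → ℕ → R) (E : Fin l → ℕ → MvPolynomial (ZVar D.d) R) : Prop where
  leading : ∀ n m, m ≤ D.b n → E n m - map (algebraMap K R) (D.eqn n m) ∈ degreeLT R (ZVar D.d) 2
  roll : ∀ n m, m < D.b n → ∀ β : Col D.d,
    E n m * (X β.bot + C (ζ β.1 (β.2 + 1))) - E n (m + 1) * X β.top ∈ scrollIdeal D.d ζ

/-- A swap lifts to a multiple of a deformed minor, which annihilates every equation on the deformed
scroll; a roll lifts by the rolling property. In both cases the terms containing `ζ` have smaller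
degree in `z`. -/
lemma entry_sub_entry_mem_liftable (hE : D.IsRollingFamily ζ E) (n : Fin l)
    {u u' : ZVar D.d →₀ ℕ} {m m' : ℕ} (h : Linked D.d (D.b n) u m u' m') (hm : m ≤ D.b n) :
    D.entry n m (monomial u 1) - D.entry n m' (monomial u' 1) ∈ D.liftable ζ E u.degree := by
  induction h with
  | refl => rw [sub_self]; exact zero_mem _
  | symm h ih =>
    have hi := h.invariant
    have hd : ∀ {u u' : ZVar D.d →₀ ℕ}, content u = content u' → u.degree = u'.degree := by
      intro u u' h; rw [← degree_content, h, degree_content]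
    rw [← neg_sub, ← hd hi.1]
    exact neg_mem (ih (hi.2.2.2 hm))
  | trans h h' ih ih' =>
    have hi := h.invariant
    have hd : ∀ {u u' : ZVar D.d →₀ ℕ}, content u = content u' → u.degree = u'.degree := by
      intro u u' h; rw [← degree_content, h, degree_content]
    rw [← sub_add_sub_cancel]
    refine add_mem (ih hm) ?_
    rw [hd hi.1]
    exact ih' (hi.2.2.1 hm)
  | swap u m α β =>
    refine ⟨D.entry n m (monomial u 1 * scrollMinor D.d ζ α β), fun i => ?_, ?_⟩
    · have : (D.entry n m (monomial (u + Finsupp.single α.top 1 + Finsupp.single β.bot 1) (1 : R)) -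
          D.entry n m (monomial (u + Finsupp.single α.bot 1 + Finsupp.single β.top 1) 1)) =
          D.entry n m (monomial u 1 * (X α.top * X β.bot - X α.bot * X β.top)) := by
        rw [mul_sub, entry, entry, entry, dif_pos (by omega), dif_pos (by omega), dif_pos (by omega),
          ← Pi.single_sub]
        congr 2 <;> rw [← mul_assoc, X, X, monomial_mul, monomial_mul, one_mul, one_mul]
      rw [this]
      refine entry_sub_mem_degreeLT ?_ i
      have h1 : monomial u 1 * scrollMinor D.d ζ α β -
          monomial u 1 * (X α.top * X β.bot - X α.bot * X β.top) =
          X α.top * (monomial u 1 * C (ζ β.1 (β.2 + 1))) -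
            X β.top * (monomial u 1 * C (ζ α.1 (α.2 + 1))) := by
        rw [scrollMinor]; ring
      have h2 : (u + Finsupp.single α.top 1 + Finsupp.single β.bot 1).degree = 1 + (u.degree + 1) := by
        simp only [map_add, Finsupp.degree_single]; ring
      rw [h1, h2]
      exact sub_mem
        (mul_mem_degreeLT (IsHomogeneous.mem_degreeLT (isHomogeneous_X _ _)) (mul_C_mul_mem_degreeLT _))
        (mul_mem_degreeLT (IsHomogeneous.mem_degreeLT (isHomogeneous_X _ _)) (mul_C_mul_mem_degreeLT _))
    · rw [combination_entry hm, mul_right_comm]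
      exact Ideal.mul_mem_left _ _ (Ideal.subset_span ⟨α, β, rfl⟩)
  | roll u m hmb α =>
    refine ⟨D.entry n m (monomial u 1 * (X α.bot + C (ζ α.1 (α.2 + 1)))) -
      D.entry n (m + 1) (monomial u 1 * X α.top), fun i => ?_, ?_⟩
    · rw [Pi.sub_apply, Pi.sub_apply, sub_sub_sub_comm]
      refine sub_mem (entry_sub_mem_degreeLT ?_ i) (entry_sub_mem_degreeLT ?_ i)
      · rw [mul_add, X, monomial_mul, one_mul, add_sub_cancel_left, map_add, Finsupp.degree_single]
        exact mul_C_mul_mem_degreeLT _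
      · rw [X, monomial_mul, one_mul, sub_self]; exact zero_mem _
    · rw [map_sub, combination_entry hm, combination_entry (by omega)]
      have := Ideal.mul_mem_left _ (monomial u 1) (hE.roll n m hmb α)
      convert this using 1
      ring

/-- The relations between the sections `s^{b-m} t^m` lift. -/
theorem sum_entry_mem_liftable (hE : D.IsRollingFamily ζ E) (n : Fin l) {q : ℕ}
    {h : Fin (D.b n + 1) → MvPolynomial (ZVar D.d) R} (hq : ∀ m, (h m).IsHomogeneous q)
    (hrel : ∑ m, toCox R D.d (h m) * (X (sVar k) ^ (D.b n - (m : ℕ)) * X (tVar k) ^ (m : ℕ)) = 0) :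
    ∑ m : Fin (D.b n + 1), D.entry n m (h m) ∈ D.liftable ζ E q := by
  classical
  have hchart := chart_eq_zero_of_toCox hrel
  let U : Finset (ZVar D.d →₀ ℕ) := Finset.univ.biUnion fun m => (h m).support
  have hU : ∀ u ∈ U, u.degree = q := by
    intro u hu
    obtain ⟨m, -, hm⟩ := Finset.mem_biUnion.1 hu
    have := hq m (mem_support_iff.1 hm)
    rw [← this]
    exact DFunLike.congr_fun (Finsupp.degree_eq_weight_one (σ := ZVar D.d) (R := ℕ)) u
  have hsum : ∀ m, h m = ∑ u ∈ U, monomial u (coeff u (h m)) := by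
    intro m
    conv_lhs => rw [(h m).as_sum]
    refine Finset.sum_subset (Finset.subset_biUnion_of_mem (fun m => (h m).support) (Finset.mem_univ m))
      fun u _ hu => ?_
    rw [notMem_support_iff.1 hu, map_zero]
  have hentry : ∀ m : Fin (D.b n + 1), D.entry n m (h m) =
      ∑ u ∈ U, coeff u (h m) • D.entry n m (monomial u (1 : R)) := by
    intro m
    conv_lhs => rw [hsum m, entry_fin]
    ext1 i
    rw [Finset.sum_apply]
    by_cases hi : i = ⟨n, m⟩
    · subst hi
      rw [Pi.single_eq_same]
      refine Finset.sum_congr rfl fun u _ => ?_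
      rw [Pi.smul_apply, entry_fin, Pi.single_eq_same, ← monomial_eq_smul]
    · rw [Pi.single_eq_of_ne hi]
      symm
      refine Finset.sum_eq_zero fun u _ => ?_
      rw [Pi.smul_apply, entry_fin, Pi.single_eq_of_ne hi, smul_zero]
  rw [Finset.sum_congr rfl fun m _ => hentry m, ← Finset.sum_product' (s := Finset.univ) (t := U)
    (f := fun (m : Fin (D.b n + 1)) u => coeff u (h m) • D.entry n m (monomial u (1 : R)))]
  -- Pairs `(m, u)` stand for `z^u t^m` on the chart. The relation says that coefficients of pairs
  -- with equal image add up to zero, and such pairs are linked.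
  refine sum_smul_mem_of_fibers (Finset.univ ×ˢ U)
    (fun x : Fin (D.b n + 1) × (ZVar D.d →₀ ℕ) => coeff x.2 (h x.1))
    (fun x => D.entry n x.1 (monomial x.2 (1 : R)))
    (fun x => chartExponent x.2 + Finsupp.single (tVar k) (x.1 : ℕ)) _ ?_ ?_
  · rintro ⟨m, u⟩ hu ⟨m', u'⟩ hu' hπ
    have h1 := chartExponent_eq hπ
    rw [← hU u (Finset.mem_product.1 hu).2]
    exact entry_sub_entry_mem_liftable hE n
      (linked_of_invariant _ u u' m m' rfl (by omega) (by omega) h1.1 h1.2) (by omega)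
  · intro e t ht
    have h1 := congrArg (coeff e) hchart
    rw [coeff_zero, coeff_sum] at h1
    have h2 : ∀ m : Fin (D.b n + 1), coeff e (chart (0 : Fin k → ℕ → R) (h m) * X (tVar k) ^ (m : ℕ)) =
        ∑ u ∈ U, if chartExponent u + Finsupp.single (tVar k) (m : ℕ) = e then coeff u (h m) else 0 := by
      intro m
      conv_lhs => rw [hsum m, map_sum, Finset.sum_mul, coeff_sum]
      refine Finset.sum_congr rfl fun u _ => ?_
      rw [chart_zero_monomial, X_pow_eq_monomial, monomial_mul, mul_one, coeff_monomial]
    rw [Finset.sum_congr rfl fun m _ => h2 m, ← Finset.sum_product' (s := Finset.univ) (t := U)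
      (f := fun (m : Fin (D.b n + 1)) u =>
        if chartExponent u + Finsupp.single (tVar k) (m : ℕ) = e then coeff u (h m) else 0),
      ← Finset.sum_filter] at h1
    rw [← h1]
    refine Finset.sum_congr ?_ fun _ _ => rfl
    ext x
    rw [ht, Finset.mem_filter]

end QuadricSystem

/-! ### Koszul relations and the lifting of all syzygies -/

namespace QuadricSystem

variable {K : Type*} [Field K] {k l : ℕ} {D : QuadricSystem K k l}
variable {R : Type*} [CommRing R] [Algebra K R] {ζ : Fin k → ℕ → R}
  {E : Fin l → ℕ → MvPolynomial (ZVar D.d) R}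

lemma map_toCox {d : Fin k → ℕ} (p : MvPolynomial (ZVar d) K) :
    map (algebraMap K R) (toCox K d p) = toCox R d (map (algebraMap K R) p) := by
  induction p using MvPolynomial.induction_on with
  | C a => simp [toCox]
  | add p q hp hq => simp only [map_add, hp, hq]
  | mul_X p z hp => rw [map_mul, map_mul, hp, map_mul, map_mul]; simp [toCox]

/-- Extension of scalars for families of coefficients. -/
def mapFamily (D : QuadricSystem K k l) (R : Type*) [CommRing R] [Algebra K R]
    (h : D.EqnIdx → MvPolynomial (ZVar D.d) K) : D.EqnIdx → MvPolynomial (ZVar D.d) R :=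
  fun i => map (algebraMap K R) (h i)

lemma mapFamily_add (h h' : D.EqnIdx → MvPolynomial (ZVar D.d) K) :
    D.mapFamily R (h + h') = D.mapFamily R h + D.mapFamily R h' := by
  ext1 i; simp [mapFamily]

lemma mapFamily_sub (h h' : D.EqnIdx → MvPolynomial (ZVar D.d) K) :
    D.mapFamily R (h - h') = D.mapFamily R h - D.mapFamily R h' := by
  ext1 i; simp [mapFamily]

lemma mapFamily_sum {ι : Type*} (s : Finset ι) (h : ι → D.EqnIdx → MvPolynomial (ZVar D.d) K) :
    D.mapFamily R (∑ x ∈ s, h x) = ∑ x ∈ s, D.mapFamily R (h x) := by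
  ext1 i
  simp only [mapFamily, Finset.sum_apply, map_sum]

lemma mapFamily_single (i : D.EqnIdx) (p : MvPolynomial (ZVar D.d) K) :
    D.mapFamily R (Pi.single i p) = Pi.single i (map (algebraMap K R) p) := by
  ext1 j
  rw [mapFamily]
  by_cases h : j = i
  · subst h; rw [Pi.single_eq_same, Pi.single_eq_same]
  · rw [Pi.single_eq_of_ne h, Pi.single_eq_of_ne h, map_zero]

/-- The section `∑_m h_m s^{b-m} t^m` of a family of coefficients for the equations `P^(n)_m`. -/
def sectionOf (D : QuadricSystem K k l) (n : Fin l) (h : D.EqnIdx → MvPolynomial (ZVar D.d) K) :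
    MvPolynomial (CoxVar k) K :=
  ∑ m : Fin (D.b n + 1), toCox K D.d (h ⟨n, m⟩) * (X (sVar k) ^ (D.b n - (m : ℕ)) * X (tVar k) ^ (m : ℕ))

/-- As `P^(n)_m` restricts to `s^{b-m} t^m P^(n)`, the many equations of one divisor collapse to a
single term, and the regular sequence `P^(n)` can be used. -/
lemma toCox_combination (h : D.EqnIdx → MvPolynomial (ZVar D.d) K) :
    toCox K D.d (D.combination D.eqn h) = ∑ n, D.sectionOf n h * D.P n := by
  rw [combination_apply, map_sum, Fintype.sum_sigma]
  refine Finset.sum_congr rfl fun n _ => ?_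
  rw [sectionOf, Finset.sum_mul]
  refine Finset.sum_congr rfl fun m _ => ?_
  rw [map_mul, D.toCox_eqn n m (by omega)]
  ring

lemma sectionOf_homogeneous {h : D.EqnIdx → MvPolynomial (ZVar D.d) K} {q : ℕ}
    (hq : ∀ i, (h i).IsHomogeneous q) (n : Fin l) :
    IsWeightedHomogeneous (bidegree D.d) (D.sectionOf n h) ((q : ℤ), (D.b n : ℤ)) := by
  refine IsWeightedHomogeneous.sum _ _ _ fun m _ => ?_
  have h1 := (toCox_isWeightedHomogeneous (hq ⟨n, m⟩)).mul
    (((isWeightedHomogeneous_sVar (K := K) D.d).pow (D.b n - (m : ℕ))).mul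
      ((isWeightedHomogeneous_tVar (K := K) D.d).pow (m : ℕ)))
  have hm : (m : ℕ) ≤ D.b n := by omega
  have h2 : (((q : ℤ), (0 : ℤ)) + ((D.b n - (m : ℕ)) • ((0 : ℤ), (1 : ℤ)) +
      (m : ℕ) • ((0 : ℤ), (1 : ℤ)))) = ((q : ℤ), (D.b n : ℤ)) := by
    ext
    · simp
    · simp [Nat.cast_sub hm]
  rwa [h2] at h1

lemma sectionOf_sub (n : Fin l) (h h' : D.EqnIdx → MvPolynomial (ZVar D.d) K) :
    D.sectionOf n (h - h') = D.sectionOf n h - D.sectionOf n h' := by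
  simp only [sectionOf, Pi.sub_apply, map_sub, sub_mul, Finset.sum_sub_distrib]

lemma sectionOf_sum {ι : Type*} (n : Fin l) (s : Finset ι)
    (h : ι → D.EqnIdx → MvPolynomial (ZVar D.d) K) :
    D.sectionOf n (∑ x ∈ s, h x) = ∑ x ∈ s, D.sectionOf n (h x) := by
  simp only [sectionOf, Finset.sum_apply, map_sum, Finset.sum_mul]
  rw [Finset.sum_comm]

lemma sectionOf_single (n : Fin l) (m : Fin (D.b n + 1)) (p : MvPolynomial (ZVar D.d) K) :
    D.sectionOf n (Pi.single ⟨n, m⟩ p) =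
      toCox K D.d p * (X (sVar k) ^ (D.b n - (m : ℕ)) * X (tVar k) ^ (m : ℕ)) := by
  rw [sectionOf, Finset.sum_eq_single m]
  · rw [Pi.single_eq_same]
  · intro m' _ h
    rw [Pi.single_eq_of_ne (by simpa using h), map_zero, zero_mul]
  · simp

lemma sectionOf_single_of_ne {n n' : Fin l} (h : n ≠ n') (m : Fin (D.b n' + 1))
    (p : MvPolynomial (ZVar D.d) K) : D.sectionOf n (Pi.single ⟨n', m⟩ p) = 0 := by
  refine Finset.sum_eq_zero fun m' _ => ?_
  rw [Pi.single_eq_of_ne (by simp [h]), map_zero, zero_mul]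

/-- The Koszul relation between two equations, multiplied by `g`. -/
def koszul (i j : D.EqnIdx) (g : MvPolynomial (ZVar D.d) K) :
    D.EqnIdx → MvPolynomial (ZVar D.d) K :=
  Pi.single i (g * D.eqn j.1 j.2) - Pi.single j (g * D.eqn i.1 i.2)

lemma combination_koszul (i j : D.EqnIdx) (g : MvPolynomial (ZVar D.d) K) :
    D.combination D.eqn (koszul i j g) = 0 := by
  rw [koszul, map_sub, combination_single, combination_single]
  ring

lemma koszul_homogeneous {i j : D.EqnIdx} {g : MvPolynomial (ZVar D.d) K} {q : ℕ}
    (hg : g.IsHomogeneous q) (x : D.EqnIdx) : (koszul i j g x).IsHomogeneous (q + 2) := by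
  have h : ∀ (i j : D.EqnIdx), ((Pi.single i (g * D.eqn j.1 j.2) :
      D.EqnIdx → MvPolynomial (ZVar D.d) K) x).IsHomogeneous (q + 2) := by
    intro i j
    have := j.2.2
    by_cases hx : x = i
    · subst hx; rw [Pi.single_eq_same]; exact hg.mul (D.eqn_homogeneous _ _ (by omega))
    · rw [Pi.single_eq_of_ne hx]; exact isHomogeneous_zero _ _ _
  exact (h i j).sub (h j i)

/-- Writing the deformed equations in place of their leading forms gives a Koszul relation that
holds exactly. -/
lemma koszul_mem_liftable (hE : D.IsRollingFamily ζ E) (i j : D.EqnIdx)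
    {g : MvPolynomial (ZVar D.d) K} {q : ℕ} (hg : g.IsHomogeneous q) :
    D.mapFamily R (koszul i j g) ∈ D.liftable ζ E (q + 2) := by
  have hg' : map (algebraMap K R) g ∈ degreeLT R (ZVar D.d) (q + 1) :=
    IsHomogeneous.mem_degreeLT (hg.map _)
  have hi := i.2.2
  have hj := j.2.2
  refine ⟨Pi.single i (map (algebraMap K R) g * E j.1 j.2) -
    Pi.single j (map (algebraMap K R) g * E i.1 i.2), fun x => ?_, ?_⟩
  · rw [koszul, mapFamily_sub, mapFamily_single, mapFamily_single, Pi.sub_apply, Pi.sub_apply,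
      sub_sub_sub_comm]
    refine sub_mem (single_sub_mem_degreeLT ?_ x) (single_sub_mem_degreeLT ?_ x)
    · rw [map_mul, ← mul_sub]
      exact mul_mem_degreeLT hg' (hE.leading _ _ (by omega))
    · rw [map_mul, ← mul_sub]
      exact mul_mem_degreeLT hg' (hE.leading _ _ (by omega))
  · rw [map_sub, combination_single, combination_single]
    have : map (algebraMap K R) g * E j.1 j.2 * E i.1 i.2 -
        map (algebraMap K R) g * E i.1 i.2 * E j.1 j.2 = 0 := by ring
    rw [this]
    exact zero_mem _

/-- A homogeneous section which vanishes modulo the previous equations comes from Koszul relations. -/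
lemma exists_koszul (n₀ : Fin l) {H : MvPolynomial (CoxVar k) K} {q : ℕ}
    (hH : IsWeightedHomogeneous (bidegree D.d) H ((q : ℤ), (D.b n₀ : ℤ)))
    (hmem : H ∈ initialIdeal D.P n₀) :
    ∃ g : (n : Fin l) → Fin (D.b n + 1) → Fin (D.b n₀ + 1) → MvPolynomial (ZVar D.d) K,
      (∀ n m m', g n m m' = 0 ∨ ((n : ℕ) < n₀ ∧ ∃ q', q' + 2 = q ∧ (g n m m').IsHomogeneous q')) ∧
      H = ∑ n, ∑ m, ∑ m', toCox K D.d (g n m m') *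
        (X (sVar k) ^ (D.b n - (m : ℕ)) * X (tVar k) ^ (m : ℕ)) *
        (X (sVar k) ^ (D.b n₀ - (m' : ℕ)) * X (tVar k) ^ (m' : ℕ)) * D.P n := by
  classical
  let f : Fin l → MvPolynomial (CoxVar k) K := fun n => if (n : ℕ) < n₀ then D.P n else 0
  have hf : ∀ n, IsWeightedHomogeneous (bidegree D.d) (f n) (2, -(D.b n : ℤ)) := by
    intro n
    simp only [f]
    split_ifs
    · exact (D.isDivisorEquation n).bidegree
    · exact isWeightedHomogeneous_zero _ _ _
  have hle : initialIdeal D.P n₀ ≤ Ideal.span (Set.range f) := by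
    rw [initialIdeal, Ideal.span_le]
    rintro _ ⟨i, hi, rfl⟩
    exact Ideal.subset_span ⟨i, if_pos hi⟩
  obtain ⟨c, hc, hHc⟩ := exists_homogeneous_coeffs hf hH (hle hmem)
  -- The coefficient of `P^(n)` has room for both twists: `s^{b n - m} t^m` completes `P^(n)` to
  -- `P^(n)_m`, and the other factor tells which `P^(n₀)_{m'}` enters the Koszul relation.
  have hc' : ∀ n, IsWeightedHomogeneous (bidegree D.d) (c n) ((q : ℤ) - 2, (D.b n : ℤ) + D.b n₀) := by
    intro n
    have := hc n
    rwa [Prod.mk_sub_mk, sub_neg_eq_add, add_comm (D.b n₀ : ℤ)] at this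
  choose g hg hg' using fun n => exists_sections (hc' n)
  refine ⟨fun n m m' => if (n : ℕ) < n₀ then g n m m' else 0, fun n m m' => ?_, ?_⟩
  · beta_reduce
    split_ifs with hn
    · by_cases h0 : g n m m' = 0
      · exact Or.inl h0
      · obtain ⟨u, hu⟩ := ne_zero_iff.1 h0
        have hdu := hg n m m' u hu
        refine Or.inr ⟨hn, u.degree, by omega, fun v hv => ?_⟩
        have hdv := hg n m m' v hv
        have h1 := DFunLike.congr_fun (Finsupp.degree_eq_weight_one (σ := ZVar D.d) (R := ℕ)) v
        have h2 : Finsupp.weight 1 v = v.degree := h1.symm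
        rw [h2]
        omega
    · exact Or.inl rfl
  · rw [hHc]
    refine Finset.sum_congr rfl fun n _ => ?_
    by_cases hn : (n : ℕ) < n₀
    · simp only [f, if_pos hn]
      conv_lhs => rw [hg' n]
      simp only [Finset.sum_mul]
    · simp only [f, if_neg hn, map_zero, zero_mul, Finset.sum_const_zero, mul_zero]

/-- The syzygies of the `P^(n)_m` over the homogeneous coordinate ring of the scroll lift. -/
theorem mapFamily_mem_liftable (hE : D.IsRollingFamily ζ E) {q : ℕ} (N : ℕ) (hN : N ≤ l) :
    ∀ h : D.EqnIdx → MvPolynomial (ZVar D.d) K, (∀ i, (h i).IsHomogeneous q) →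
      toCox K D.d (D.combination D.eqn h) = 0 → (∀ i, N ≤ (i.1 : ℕ) → h i = 0) →
      D.mapFamily R h ∈ D.liftable ζ E q := by
  classical
  induction N with
  | zero =>
    intro h _ _ h0
    have : D.mapFamily R h = 0 := by
      ext1 i
      rw [mapFamily, h0 i (Nat.zero_le _), map_zero]; rfl
    rw [this]
    exact zero_mem _
  | succ N ih =>
    intro h hq hrel h0
    let n₀ : Fin l := ⟨N, by omega⟩
    have hzero : ∀ {h : D.EqnIdx → MvPolynomial (ZVar D.d) K} {n : Fin l}, (∀ m, h ⟨n, m⟩ = 0) →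
        D.sectionOf n h = 0 := by
      intro h n hn
      refine Finset.sum_eq_zero fun m _ => ?_
      rw [hn, map_zero, zero_mul]
    -- Only divisors up to `n₀` occur, so the relation places the last term in the ideal of the
    -- previous equations. Its section has weight `b n₀ ≥ 0`, where regularity is available.
    have hmul : D.sectionOf n₀ h * D.P n₀ ∈ initialIdeal D.P n₀ := by
      rw [toCox_combination, ← Finset.add_sum_erase _ _ (Finset.mem_univ n₀)] at hrel
      rw [eq_neg_of_add_eq_zero_left hrel]
      refine neg_mem (Ideal.sum_mem _ fun n hn => ?_)
      have hne := (Finset.mem_erase.1 hn).1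
      by_cases hlt : (n : ℕ) < N
      · exact Ideal.mul_mem_left _ _ (Ideal.subset_span ⟨n, hlt, rfl⟩)
      · have : N ≠ n := fun h => hne (Fin.ext h.symm)
        rw [hzero fun m => h0 _ (by dsimp only; omega), zero_mul]
        exact zero_mem _
    have hsec := sectionOf_homogeneous hq n₀
    have hmem := mem_initialIdeal_of_mul_mem' D.isDivisorEquation D.isCompleteIntersection n₀
      (by omega) hsec hmul
    obtain ⟨g, hg, hgsum⟩ := exists_koszul n₀ hsec hmem
    let kos : D.EqnIdx → MvPolynomial (ZVar D.d) K :=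
      ∑ n, ∑ m, ∑ m', koszul ⟨n₀, m'⟩ ⟨n, m⟩ (g n m m')
    have hkz : ∀ (i j : D.EqnIdx), koszul i j 0 = 0 := by
      intro i j; simp [koszul]
    have hkos_lift : D.mapFamily R kos ∈ D.liftable ζ E q := by
      simp only [kos, mapFamily_sum]
      refine Submodule.sum_mem _ fun n _ => Submodule.sum_mem _ fun m _ => Submodule.sum_mem _ fun m' _ => ?_
      rcases hg n m m' with h1 | ⟨-, q', rfl, h1⟩
      · have h2 : D.mapFamily R (0 : D.EqnIdx → MvPolynomial (ZVar D.d) K) = 0 := by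
          ext1 i; simp [mapFamily]
        rw [h1, hkz, h2]
        exact zero_mem _
      · exact koszul_mem_liftable hE _ _ h1
    have hkos_hom : ∀ i, (kos i).IsHomogeneous q := by
      intro i
      simp only [kos, Finset.sum_apply]
      refine IsHomogeneous.sum _ _ _ fun n _ => IsHomogeneous.sum _ _ _ fun m _ =>
        IsHomogeneous.sum _ _ _ fun m' _ => ?_
      rcases hg n m m' with h1 | ⟨-, q', rfl, h1⟩
      · rw [h1, hkz]; exact isHomogeneous_zero _ _ _
      · exact koszul_homogeneous h1 i
    have hkos_rel : D.combination D.eqn kos = 0 := by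
      simp only [kos, map_sum, combination_koszul, Finset.sum_const_zero]
    have hkos_sec : D.sectionOf n₀ kos = D.sectionOf n₀ h := by
      rw [hgsum]
      simp only [kos, sectionOf_sum]
      refine Finset.sum_congr rfl fun n _ => Finset.sum_congr rfl fun m _ =>
        Finset.sum_congr rfl fun m' _ => ?_
      rcases hg n m m' with h1 | ⟨hn, -⟩
      · rw [h1, hkz, hzero fun _ => rfl]; simp
      · have hne : n₀ ≠ n := fun h => by rw [← h] at hn; exact lt_irrefl _ hn
        rw [koszul, sectionOf_sub, sectionOf_single, sectionOf_single_of_ne hne, sub_zero, map_mul,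
          D.toCox_eqn n m (by omega)]
        ring
    have hkos_supp : ∀ i : D.EqnIdx, N + 1 ≤ (i.1 : ℕ) → kos i = 0 := by
      intro i hi
      simp only [kos, Finset.sum_apply]
      refine Finset.sum_eq_zero fun n _ => Finset.sum_eq_zero fun m _ => Finset.sum_eq_zero fun m' _ => ?_
      rcases hg n m m' with h1 | ⟨hn, -⟩
      · rw [h1, hkz]; rfl
      · have hn' : (n : ℕ) < N := hn
        have h1 : i ≠ ⟨n₀, m'⟩ := by rintro rfl; simp only [n₀] at hi; omega
        have h2 : i ≠ ⟨n, m⟩ := by rintro rfl; simp only at hi; omega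
        rw [koszul, Pi.sub_apply, Pi.single_eq_of_ne h1, Pi.single_eq_of_ne h2, sub_zero]
    -- The section of `n₀` is now zero, so the entries at `n₀` form a relation by themselves, which
    -- lifts by rolling. The remaining entries involve only earlier divisors.
    set h₁ := h - kos with hh₁
    have hh₁_hom : ∀ i, (h₁ i).IsHomogeneous q := fun i => (hq i).sub (hkos_hom i)
    have hh₁_sec : D.sectionOf n₀ h₁ = 0 := by
      rw [hh₁, sectionOf_sub, hkos_sec, sub_self]
    let top : D.EqnIdx → MvPolynomial (ZVar D.d) K := ∑ m, Pi.single ⟨n₀, m⟩ (h₁ ⟨n₀, m⟩)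
    have htop : ∀ i, top i = if i.1 = n₀ then h₁ i else 0 := by
      rintro ⟨n, m⟩
      simp only [top, Finset.sum_apply]
      split_ifs with hn
      · subst hn
        rw [Finset.sum_eq_single m]
        · rw [Pi.single_eq_same]
        · intro m' _ h; rw [Pi.single_eq_of_ne (by simpa using h.symm)]
        · simp
      · refine Finset.sum_eq_zero fun m' _ => ?_
        rw [Pi.single_eq_of_ne (by simp [hn])]
    have htop_lift : D.mapFamily R top ∈ D.liftable ζ E q := by
      have h1 := sum_entry_mem_liftable hE n₀ (q := q)
        (h := fun m => map (algebraMap K R) (h₁ ⟨n₀, m⟩)) (fun m => (hh₁_hom _).map _) ?_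
      · simp only [top, mapFamily_sum, mapFamily_single]
        simpa only [entry_fin] using h1
      · have h2 := congrArg (map (algebraMap K R)) hh₁_sec
        rw [sectionOf, map_sum, map_zero] at h2
        rw [← h2]
        refine Finset.sum_congr rfl fun m _ => ?_
        simp only [map_mul, map_pow, map_X, map_toCox]
    have htop_rel : toCox K D.d (D.combination D.eqn top) = 0 := by
      rw [toCox_combination]
      refine Finset.sum_eq_zero fun n _ => ?_
      by_cases hn : n = n₀
      · have : D.sectionOf n top = D.sectionOf n h₁ := by
          refine Finset.sum_congr rfl fun m _ => ?_
          rw [htop, if_pos hn]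
        rw [this, hn, hh₁_sec, zero_mul]
      · rw [hzero fun m => by rw [htop, if_neg hn], zero_mul]
    have hfin := ih (by omega) (h₁ - top) (fun i => (hh₁_hom i).sub (by
        rw [htop]; split_ifs
        · exact hh₁_hom i
        · exact isHomogeneous_zero _ _ _)) (by
        rw [map_sub, map_sub, htop_rel, hh₁, map_sub, hkos_rel, sub_zero, sub_zero, hrel]) (by
        intro i hi
        rw [Pi.sub_apply, htop]
        split_ifs with hn
        · exact sub_self _
        · have : (i.1 : ℕ) ≠ N := fun h => hn (Fin.ext h)
          rw [hh₁, Pi.sub_apply, h0 i (by omega), hkos_supp i (by omega), sub_zero, sub_zero])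
    have : h = (h₁ - top) + top + kos := by rw [hh₁]; abel
    rw [this, mapFamily_add, mapFamily_add]
    exact add_mem (add_mem hfin htop_lift) hkos_lift

/-- The relations, over the homogeneous coordinate ring of the scroll, between the leading forms of
the equations lift. -/
theorem mem_liftable (hE : D.IsRollingFamily ζ E) {q : ℕ}
    {g : D.EqnIdx → MvPolynomial (ZVar D.d) R} (hq : ∀ i, (g i).IsHomogeneous q)
    (hg : ∑ i, g i * map (algebraMap K R) (D.eqn i.1 i.2) ∈ scrollIdeal D.d (0 : Fin k → ℕ → R)) :
    g ∈ D.liftable ζ E q := by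
  classical
  -- Scroll and leading forms are defined over `K`; expanding coefficients in a `K`-basis of `R`
  -- makes a relation over `R` an `R`-combination of relations over `K`.
  let B := Module.Basis.ofVectorSpace K R
  have hscroll : scrollIdeal D.d (0 : Fin k → ℕ → R) =
      (scrollIdeal D.d (0 : Fin k → ℕ → K)).map (map (algebraMap K R)) := by
    rw [scrollIdeal, scrollIdeal, Ideal.map_span]
    congr 1
    ext p
    constructor
    · rintro ⟨α, β, rfl⟩
      exact ⟨_, ⟨α, β, rfl⟩, by simp [scrollMinor]⟩
    · rintro ⟨_, ⟨α, β, rfl⟩, rfl⟩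
      exact ⟨α, β, by simp [scrollMinor]⟩
  let S : Finset (Module.Basis.ofVectorSpaceIndex K R) := Finset.univ.biUnion fun i : D.EqnIdx =>
    (g i).support.biUnion fun u => (B.repr (coeff u (g i))).support
  have hsum : g = ∑ x ∈ S, B x • D.mapFamily R (fun i => mapCoeff _ (B.coord x) (g i)) := by
    ext1 i
    rw [Finset.sum_apply]
    ext u
    rw [coeff_sum]
    simp only [Pi.smul_apply, coeff_smul, mapFamily, coeff_map, coeff_mapCoeff]
    by_cases hu : u ∈ (g i).support
    · have hS : (B.repr (coeff u (g i))).support ⊆ S := fun x hx =>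
        Finset.mem_biUnion.2 ⟨i, Finset.mem_univ i, Finset.mem_biUnion.2 ⟨u, hu, hx⟩⟩
      conv_lhs => rw [← B.linearCombination_repr (coeff u (g i)), Finsupp.linearCombination_apply,
        Finsupp.sum]
      rw [Finset.sum_subset hS]
      · refine Finset.sum_congr rfl fun x _ => ?_
        rw [Algebra.smul_def, smul_eq_mul, mul_comm]; rfl
      · intro x _ hx
        rw [Finsupp.notMem_support_iff.1 hx, zero_smul]
    · rw [notMem_support_iff.1 hu]
      simp
  rw [hsum]
  refine Submodule.sum_mem _ fun x _ => Submodule.smul_mem _ _ ?_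
  refine mapFamily_mem_liftable hE l le_rfl _ (fun i u hu => hq i ?_) ?_ (fun i hi => ?_)
  · intro h
    rw [coeff_mapCoeff, h, map_zero] at hu
    exact hu rfl
  · rw [hscroll] at hg
    have h1 := mapCoeff_mem (B.coord x) hg
    rw [map_sum] at h1
    simp only [mapCoeff_mul_map] at h1
    exact toCox_scrollIdeal h1
  · have := i.1.2
    omega

/-! ### Initial forms and flatness of a rolling family -/

/-- The ideal of a rolling family on a deformed scroll. -/
def familyIdeal (D : QuadricSystem K k l) (ζ : Fin k → ℕ → R)
    (E : Fin l → ℕ → MvPolynomial (ZVar D.d) R) : Ideal (MvPolynomial (ZVar D.d) R) :=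
  scrollIdeal D.d ζ ⊔ Ideal.span (Set.range fun i : D.EqnIdx => E i.1 i.2)

/-- Leading forms of elements of the ideal of a rolling family. -/
lemma leadingForm_mem (hE : D.IsRollingFamily ζ E) {e : ℕ} {x : MvPolynomial (ZVar D.d) R}
    (hdeg : x ∈ degreeLT R (ZVar D.d) (e + 1)) (q : ℕ) :
    ∀ h : D.EqnIdx → MvPolynomial (ZVar D.d) R, (∀ i, h i ∈ degreeLT R (ZVar D.d) q) →
      x - D.combination E h ∈ scrollIdeal D.d ζ →
      homogeneousComponent e x ∈ D.familyIdeal (0 : Fin k → ℕ → R)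
        (fun n m => map (algebraMap K R) (D.eqn n m)) := by
  have hlead : ∀ (q : ℕ) (h : D.EqnIdx → MvPolynomial (ZVar D.d) R),
      (∀ i, h i ∈ degreeLT R (ZVar D.d) (q + 1)) → ∃ r ∈ degreeLT R (ZVar D.d) (q + 2),
      D.combination E h = D.combination (fun n m => map (algebraMap K R) (D.eqn n m))
        (fun i => homogeneousComponent q (h i)) + r := by
    intro q h hh
    refine ⟨D.combination E h - D.combination (fun n m => map (algebraMap K R) (D.eqn n m))
        (fun i => homogeneousComponent q (h i)), ?_, by ring⟩
    rw [combination_apply, combination_apply, ← Finset.sum_sub_distrib]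
    refine Submodule.sum_mem _ fun i _ => ?_
    have hi := i.2.2
    have h1 : h i * E i.1 i.2 - homogeneousComponent q (h i) * map (algebraMap K R) (D.eqn i.1 i.2) =
      h i * (E i.1 i.2 - map (algebraMap K R) (D.eqn i.1 i.2)) +
      (h i - homogeneousComponent q (h i)) * map (algebraMap K R) (D.eqn i.1 i.2) := by ring
    rw [h1]
    exact add_mem (mul_mem_degreeLT (hh i) (hE.leading _ _ (by omega)))
      (mul_mem_degreeLT' (sub_homogeneousComponent_mem (hh i))
        (IsHomogeneous.mem_degreeLT ((D.eqn_homogeneous _ _ (by omega)).map _)))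
  have hzero : ∀ {p : MvPolynomial (ZVar D.d) R}, p ∈ degreeLT R (ZVar D.d) 0 → p = 0 := by
    intro p hp
    ext u
    by_contra hne
    exact absurd (mem_degreeLT.1 hp u hne) (by omega)
  induction q with
  | zero =>
    intro h hh hx
    have : h = 0 := funext fun i => hzero (hh i)
    rw [this, map_zero, sub_zero] at hx
    exact Ideal.mem_sup_left (initialForm_mem_scrollIdeal ζ hx hdeg)
  | succ q ih =>
    intro h hh hx
    obtain ⟨r, hr, hhr⟩ := hlead q h hh
    have hq : ∀ i, (homogeneousComponent q (h i)).IsHomogeneous q := fun i =>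
      homogeneousComponent_isHomogeneous _ _
    have hcomb : (D.combination (fun n m => map (algebraMap K R) (D.eqn n m))
        (fun i => homogeneousComponent q (h i))).IsHomogeneous (q + 2) := by
      rw [combination_apply]
      refine IsHomogeneous.sum _ _ _ fun i _ => (hq i).mul ((D.eqn_homogeneous _ _ ?_).map _)
      have := i.2.2
      omega
    have hmem : D.combination E h ∈ degreeLT R (ZVar D.d) (q + 3) := by
      rw [hhr]
      exact add_mem (IsHomogeneous.mem_degreeLT hcomb) (degreeLT_mono (by omega) hr)
    have hcomp : homogeneousComponent (q + 2) (D.combination E h) =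
        D.combination (fun n m => map (algebraMap K R) (D.eqn n m))
        (fun i => homogeneousComponent q (h i)) := by
      rw [hhr, map_add, homogeneousComponent_of_mem_degreeLT hr le_rfl, add_zero,
        homogeneousComponent_eq_self hcomb]
    have hcmem : D.combination (fun n m => map (algebraMap K R) (D.eqn n m))
        (fun i => homogeneousComponent q (h i)) ∈ D.familyIdeal (0 : Fin k → ℕ → R)
        (fun n m => map (algebraMap K R) (D.eqn n m)) := by
      rw [combination_apply]
      exact Ideal.sum_mem _ fun i _ => Ideal.mul_mem_left _ _
        (Ideal.mem_sup_right (Ideal.subset_span ⟨i, rfl⟩))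
    -- If `e < q + 2`, the leading forms cancel on the scroll, and subtracting a lift of that
    -- relation lowers the degree of the coefficients. Otherwise the combination has no terms above
    -- degree `e`, and its degree-`e` part can be read off.
    rcases lt_or_ge e (q + 2) with he | he
    · have h1 := initialForm_mem_scrollIdeal (e := q + 2) ζ hx
        (sub_mem (degreeLT_mono (by omega) hdeg) hmem)
      rw [map_sub, homogeneousComponent_of_mem_degreeLT hdeg (by omega), zero_sub, hcomp] at h1
      obtain ⟨h', hh', hrel⟩ := mem_liftable hE hq (by
        rw [Submodule.neg_mem_iff, combination_apply] at h1; exact h1)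
      refine ih (h - h') (fun i => ?_) ?_
      · have h2 : (h - h') i = (h i - homogeneousComponent q (h i)) -
          (h' i - homogeneousComponent q (h i)) := by rw [Pi.sub_apply]; ring
        rw [h2]
        exact sub_mem (sub_homogeneousComponent_mem (hh i)) (hh' i)
      · rw [map_sub, sub_sub_eq_add_sub, add_sub_right_comm]
        exact add_mem hx hrel
    · have h1 := initialForm_mem_scrollIdeal (e := e) ζ hx
        (sub_mem hdeg (degreeLT_mono (by omega) hmem))
      rw [map_sub] at h1
      rw [← sub_add_cancel (homogeneousComponent e x) (homogeneousComponent e (D.combination E h))]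
      refine add_mem (Ideal.mem_sup_left h1) ?_
      rcases he.eq_or_lt with he | he
      · rw [← he, hcomp]; exact hcmem
      · rw [homogeneousComponent_of_mem_degreeLT hmem (by omega)]
        exact zero_mem _

/-- The family defined by a rolling family of equations is flat. -/
theorem free_familyIdeal (hE : D.IsRollingFamily ζ E) :
    Module.Free R (MvPolynomial (ZVar D.d) R ⧸ D.familyIdeal ζ E) := by
  have hmap : (D.familyIdeal (0 : Fin k → ℕ → K) D.eqn).map (map (algebraMap K R)) =
      D.familyIdeal (0 : Fin k → ℕ → R) (fun n m => map (algebraMap K R) (D.eqn n m)) := by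
    rw [familyIdeal, familyIdeal, Ideal.map_sup, scrollIdeal, scrollIdeal, Ideal.map_span,
      Ideal.map_span, ← Set.range_comp]
    congr 2
    ext p
    constructor
    · rintro ⟨_, ⟨α, β, rfl⟩, rfl⟩
      exact ⟨α, β, by simp [scrollMinor]⟩
    · rintro ⟨α, β, rfl⟩
      exact ⟨_, ⟨α, β, rfl⟩, by simp [scrollMinor]⟩
  refine free_of_initialForms (I₀ := D.familyIdeal (0 : Fin k → ℕ → K) D.eqn) ?_ ?_
  · have hgen : ∀ (f : MvPolynomial (ZVar D.d) K) (G : MvPolynomial (ZVar D.d) R), f.IsHomogeneous 2 →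
        G ∈ D.familyIdeal ζ E → G - map (algebraMap K R) f ∈ degreeLT R (ZVar D.d) 2 → ∀ a e,
        ∃ x ∈ D.familyIdeal ζ E,
          x - map (algebraMap K R) (homogeneousComponent e (a * f)) ∈ degreeLT R (ZVar D.d) e := by
      intro f G hf hG hGf a e
      rcases lt_or_ge e 2 with he | he
      · exact ⟨0, zero_mem _, by rw [homogeneousComponent_mul_of_lt hf he]; simp⟩
      · obtain ⟨e, rfl⟩ := Nat.exists_eq_add_of_le' he
        refine ⟨map (algebraMap K R) (homogeneousComponent e a) * G, Ideal.mul_mem_left _ _ hG, ?_⟩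
        rw [homogeneousComponent_mul hf, map_mul, ← mul_sub]
        exact mul_mem_degreeLT (IsHomogeneous.mem_degreeLT
          ((homogeneousComponent_isHomogeneous _ _).map _)) hGf
    intro f hf
    rw [familyIdeal, scrollIdeal, ← Ideal.span_union] at hf
    suffices h : ∀ a e, ∃ x ∈ D.familyIdeal ζ E,
        x - map (algebraMap K R) (homogeneousComponent e (a * f)) ∈ degreeLT R (ZVar D.d) e by
      intro e; simpa using h 1 e
    refine Submodule.span_induction (p := fun f _ => ∀ a e, ∃ x ∈ D.familyIdeal ζ E,
        x - map (algebraMap K R) (homogeneousComponent e (a * f)) ∈ degreeLT R (ZVar D.d) e)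
        ?_ ?_ ?_ ?_ hf
    · rintro f (⟨α, β, rfl⟩ | ⟨i, rfl⟩)
      · refine hgen _ (scrollMinor D.d ζ α β) ?_
          (Ideal.mem_sup_left (Ideal.subset_span ⟨α, β, rfl⟩)) ?_
        · simp only [scrollMinor, Pi.zero_apply, C_0, add_zero]
          exact ((isHomogeneous_X _ _).mul (isHomogeneous_X _ _)).sub
            ((isHomogeneous_X _ _).mul (isHomogeneous_X _ _))
        · have : scrollMinor D.d ζ α β - map (algebraMap K R) (scrollMinor D.d 0 α β) =
              C (ζ β.1 (β.2 + 1)) * X α.top - C (ζ α.1 (α.2 + 1)) * X β.top := by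
            simp only [scrollMinor, Pi.zero_apply, C_0, add_zero, map_sub, map_mul, map_X]; ring
          rw [this]
          exact sub_mem (C_mul_mem_degreeLT _ (IsHomogeneous.mem_degreeLT (isHomogeneous_X _ _)))
            (C_mul_mem_degreeLT _ (IsHomogeneous.mem_degreeLT (isHomogeneous_X _ _)))
      · have := i.2.2
        exact hgen _ (E i.1 i.2) (D.eqn_homogeneous _ _ (by omega))
          (Ideal.mem_sup_right (Ideal.subset_span ⟨i, rfl⟩)) (hE.leading _ _ (by omega))
    · intro a e
      exact ⟨0, zero_mem _, by simp⟩
    · intro f g _ _ hf hg a e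
      obtain ⟨x, hx, hx'⟩ := hf a e
      obtain ⟨y, hy, hy'⟩ := hg a e
      refine ⟨x + y, add_mem hx hy, ?_⟩
      rw [mul_add, map_add, map_add, add_sub_add_comm]
      exact add_mem hx' hy'
    · intro c f _ hf a e
      rw [smul_eq_mul, ← mul_assoc]
      exact hf _ _
  · intro e x hx hdeg
    rw [hmap]
    obtain ⟨y, hy, z, hz, rfl⟩ := Submodule.mem_sup.1 hx
    obtain ⟨h, hh⟩ := (Submodule.mem_span_range_iff_exists_fun _).1 hz
    have hfin : ∃ q, ∀ i, h i ∈ degreeLT R (ZVar D.d) q := by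
      choose q hq using fun i => exists_mem_degreeLT (h i)
      exact ⟨Finset.univ.sup q, fun i => degreeLT_mono (Finset.le_sup (Finset.mem_univ i)) (hq i)⟩
    obtain ⟨q, hq⟩ := hfin
    refine leadingForm_mem hE hdeg q h hq ?_
    have : D.combination E h = z := by rw [← hh]; rfl
    rw [this, add_sub_cancel_right]
    exact hy

end QuadricSystem

lemma eq_sum_of_isHomogeneous_one {R σ : Type*} [CommRing R] [Fintype σ] {p : MvPolynomial σ R}
    (hp : p.IsHomogeneous 1) : p = ∑ z, C (coeff (Finsupp.single z 1) p) * X z := by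
  classical
  have hmem : p ∈ homogeneousSubmodule σ R 1 := hp
  rw [homogeneousSubmodule_one_eq_span_X] at hmem
  obtain ⟨c, rfl⟩ := (Submodule.mem_span_range_iff_exists_fun _).1 hmem
  refine Finset.sum_congr rfl fun z _ => ?_
  rw [coeff_sum, Finset.sum_eq_single z]
  · rw [coeff_smul, coeff_X, if_pos rfl, smul_eq_mul, mul_one, C_mul']
  · intro y _ h
    rw [coeff_smul, coeff_X, if_neg (fun hy => h (Finsupp.single_left_injective one_ne_zero hy)), smul_zero]
  · simp

namespace QuadricSystem

variable {K : Type*} [Field K] {k l : ℕ} {D : QuadricSystem K k l}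

/-! ### Rolling factors on the deformed scroll -/

lemma deformedMinor_eq (α β : Col D.d) : D.deformedMinor α β = scrollMinor D.d D.zeta α β := rfl

lemma sum_zVar_top {M : Type*} [AddCommMonoid M] {d : Fin k → ℕ} (f : ZVar d → M) :
    ∑ z, f z = ∑ α : Col d, f α.top + ∑ i, f ⟨i, Fin.last _⟩ := by
  rw [Fintype.sum_sigma, Fintype.sum_sigma, ← Finset.sum_add_distrib]
  exact Finset.sum_congr rfl fun i _ => Fin.sum_univ_castSucc _

lemma sum_zVar_bot {M : Type*} [AddCommMonoid M] {d : Fin k → ℕ} (f : ZVar d → M) :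
    ∑ z, f z = ∑ α : Col d, f α.bot + ∑ i, f ⟨i, 0⟩ := by
  rw [Fintype.sum_sigma, Fintype.sum_sigma, ← Finset.sum_add_distrib]
  exact Finset.sum_congr rfl fun i _ => (Fin.sum_univ_succ _).trans (add_comm _ _)

section Linear

variable {R : Type*} [CommRing R] {d : Fin k → ℕ}

/-- The exponent of the section `z` of the scroll. -/
def coxExponent (z : ZVar d) : CoxVar k →₀ ℕ :=
  Finsupp.single (Sum.inr z.1) 1 + Finsupp.single (sVar k) (d z.1 - (z.2 : ℕ)) +
    Finsupp.single (tVar k) (z.2 : ℕ)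

lemma toCox_X (z : ZVar d) : toCox R d (X z) = monomial (coxExponent z) 1 := by
  rw [toCox, aeval_X, X_pow_eq_monomial, X_pow_eq_monomial, X, monomial_mul, monomial_mul, one_mul,
    one_mul]; rfl

lemma coxExponent_add_eq {z z' : ZVar d} {a a' b b' : ℕ}
    (h : coxExponent z + Finsupp.single (sVar k) a + Finsupp.single (tVar k) b =
      coxExponent z' + Finsupp.single (sVar k) a' + Finsupp.single (tVar k) b') :
    z.1 = z'.1 ∧ (z.2 : ℕ) + b = z'.2 + b' := by
  constructor
  · have h1 := DFunLike.congr_fun h (Sum.inr z.1)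
    simp only [coxExponent, sVar, tVar, Finsupp.add_apply, Finsupp.single_apply, reduceCtorEq, if_false,
      Sum.inr.injEq, if_true, add_zero] at h1
    by_contra hne
    rw [if_neg (Ne.symm hne)] at h1
    omega
  · have h1 := DFunLike.congr_fun h (tVar k)
    simpa [coxExponent, sVar, tVar] using h1

/-- Comparing the coefficients of two linear forms `U`, `V` with `sV = tU` on the scroll. -/
lemma coeff_of_section_eq {I : Ideal R} {U V : MvPolynomial (ZVar d) R} (hU : U.IsHomogeneous 1)
    (hV : V.IsHomogeneous 1)
    (h : X (sVar k) * toCox R d V - X (tVar k) * toCox R d U ∈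
      I.map (C : R →+* MvPolynomial (CoxVar k) R)) :
    (∀ i, coeff (Finsupp.single ⟨i, 0⟩ 1) V ∈ I) ∧
    (∀ i, coeff (Finsupp.single ⟨i, Fin.last _⟩ 1) U ∈ I) ∧
    ∀ α : Col d, coeff (Finsupp.single α.bot 1) V - coeff (Finsupp.single α.top 1) U ∈ I := by
  classical
  rw [mem_map_C_iff] at h
  set u := fun z : ZVar d => coeff (Finsupp.single z 1) U with hu
  set v := fun z : ZVar d => coeff (Finsupp.single z 1) V with hv
  have hs : ∀ (p : MvPolynomial (ZVar d) R), p.IsHomogeneous 1 → ∀ a b f,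
      coeff f (X (sVar k) ^ a * X (tVar k) ^ b * toCox R d p) = ∑ z, if coxExponent z +
        Finsupp.single (sVar k) a + Finsupp.single (tVar k) b = f then coeff (Finsupp.single z 1) p else 0 := by
    intro p hp a b f
    conv_lhs => rw [eq_sum_of_isHomogeneous_one hp]
    rw [map_sum, Finset.mul_sum, coeff_sum]
    refine Finset.sum_congr rfl fun z _ => ?_
    have hC : toCox R d (C (coeff (Finsupp.single z 1) p)) = C (coeff (Finsupp.single z 1) p) := by
      rw [toCox, aeval_C]; rfl
    rw [map_mul, hC, toCox_X, X_pow_eq_monomial, X_pow_eq_monomial, monomial_mul, C_mul_monomial,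
      monomial_mul, coeff_monomial, mul_one, mul_one, one_mul]
    congr 2
    abel
  have key : ∀ f, (∑ z, if coxExponent z + Finsupp.single (sVar k) 1 + Finsupp.single (tVar k) 0 = f
      then v z else 0) - (∑ z, if coxExponent z + Finsupp.single (sVar k) 0 + Finsupp.single (tVar k) 1 = f
      then u z else 0) ∈ I := by
    intro f
    have := h f
    rw [coeff_sub] at this
    rw [← hs V hV 1 0 f, ← hs U hU 0 1 f]
    simpa using this
  have single : ∀ (w : ZVar d → R) (z₀ : ZVar d) (a b : ℕ), (∑ z, if coxExponent z +
      Finsupp.single (sVar k) a + Finsupp.single (tVar k) b = coxExponent z₀ +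
      Finsupp.single (sVar k) a + Finsupp.single (tVar k) b then w z else 0) = w z₀ := by
    intro w z₀ a b
    rw [Finset.sum_eq_single z₀]
    · rw [if_pos rfl]
    · rintro ⟨i, j⟩ _ hne
      rw [if_neg]
      intro h
      obtain ⟨i₀, j₀⟩ := z₀
      obtain ⟨h1, h2⟩ := coxExponent_add_eq h
      dsimp only at h1
      subst h1
      refine hne ?_
      congr 1
      ext
      dsimp only at h2
      omega
    · simp
  refine ⟨fun i => ?_, fun i => ?_, fun α => ?_⟩
  · have h1 := key (coxExponent (⟨i, 0⟩ : ZVar d) + Finsupp.single (sVar k) 1 + Finsupp.single (tVar k) 0)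
    rw [single] at h1
    rwa [Finset.sum_eq_zero, sub_zero] at h1
    intro z _
    rw [if_neg]
    intro h
    have := (coxExponent_add_eq h).2
    simp at this
  · have h1 := key (coxExponent (⟨i, Fin.last _⟩ : ZVar d) + Finsupp.single (sVar k) 0 + Finsupp.single (tVar k) 1)
    rw [single] at h1
    rw [Finset.sum_eq_zero, zero_sub, neg_mem_iff] at h1
    · exact h1
    rintro ⟨i', j⟩ _
    rw [if_neg]
    intro h
    obtain ⟨h1, h2⟩ := coxExponent_add_eq h
    dsimp only at h1
    subst h1
    have := j.2
    simp only [Fin.val_last] at h2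
    omega
  · have h1 := key (coxExponent α.bot + Finsupp.single (sVar k) 1 + Finsupp.single (tVar k) 0)
    have h2 : coxExponent α.bot + Finsupp.single (sVar k) 1 + Finsupp.single (tVar k) 0 =
        coxExponent α.top + Finsupp.single (sVar k) 0 + Finsupp.single (tVar k) 1 := by
      have := α.2.2
      simp only [coxExponent, Col.top, Col.bot, Fin.val_succ, Fin.val_castSucc, Finsupp.single_zero,
        add_zero]
      rw [show d α.1 - (α.2 : ℕ) = (d α.1 - ((α.2 : ℕ) + 1)) + 1 by omega, Finsupp.single_add,
        Finsupp.single_add]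
      abel
    rw [single, h2, single] at h1
    exact h1

end Linear

lemma zCoord_isHomogeneous (i : Fin k) (j : ℕ) : (D.zCoord i j).IsHomogeneous 1 := by
  rw [zCoord]
  split_ifs
  · exact isHomogeneous_X _ _
  · exact isHomogeneous_zero _ _ _

lemma toCox_column {R : Type*} [CommRing R] {d : Fin k → ℕ} (α : Col d) :
    X (sVar k) * toCox R d (X α.bot) = X (tVar k) * toCox R d (X α.top) := by
  have h := α.2.2
  simp only [toCox, aeval_X, Col.top, Col.bot, Fin.val_succ, Fin.val_castSucc]
  rw [show d α.1 - (α.2 : ℕ) = (d α.1 - ((α.2 : ℕ) + 1)) + 1 by omega]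
  ring

lemma toCox_zCoord (i : Fin k) (j : ℕ) (hj : j < D.d i) :
    X (sVar k) * toCox D.Base D.d (D.zCoord i (j + 1)) =
      X (tVar k) * toCox D.Base D.d (D.zCoord i j) := by
  rw [zCoord, zCoord, dif_pos (by omega), dif_pos (by omega)]
  exact toCox_column (⟨i, ⟨j, hj⟩⟩ : Col D.d)

lemma toCox_purePart (n : Fin l) (m : ℕ) (hm : m < D.b n) :
    X (sVar k) * toCox D.Base D.d (D.purePart n (m + 1)) =
      X (tVar k) * toCox D.Base D.d (D.purePart n m) := by
  simp only [purePart, map_sum, map_mul, Finset.mul_sum]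
  refine Finset.sum_congr rfl fun i _ => Finset.sum_congr rfl fun j _ => ?_
  have hj := j.2
  rw [mul_left_comm, mul_left_comm (X (tVar k)), ← add_assoc, toCox_zCoord i _ (by omega)]

namespace FirstOrderLift

variable (F : D.FirstOrderLift)

lemma pert_isHomogeneous (n : Fin l) (m : ℕ) : (F.pert n m).IsHomogeneous 1 := by
  refine IsHomogeneous.add ?_ ?_
  · exact IsHomogeneous.sum _ _ _ fun z _ => (isHomogeneous_X _ z).C_mul _
  · exact IsHomogeneous.sum _ _ _ fun i _ => IsHomogeneous.sum _ _ _ fun j _ =>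
      (zCoord_isHomogeneous i _).C_mul _

/-- The part of `P'_{m+1}` which is rolled from `P'_m`. -/
def rolled (n : Fin l) (m : ℕ) : MvPolynomial (ZVar D.d) D.Base :=
  F.pert n (m + 1) - ∑ α : Col D.d, map C (D.roll n m α) * C (D.zetaPt α.bot)

lemma rolled_isHomogeneous (n : Fin l) (m : ℕ) (hm : m < D.b n) : (F.rolled n m).IsHomogeneous 1 := by
  refine (F.pert_isHomogeneous n _).sub (IsHomogeneous.sum _ _ _ fun α _ => ?_)
  rw [mul_comm]
  exact ((D.roll_homogeneous n m α hm).map _).C_mul _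

lemma rolled_mem (n : Fin l) (m : ℕ) (hm : m < D.b n) :
    X (sVar k) * toCox D.Base D.d (F.rolled n m) - X (tVar k) * toCox D.Base D.d (F.pert n m) ∈
      D.liftingIdeal.map (C : D.Base →+* MvPolynomial (CoxVar k) D.Base) := by
  have h := F.lift n m hm
  have h1 : X (sVar k) * toCox D.Base D.d (F.rolled n m) - X (tVar k) * toCox D.Base D.d (F.pert n m) =
      X (sVar k) * toCox D.Base D.d (D.bilin (F.q n (m + 1)))
      - X (tVar k) * toCox D.Base D.d (D.bilin (F.q n m))
      - X (sVar k) * toCox D.Base D.d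
          (∑ α : Col D.d, map C (D.roll n m α) * C (D.zetaPt α.bot)) := by
    rw [rolled, pert, pert, map_sub, map_add, map_add, mul_sub, mul_add, mul_add, toCox_purePart n m hm]
    ring
  rwa [h1]

/-- The coefficients by which one rolls from `P'_m` to the next equation. -/
def pertRoll (n : Fin l) (m : ℕ) (α : Col D.d) : D.Base := coeff (Finsupp.single α.top 1) (F.pert n m)

/-- On the scroll `t z^(i)_{d i}` is not divisible by `s`, so the coefficient in `P'_m` of this
variable, which is the top entry of no column, lies in `L`. -/
lemma pert_sub_mem (n : Fin l) (m : ℕ) (hm : m < D.b n) :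
    F.pert n m - ∑ α : Col D.d, C (F.pertRoll n m α) * X α.top ∈
      D.liftingIdeal.map (C : D.Base →+* MvPolynomial (ZVar D.d) D.Base) := by
  have h := coeff_of_section_eq (F.pert_isHomogeneous n m) (F.rolled_isHomogeneous n m hm)
    (F.rolled_mem n m hm)
  nth_rw 1 [eq_sum_of_isHomogeneous_one (F.pert_isHomogeneous n m)]
  rw [sum_zVar_top]
  simp only [pertRoll]
  rw [add_sub_cancel_left]
  exact Ideal.sum_mem _ fun i _ => Ideal.mul_mem_right _ _ (Ideal.mem_map_of_mem _ (h.2.1 i))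

/-- Symmetrically, `s z^(i)_0` is not divisible by `t`, which excludes the variables that are the
bottom entry of no column; the other coefficients are shifted from those of `P'_m`. -/
lemma rolled_sub_mem (n : Fin l) (m : ℕ) (hm : m < D.b n) :
    F.rolled n m - ∑ α : Col D.d, C (F.pertRoll n m α) * X α.bot ∈
      D.liftingIdeal.map (C : D.Base →+* MvPolynomial (ZVar D.d) D.Base) := by
  have h := coeff_of_section_eq (F.pert_isHomogeneous n m) (F.rolled_isHomogeneous n m hm)
    (F.rolled_mem n m hm)
  nth_rw 1 [eq_sum_of_isHomogeneous_one (F.rolled_isHomogeneous n m hm)]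
  rw [sum_zVar_bot, add_sub_right_comm, ← Finset.sum_sub_distrib]
  refine add_mem (Ideal.sum_mem _ fun α _ => ?_)
    (Ideal.sum_mem _ fun i _ => Ideal.mul_mem_right _ _ (Ideal.mem_map_of_mem _ (h.1 i)))
  rw [← sub_mul, ← C_sub]
  exact Ideal.mul_mem_right _ _ (Ideal.mem_map_of_mem _ (h.2.2 α))

/-- By rolling, `∑ p_α(ζ) ζ_{α+1}` is `P_{m+1}(ζ)`. This is how the undeformed equation enters the
base equation. -/
lemma eval_rolled (n : Fin l) (m : ℕ) (hm : m < D.b n) :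
    eval D.zetaPt (F.rolled n m) = F.baseEquation n (m + 1) := by
  rw [rolled, baseEquation, map_sub, map_sum, D.eqn_succ n m hm, map_sum]
  congr 1
  refine Finset.sum_congr rfl fun α _ => ?_
  rw [map_mul, map_mul, eval_C, aeval_X, eval_map]
  rfl

lemma eval_mem_of_mem_map {I : Ideal D.Base} {x : MvPolynomial (ZVar D.d) D.Base}
    (hx : x ∈ I.map (C : D.Base →+* MvPolynomial (ZVar D.d) D.Base)) : eval D.zetaPt x ∈ I := by
  have h := Ideal.mem_map_of_mem (eval D.zetaPt) hx
  rw [Ideal.map_map] at h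
  have h1 : (eval D.zetaPt).comp (C : D.Base →+* MvPolynomial (ZVar D.d) D.Base) = RingHom.id _ :=
    RingHom.ext fun r => eval_C r
  rwa [h1, Ideal.map_id] at h

/-- The equations of the infinitesimal deformation. -/
def equation (n : Fin l) (m : ℕ) : MvPolynomial (ZVar D.d) D.Base := map C (D.eqn n m) + F.pert n m

/-- Rolling factors on the deformed scroll: the obstruction is the base equation. -/
theorem roll_mem (n : Fin l) (m : ℕ) (hm : m < D.b n) (β : Col D.d) :
    F.equation n m * (X β.bot + C (D.zetaPt β.bot)) - F.equation n (m + 1) * X β.top -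
      ∑ α, (map C (D.roll n m α) + C (F.pertRoll n m α)) * D.deformedMinor α β -
      C (F.baseEquation n (m + 1)) * X β.top ∈
      D.liftingIdeal.map (C : D.Base →+* MvPolynomial (ZVar D.d) D.Base) := by
  have h1 := F.pert_sub_mem n m hm
  have h2 := F.rolled_sub_mem n m hm
  -- At `z = ζ` the sum `∑ π_α z_{α+1}` becomes `∑ π_α ζ_{α+1}`, the coefficient of `z_β` left over
  -- when the minors are expanded. Modulo `L` it equals the base equation.
  have h3 := eval_mem_of_mem_map h2
  rw [map_sub, F.eval_rolled n m hm, map_sum] at h3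
  have h4 := Ideal.mem_map_of_mem (C : D.Base →+* MvPolynomial (ZVar D.d) D.Base) h3
  have h5 := sub_mem (sub_mem (Ideal.mul_mem_right (X β.bot + C (D.zetaPt β.bot)) _ h1)
    (Ideal.mul_mem_right (X β.top) _ h2)) (Ideal.mul_mem_right (X β.top) _ h4)
  convert h5 using 1
  have e1 : F.equation n m = ∑ α : Col D.d, map C (D.roll n m α) * X α.top + F.pert n m := by
    rw [equation, D.eqn_eq n m hm, map_sum]
    simp only [map_mul, map_X]
  have e2 : F.equation n (m + 1) = ∑ α : Col D.d, map C (D.roll n m α) * X α.bot +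
      (F.rolled n m + ∑ α : Col D.d, map C (D.roll n m α) * C (D.zetaPt α.bot)) := by
    rw [equation, D.eqn_succ n m hm, map_sum, rolled, sub_add_cancel]
    simp only [map_mul, map_X]
  have e3 : ∑ α, (map C (D.roll n m α) + C (F.pertRoll n m α)) * D.deformedMinor α β =
      (∑ α : Col D.d, map C (D.roll n m α) * X α.top) * (X β.bot + C (D.zetaPt β.bot)) -
      (∑ α : Col D.d, map C (D.roll n m α) * X α.bot) * X β.top -
      (∑ α : Col D.d, map C (D.roll n m α) * C (D.zetaPt α.bot)) * X β.top +
      (∑ α : Col D.d, C (F.pertRoll n m α) * X α.top) * (X β.bot + C (D.zetaPt β.bot)) -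
      (∑ α : Col D.d, C (F.pertRoll n m α) * X α.bot) * X β.top -
      (∑ α : Col D.d, C (F.pertRoll n m α) * C (D.zetaPt α.bot)) * X β.top := by
    simp only [Finset.sum_mul, ← Finset.sum_sub_distrib, ← Finset.sum_add_distrib]
    refine Finset.sum_congr rfl fun α _ => ?_
    rw [deformedMinor]
    ring
  simp only [map_mul, eval_C, eval_X, map_sub, map_sum]
  rw [e1, e2, e3]
  ring

end FirstOrderLift

/-! ### Degrees of the equations -/

lemma zeta_isHomogeneous (i : Fin k) (j : ℕ) : (D.zeta i j).IsHomogeneous 1 := by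
  rw [zeta]
  split_ifs
  · exact isHomogeneous_X _ _
  · exact isHomogeneous_zero _ _ _

lemma liftingForm_isHomogeneous (n : Fin l) (i : Fin k) (r : ℕ) :
    (D.liftingForm n i r).IsHomogeneous 1 :=
  IsHomogeneous.sum _ _ _ fun _ _ => IsHomogeneous.sum _ _ _ fun _ _ =>
    (zeta_isHomogeneous _ _).C_mul _

lemma mem_originIdeal_pow {p : D.Base} {q : ℕ} (hp : p.IsHomogeneous q) : p ∈ D.originIdeal ^ q := by
  refine (mem_pow_idealOfVars_iff' q p).2 fun e he => ?_
  by_contra hne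
  have h1 := hp hne
  have h2 := DFunLike.congr_fun (Finsupp.degree_eq_weight_one
    (σ := D.ZetaIdx ⊕ D.RhoIdx) (R := ℕ)) e
  have h3 : Finsupp.weight 1 e = e.degree := h2.symm
  omega

lemma homogeneousComponent_eq_zero_of_mem_pow {p : D.Base} {q e : ℕ} (hp : p ∈ D.originIdeal ^ q)
    (h : e < q) : homogeneousComponent e p = 0 := by
  refine homogeneousComponent_eq_zero' _ _ fun u hu hue => ?_
  have := (mem_pow_idealOfVars_iff q p).1 hp u hu
  omega

lemma liftingIdeal_le : D.liftingIdeal ≤ D.originIdeal := by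
  rw [liftingIdeal, Ideal.span_le]
  rintro _ ⟨n, i, r, _, _, rfl⟩
  have := mem_originIdeal_pow (D.liftingForm_isHomogeneous n i r)
  rwa [pow_one] at this

namespace FirstOrderLift

variable (F : D.FirstOrderLift)

/-- The coefficients of the perturbations are linear forms on the base. -/
lemma coeff_pert_isHomogeneous (n : Fin l) (m : ℕ) (u : ZVar D.d →₀ ℕ) :
    (coeff u (F.pert n m)).IsHomogeneous 1 := by
  classical
  rw [pert, coeff_add]
  refine IsHomogeneous.add ?_ ?_
  · rw [bilin, coeff_sum]
    refine IsHomogeneous.sum _ _ _ fun z _ => ?_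
    rw [coeff_C_mul, coeff_X]
    split_ifs
    · rw [mul_one]
      exact IsHomogeneous.sum _ _ _ fun v _ => (isHomogeneous_X _ _).C_mul _
    · rw [mul_zero]; exact isHomogeneous_zero _ _ _
  · rw [purePart, coeff_sum]
    refine IsHomogeneous.sum _ _ _ fun i _ => ?_
    rw [coeff_sum]
    refine IsHomogeneous.sum _ _ _ fun j _ => ?_
    rw [coeff_C_mul, zCoord]
    split_ifs
    · rw [coeff_X]
      split_ifs
      · rw [mul_one]; exact isHomogeneous_X _ _
      · rw [mul_zero]; exact isHomogeneous_zero _ _ _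
    · rw [coeff_zero, mul_zero]; exact isHomogeneous_zero _ _ _

lemma baseEquation_isHomogeneous (n : Fin l) (m : ℕ) (hm : m ≤ D.b n) :
    (F.baseEquation n m).IsHomogeneous 2 := by
  have hz : ∀ z, (D.zetaPt z).IsHomogeneous 1 := fun z => zeta_isHomogeneous _ _
  refine IsHomogeneous.sub ?_ ?_
  · rw [eq_sum_of_isHomogeneous_one (F.pert_isHomogeneous n m), map_sum]
    refine IsHomogeneous.sum _ _ _ fun z _ => ?_
    rw [map_mul, eval_C, eval_X]
    exact (F.coeff_pert_isHomogeneous n m _).mul (hz z)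
  · have := (D.eqn_homogeneous n m hm).aeval (g := D.zetaPt) (n := 1) hz
    simpa using this

end FirstOrderLift

end QuadricSystem

lemma isHomogeneousIdeal_span {K σ : Type*} [CommRing K] {s : Set (MvPolynomial σ K)}
    (hs : ∀ p ∈ s, ∃ q, p.IsHomogeneous q) : IsHomogeneousIdeal (Ideal.span s) :=
  letI := MvPolynomial.gradedAlgebra (σ := σ) (R := K)
  Ideal.homogeneous_span _ _ hs

namespace QuadricSystem

variable {K : Type*} [Field K] {k l : ℕ} {D : QuadricSystem K k l}

namespace FirstOrderLift

variable (F : D.FirstOrderLift)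

/-! ### The extension over the base equations -/

/-- The equations of the extension: those of the infinitesimal deformation, except that the
last one of each divisor is corrected by the obstruction to roll to it. -/
def extEquation (n : Fin l) (m : ℕ) : MvPolynomial (ZVar D.d) D.Base :=
  F.equation n m + C (if m = D.b n then F.baseEquation n m else 0)

/-- The ideal of the extension. -/
def extIdeal : Ideal (MvPolynomial (ZVar D.d) D.Base) :=
  Ideal.span ({g | ∃ α β, g = D.deformedMinor α β} ∪
    {g | ∃ n m, m ≤ D.b n ∧ g = F.extEquation n m})

lemma restrict_extIdeal {R : Type*} [CommRing R] (φ : D.Base →+* R) :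
    restrict φ F.extIdeal = D.familyIdeal (fun i j => φ (D.zeta i j))
      (fun n m => map φ (F.extEquation n m)) := by
  rw [restrict, extIdeal, Ideal.map_span, Set.image_union, Ideal.span_union, familyIdeal, scrollIdeal]
  congr 2
  · ext p
    constructor
    · rintro ⟨_, ⟨α, β, rfl⟩, rfl⟩
      exact ⟨α, β, by simp [deformedMinor_eq, scrollMinor]⟩
    · rintro ⟨α, β, rfl⟩
      exact ⟨_, ⟨α, β, rfl⟩, by simp [deformedMinor_eq, scrollMinor]⟩
  · ext p
    constructor
    · rintro ⟨_, ⟨n, m, hm, rfl⟩, rfl⟩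
      exact ⟨⟨n, ⟨m, by omega⟩⟩, rfl⟩
    · rintro ⟨⟨n, m⟩, rfl⟩
      exact ⟨_, ⟨n, m, by omega, rfl⟩, rfl⟩

lemma extEquation_roll_mem (n : Fin l) (m : ℕ) (hm : m < D.b n) (β : Col D.d) :
    F.extEquation n m * (X β.bot + C (D.zetaPt β.bot)) - F.extEquation n (m + 1) * X β.top -
      ∑ α, (map C (D.roll n m α) + C (F.pertRoll n m α)) * D.deformedMinor α β ∈
      F.baseIdeal.map (C : D.Base →+* MvPolynomial (ZVar D.d) D.Base) := by
  have h := Ideal.map_mono (f := (C : D.Base →+* MvPolynomial (ZVar D.d) D.Base))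
    (show D.liftingIdeal ≤ F.baseIdeal from le_sup_left) (F.roll_mem n m hm β)
  rw [extEquation, extEquation, if_neg hm.ne]
  -- At the last roll the added constant cancels the obstruction; at every earlier one the
  -- obstruction is a generator of `baseIdeal`.
  by_cases hb : m + 1 = D.b n
  · rw [if_pos hb]
    convert h using 1
    rw [C_0]
    ring
  · have h1 : F.baseEquation n (m + 1) ∈ F.baseIdeal :=
      Ideal.mem_sup_right (Ideal.subset_span ⟨n, m + 1, by omega, by omega, rfl⟩)
    rw [if_neg hb]
    convert add_mem h (Ideal.mul_mem_right (X β.top) _ (Ideal.mem_map_of_mem C h1)) using 1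
    rw [C_0]
    ring

lemma map_eq_zero_of_mem_map {J : Ideal D.Base} {x : MvPolynomial (ZVar D.d) D.Base}
    (hx : x ∈ J.map (C : D.Base →+* MvPolynomial (ZVar D.d) D.Base)) :
    map (Ideal.Quotient.mk J) x = 0 := by
  rw [← RingHom.mem_ker, ker_map, Ideal.mk_ker]
  exact hx

lemma isRollingFamily : D.IsRollingFamily
    (fun i j => Ideal.Quotient.mk F.baseIdeal (D.zeta i j))
    (fun n m => map (Ideal.Quotient.mk F.baseIdeal) (F.extEquation n m)) where
  leading n m hm := by
    have h : map (Ideal.Quotient.mk F.baseIdeal) (map C (D.eqn n m)) =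
        map (algebraMap K (D.Base ⧸ F.baseIdeal)) (D.eqn n m) := by
      rw [map_map]; rfl
    have h1 : map (Ideal.Quotient.mk F.baseIdeal) (F.extEquation n m) -
        map (algebraMap K (D.Base ⧸ F.baseIdeal)) (D.eqn n m) =
        map (Ideal.Quotient.mk F.baseIdeal) (F.pert n m) +
        map (Ideal.Quotient.mk F.baseIdeal) (C (if m = D.b n then F.baseEquation n m else 0)) := by
      rw [extEquation, equation, map_add, map_add, h]
      ring
    rw [h1]
    refine add_mem (IsHomogeneous.mem_degreeLT ((F.pert_isHomogeneous n m).map _)) ?_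
    rw [map_C]
    exact degreeLT_mono (by omega) (IsHomogeneous.mem_degreeLT (isHomogeneous_C _ _))
  roll n m hm β := by
    have h := map_eq_zero_of_mem_map (F.extEquation_roll_mem n m hm β)
    simp only [map_sub, map_mul, map_add, map_X, map_C, map_sum, sub_eq_zero] at h
    have h1 : (X β.bot + C (Ideal.Quotient.mk F.baseIdeal (D.zetaPt β.bot)) :
        MvPolynomial (ZVar D.d) (D.Base ⧸ F.baseIdeal)) = X β.bot +
        C (Ideal.Quotient.mk F.baseIdeal (D.zeta β.1 (β.2 + 1))) := rfl
    rw [← h1, h]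
    refine Ideal.sum_mem _ fun α _ => Ideal.mul_mem_left _ _ (Ideal.subset_span ⟨α, β, ?_⟩)
    simp [deformedMinor_eq, scrollMinor]

lemma isFlatFamily_extIdeal : IsFlatFamily (Ideal.Quotient.mk F.baseIdeal) F.extIdeal := by
  rw [IsFlatFamily, restrict_extIdeal]
  have := free_familyIdeal F.isRollingFamily
  exact Module.Flat.of_free

lemma baseEquation_mem (n : Fin l) (m : ℕ) (hm : m ≤ D.b n) :
    F.baseEquation n m ∈ D.originIdeal ^ 2 :=
  mem_originIdeal_pow (F.baseEquation_isHomogeneous n m hm)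

lemma baseIdeal_le : F.baseIdeal ≤ D.liftingIdeal ⊔ D.originIdeal ^ 2 := by
  refine sup_le_sup_left ((Ideal.span_le).2 ?_) _
  rintro _ ⟨n, m, _, hm, rfl⟩
  exact F.baseEquation_mem n m (by omega)

theorem isExtension_extIdeal : F.IsExtension F.baseIdeal F.extIdeal where
  lifting_le := le_sup_left
  le_first_order := F.baseIdeal_le
  flat := F.isFlatFamily_extIdeal
  first_order := by
    -- The corrections are quadratic in `ζ`, `ρ`, hence invisible to first order.
    have h : ∀ n m, m ≤ D.b n →
        map (Ideal.Quotient.mk (D.liftingIdeal ⊔ D.originIdeal ^ 2)) (F.extEquation n m) =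
        map (Ideal.Quotient.mk (D.liftingIdeal ⊔ D.originIdeal ^ 2))
          (map C (D.eqn n m) + F.pert n m) := by
      intro n m hm
      rw [extEquation, map_add (map (Ideal.Quotient.mk _)) (F.equation n m), map_C,
        Ideal.Quotient.eq_zero_iff_mem.2, C_0, add_zero, equation]
      split_ifs
      · exact Ideal.mem_sup_right (F.baseEquation_mem n m hm)
      · exact zero_mem _
    rw [restrict, restrict, extIdeal, equations, Ideal.map_span, Ideal.map_span, Set.image_union,
      Set.image_union]
    congr 2
    ext p
    constructor
    · rintro ⟨_, ⟨n, m, hm, rfl⟩, rfl⟩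
      exact ⟨_, ⟨n, m, hm, rfl⟩, (h n m hm).symm⟩
    · rintro ⟨_, ⟨n, m, hm, rfl⟩, rfl⟩
      exact ⟨_, ⟨n, m, hm, rfl⟩, h n m hm⟩

lemma baseHomogeneous_baseIdeal : BaseHomogeneous F.baseIdeal := by
  rw [BaseHomogeneous, baseIdeal, liftingIdeal, ← Ideal.span_union]
  refine isHomogeneousIdeal_span ?_
  rintro _ (⟨n, i, r, _, _, rfl⟩ | ⟨n, m, _, hm, rfl⟩)
  · exact ⟨1, D.liftingForm_isHomogeneous n i r⟩
  · exact ⟨2, F.baseEquation_isHomogeneous n m (by omega)⟩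

section Total

/-- Polynomials in `z` over the base, as polynomials in all variables. -/
def total (D : QuadricSystem K k l) : MvPolynomial (ZVar D.d) D.Base →+*
    MvPolynomial (ZVar D.d ⊕ (D.ZetaIdx ⊕ D.RhoIdx)) K :=
  (sumAlgEquiv K (ZVar D.d) (D.ZetaIdx ⊕ D.RhoIdx)).symm.toRingEquiv.toRingHom

lemma total_X (z : ZVar D.d) : total D (X z) = X (Sum.inl z) := sumAlgEquiv_symm_X _ _ _ _

lemma total_C (p : D.Base) : total D (C p) = rename Sum.inr p := by
  have h := DFunLike.congr_fun (sumAlgEquiv_comp_rename_inr K (ZVar D.d) (D.ZetaIdx ⊕ D.RhoIdx)) p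
  exact (AlgEquiv.symm_apply_eq _).2 h.symm

lemma total_map (p : MvPolynomial (ZVar D.d) K) :
    total D (map C p) = rename Sum.inl p := by
  have h := DFunLike.congr_fun (sumAlgEquiv_comp_rename_inl K (ZVar D.d) (D.ZetaIdx ⊕ D.RhoIdx)) p
  exact (AlgEquiv.symm_apply_eq _).2 h.symm

end Total

lemma total_extEquation_isHomogeneous (n : Fin l) (m : ℕ) (hm : m ≤ D.b n) :
    (total D (F.extEquation n m)).IsHomogeneous 2 := by
  rw [extEquation, equation, map_add, map_add, total_map, total_C]
  refine IsHomogeneous.add (IsHomogeneous.add ?_ ?_) ?_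
  · exact (D.eqn_homogeneous n m hm).rename_isHomogeneous
  · rw [eq_sum_of_isHomogeneous_one (F.pert_isHomogeneous n m), map_sum]
    refine IsHomogeneous.sum _ _ _ fun z _ => ?_
    rw [map_mul, total_C, total_X]
    exact (F.coeff_pert_isHomogeneous n m _).rename_isHomogeneous.mul (isHomogeneous_X _ _)
  · refine IsHomogeneous.rename_isHomogeneous ?_
    split_ifs
    · exact F.baseEquation_isHomogeneous n m hm
    · exact isHomogeneous_zero _ _ _

lemma total_deformedMinor_isHomogeneous (α β : Col D.d) :
    (total D (D.deformedMinor α β)).IsHomogeneous 2 := by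
  have h : ∀ z, (total D (C (D.zetaPt z))).IsHomogeneous 1 := fun z => by
    rw [total_C]
    exact (zeta_isHomogeneous _ _).rename_isHomogeneous
  simp only [deformedMinor, map_sub, map_mul, map_add, total_X]
  exact ((isHomogeneous_X _ _).mul ((isHomogeneous_X _ _).add (h _))).sub
    (((isHomogeneous_X _ _).add (h _)).mul (isHomogeneous_X _ _))

lemma familyHomogeneous_extIdeal : FamilyHomogeneous F.extIdeal := by
  have h : F.extIdeal.comap (sumAlgEquiv K (ZVar D.d) (D.ZetaIdx ⊕ D.RhoIdx)) =
      F.extIdeal.map (total D) :=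
    (Ideal.map_symm (sumAlgEquiv K (ZVar D.d) (D.ZetaIdx ⊕ D.RhoIdx)).toRingEquiv).symm
  rw [FamilyHomogeneous, h, extIdeal, Ideal.map_span]
  refine isHomogeneousIdeal_span ?_
  rintro _ ⟨_, ⟨α, β, rfl⟩ | ⟨n, m, hm, rfl⟩, rfl⟩
  · exact ⟨2, total_deformedMinor_isHomogeneous α β⟩
  · exact ⟨2, F.total_extEquation_isHomogeneous n m hm⟩

end FirstOrderLift

end QuadricSystem

/-! ### Flatness and relations -/

/-- An element of the ideal of a flat family with coefficients in `N` is a combination of elements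
of the ideal with coefficients in `N`. -/
lemma mem_mul_of_flat {R σ : Type*} [CommRing R] {I : Ideal (MvPolynomial σ R)}
    (hI : Module.Flat R (MvPolynomial σ R ⧸ I)) {N : Ideal R} {x : MvPolynomial σ R} (hx : x ∈ I)
    (hN : x ∈ N.map (C : R →+* MvPolynomial σ R)) :
    x ∈ N.map (C : R →+* MvPolynomial σ R) * I := by
  have h0 : ∑ u : x.support, coeff u.1 x • (Ideal.Quotient.mk I (monomial u.1 1)) = 0 := by
    have h1 : ∑ u : x.support, coeff u.1 x • (Ideal.Quotient.mk I (monomial u.1 1)) =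
        Ideal.Quotient.mk I (∑ u : x.support, C (coeff u.1 x) * monomial u.1 1) := by
      rw [map_sum]
      refine Finset.sum_congr rfl fun u _ => ?_
      rw [map_mul]
      exact Algebra.smul_def (coeff u.1 x) (Ideal.Quotient.mk I (monomial u.1 1))
    rw [h1, Ideal.Quotient.eq_zero_iff_mem, Finset.sum_coe_sort x.support
      (fun u => C (coeff u x) * monomial u 1)]
    convert hx
    conv_rhs => rw [x.as_sum]
    exact Finset.sum_congr rfl fun u _ => by rw [C_mul_monomial, mul_one]
  -- The equational criterion: the relation `∑ x_u z^u = 0` in the quotient is trivial, so `z^u = ∑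
  -- a_{uj} y_j` with `∑ x_u a_{uj} = 0`. With lifts `Y_j` of the `y_j` this gives `x = ∑ x_u (z^u -
  -- ∑ a_{uj} Y_j)`, where each bracket is in `I` and each `x_u` in `N`.
  obtain ⟨κ, a, y, hy, ha⟩ := Module.Flat.isTrivialRelation_of_sum_smul_eq_zero h0
  choose Y hY using fun j => Ideal.Quotient.mk_surjective (y j)
  have hg : ∀ u : x.support, monomial u.1 1 - ∑ j, C (a u j) * Y j ∈ I := by
    intro u
    have hyu : Ideal.Quotient.mk I (monomial u.1 1) = ∑ j, a u j • y j := hy u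
    rw [← Ideal.Quotient.eq_zero_iff_mem, map_sub, hyu, map_sum, sub_eq_zero]
    refine Finset.sum_congr rfl fun j _ => ?_
    rw [map_mul, hY]
    exact Algebra.smul_def (a u j) (y j)
  have hx' : x = ∑ u : x.support, C (coeff u.1 x) * (monomial u.1 1 - ∑ j, C (a u j) * Y j) := by
    have h1 : ∑ u : x.support, C (coeff u.1 x) * ∑ j, C (a u j) * Y j = 0 := by
      simp only [Finset.mul_sum]
      rw [Finset.sum_comm]
      refine Finset.sum_eq_zero fun j _ => ?_
      simp only [← mul_assoc, ← C_mul]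
      rw [← Finset.sum_mul, ← map_sum]
      have h2 : ∑ u : x.support, coeff u.1 x * a u j = 0 := by simpa using ha j
      rw [h2, C_0, zero_mul]
    simp only [mul_sub]
    rw [Finset.sum_sub_distrib, h1, sub_zero, Finset.sum_coe_sort x.support
      (fun u => C (coeff u x) * monomial u 1)]
    conv_lhs => rw [x.as_sum]
    exact Finset.sum_congr rfl fun u _ => by rw [C_mul_monomial, mul_one]
  rw [hx']
  exact Ideal.sum_mem _ fun u _ => Ideal.mul_mem_mul
    (Ideal.mem_map_of_mem _ (mem_map_C_iff.1 hN u.1)) (hg u)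

/-! ### Polynomials with small coefficients in low degree -/

/-- The polynomials whose coefficients in degrees `0` and `1` lie in `N`. -/
def lowIdeal {R : Type*} [CommRing R] (σ : Type*) (N : Ideal R) : Ideal (MvPolynomial σ R) :=
  N.map C ⊔ idealOfVars σ R ^ 2

section Low

variable {R σ : Type*} [CommRing R] {N N' : Ideal R}

lemma map_le_lowIdeal : N.map C ≤ lowIdeal σ N := le_sup_left

lemma mem_lowIdeal_iff {x : MvPolynomial σ R} :
    x ∈ lowIdeal σ N ↔ ∀ u : σ →₀ ℕ, u.degree < 2 → coeff u x ∈ N := by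
  classical
  constructor
  · intro hx u hu
    obtain ⟨y, hy, v, hv, rfl⟩ := Submodule.mem_sup.1 hx
    rw [coeff_add, (mem_pow_idealOfVars_iff' 2 v).1 hv u hu, add_zero]
    exact mem_map_C_iff.1 hy u
  · intro h
    rw [x.as_sum]
    refine Ideal.sum_mem _ fun u _ => ?_
    by_cases hu : u.degree < 2
    · refine map_le_lowIdeal (mem_map_C_iff.2 fun v => ?_)
      rw [coeff_monomial]
      split_ifs
      · exact h u hu
      · exact zero_mem _
    · refine Ideal.mem_sup_right ((mem_pow_idealOfVars_iff' 2 _).2 fun v hv => ?_)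
      rw [coeff_monomial, if_neg]
      rintro rfl
      exact hu hv

lemma map_mul_lowIdeal_le : N.map C * lowIdeal σ N' ≤ lowIdeal σ (N * N') := by
  rw [lowIdeal, lowIdeal, Ideal.mul_sup, Ideal.map_mul]
  exact sup_le_sup_left Ideal.mul_le_right _

lemma map_lowIdeal {S : Type*} [CommRing S] (φ : R →+* S) {x : MvPolynomial σ R}
    (hx : x ∈ lowIdeal σ N) : map φ x ∈ lowIdeal σ (N.map φ) := by
  rw [mem_lowIdeal_iff] at hx ⊢
  intro u hu
  rw [coeff_map]
  exact Ideal.mem_map_of_mem _ (hx u hu)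

lemma mem_lowIdeal_of_isHomogeneous_two {x : MvPolynomial σ R} (hx : x.IsHomogeneous 2) :
    x ∈ lowIdeal σ N := by
  refine Ideal.mem_sup_right ((mem_pow_idealOfVars_iff' 2 x).2 fun e he => ?_)
  by_contra hne
  have h1 := hx hne
  have h2 := DFunLike.congr_fun (Finsupp.degree_eq_weight_one (σ := σ) (R := ℕ)) e
  have h3 : Finsupp.weight 1 e = e.degree := h2.symm
  omega

/-- Multiplication by a linear form only sees the constant coefficient. -/
lemma mul_sub_C_coeff_zero_mul_mem {p x : MvPolynomial σ R} (hp : p.IsHomogeneous 1) :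
    x * p - C (coeff 0 x) * p ∈ idealOfVars σ R ^ 2 := by
  have h1 : ∀ y : MvPolynomial σ R, coeff 0 y = 0 → y ∈ idealOfVars σ R ^ 1 := fun y hy =>
    (mem_pow_idealOfVars_iff' 1 y).2 fun e he => by
      rw [(Finsupp.degree_eq_zero_iff e).1 (by omega), hy]
  have h2 : coeff 0 p = 0 := by
    by_contra hne
    simpa using hp hne
  rw [← sub_mul, pow_two]
  refine Ideal.mul_mem_mul ?_ ?_
  · simpa using h1 (x - C (coeff 0 x)) (by simp)
  · simpa using h1 p h2

lemma mem_map_of_mem_lowIdeal {x : MvPolynomial σ R} (hx : x ∈ lowIdeal σ N)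
    (h : x.IsHomogeneous 1) : x ∈ N.map C := by
  rw [mem_map_C_iff]
  intro u
  by_cases hu : u.degree < 2
  · exact mem_lowIdeal_iff.1 hx u hu
  · have h0 : coeff u x = 0 := by
      by_contra hne
      have h1 := h hne
      have h2 := DFunLike.congr_fun (Finsupp.degree_eq_weight_one (σ := σ) (R := ℕ)) u
      have h3 : Finsupp.weight 1 u = u.degree := h2.symm
      omega
    rw [h0]
    exact zero_mem _

end Low

namespace QuadricSystem

variable {K : Type*} [Field K] {k l : ℕ} {D : QuadricSystem K k l}

/-! ### Linear relations between the rolling coefficients -/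

/-- The linear syzygies between the rolled equations, modulo the Koszul relations, are trivial. -/
lemma eq_zero_of_alternating {R : Type*} [CommRing R] [Algebra K R] (n : Fin l) (m : ℕ)
    (hm : m < D.b n) (a c : R) (φ : Col D.d → Col D.d → R) (hskew : ∀ α β, φ α β + φ β α = 0)
    (halt : ∀ α, φ α α = 0)
    (h : ∀ β : Col D.d, C a * X β.top + C c * X β.bot =
      ∑ α, C (φ α β) * map (algebraMap K R) (D.roll n m α)) : a = 0 ∧ c = 0 := by
  set p : Col D.d → MvPolynomial (ZVar D.d) R := fun α => map (algebraMap K R) (D.roll n m α)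
  -- Multiply the relation of `β` by `p_β` and sum. The left side is rolled together into `P_m` and
  -- `P_{m+1}`; the right side is an alternating form evaluated at `(p, p)`, which vanishes in every
  -- characteristic.
  have h1 : C a * map (algebraMap K R) (D.eqn n m) + C c * map (algebraMap K R) (D.eqn n (m + 1)) =
      0 := by
    have h2 : ∑ x : Col D.d × Col D.d, C (φ x.1 x.2) * p x.1 * p x.2 = 0 := by
      refine Finset.sum_involution (fun x _ => (x.2, x.1)) ?_ ?_ (fun _ _ => Finset.mem_univ _)
        (fun _ _ => rfl)
      · rintro ⟨α, β⟩ _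
        have := congrArg (C : R → MvPolynomial (ZVar D.d) R) (hskew α β)
        rw [C_add, C_0] at this
        linear_combination p α * p β * this
      · rintro ⟨α, β⟩ _ hne heq
        obtain rfl : β = α := congrArg Prod.fst heq
        exact hne (by simp [halt])
    rw [Fintype.sum_prod_type_right] at h2
    rw [D.eqn_eq n m hm, D.eqn_succ n m hm, map_sum, map_sum, Finset.mul_sum, Finset.mul_sum,
      ← Finset.sum_add_distrib, ← h2]
    refine Finset.sum_congr rfl fun β _ => ?_
    have h3 : ∑ α, C (φ α β) * p α * p β = (C a * X β.top + C c * X β.bot) * p β := by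
      rw [h β, Finset.sum_mul]
    rw [h3, map_mul, map_mul, map_X, map_X]
    ring
  have h2 := congrArg (toCox R D.d) h1
  have hC : ∀ r : R, toCox R D.d (C r) = C r := fun r => by rw [toCox, aeval_C]; rfl
  rw [map_zero, map_add, map_mul, map_mul, hC, hC, ← map_toCox, ← map_toCox, D.toCox_eqn n m hm.le,
    D.toCox_eqn n (m + 1) hm] at h2
  have hP := IsCompleteIntersection.ne_zero D.isDivisorEquation D.isCompleteIntersection n
  -- Over `K` the Cox ring is a domain, so the nonzero factors `s^{b-m-1} t^m P` cancel and leave a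
  -- linear form in `s` and `t`.
  have key : ∀ lam : R →ₗ[K] K, lam a = 0 ∧ lam c = 0 := by
    intro lam
    have hlam : ∀ r : R, mapCoeff (CoxVar k) lam (C r) = C (lam r) := by
      classical
      intro r
      ext e
      rw [coeff_mapCoeff, coeff_C, coeff_C]
      split_ifs
      · rfl
      · exact map_zero _
    have h3 := congrArg (mapCoeff (CoxVar k) lam) h2
    rw [map_add, mapCoeff_mul_map, mapCoeff_mul_map, hlam, hlam, map_zero] at h3
    have h4 : (X (sVar k) ^ (D.b n - (m + 1)) * X (tVar k) ^ m * D.P n) *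
        (C (lam a) * X (sVar k) + C (lam c) * X (tVar k)) = 0 := by
      rw [← h3, show D.b n - m = (D.b n - (m + 1)) + 1 by omega]
      ring
    have h5 : (C (lam a) * X (sVar k) + C (lam c) * X (tVar k) : MvPolynomial (CoxVar k) K) = 0 := by
      refine (mul_eq_zero.1 h4).resolve_left (mul_ne_zero (mul_ne_zero ?_ ?_) hP)
      · exact pow_ne_zero _ (X_ne_zero _)
      · exact pow_ne_zero _ (X_ne_zero _)
    have hst : sVar k ≠ tVar k := by simp [sVar, tVar]
    constructor
    · have := congrArg (eval (Pi.single (sVar k) 1)) h5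
      simpa [hst, Pi.single_eq_of_ne hst.symm] using this
    · have := congrArg (eval (Pi.single (tVar k) 1)) h5
      simpa [hst, Pi.single_eq_of_ne hst] using this
  exact ⟨(Module.forall_dual_apply_eq_zero_iff K a).1 fun lam => (key lam).1,
    (Module.forall_dual_apply_eq_zero_iff K c).1 fun lam => (key lam).2⟩

namespace FirstOrderLift

variable {F : D.FirstOrderLift} {J : Ideal D.Base} {I : Ideal (MvPolynomial (ZVar D.d) D.Base)}

/-! ### The obstruction -/

lemma first_order_le : D.liftingIdeal ⊔ D.originIdeal ^ 2 ≤ D.originIdeal :=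
  sup_le liftingIdeal_le (Ideal.pow_le_self two_ne_zero)

/-- The equations of the cone are quadrics in `z`, and what is added to them has coefficients linear
in `ζ`, `ρ`. -/
lemma equations_le_lowIdeal : F.equations ≤ lowIdeal (ZVar D.d) D.originIdeal := by
  have hC : ∀ {p : D.Base}, p.IsHomogeneous 1 → C p ∈ D.originIdeal.map
      (C : D.Base →+* MvPolynomial (ZVar D.d) D.Base) := fun hp => by
    have := mem_originIdeal_pow hp
    rw [pow_one] at this
    exact Ideal.mem_map_of_mem _ this
  rw [equations, Ideal.span_le]
  rintro _ (⟨α, β, rfl⟩ | ⟨n, m, hm, rfl⟩)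
  · have h1 : D.deformedMinor α β = (X α.top * X β.bot - X α.bot * X β.top) +
        (X α.top * C (D.zetaPt β.bot) - C (D.zetaPt α.bot) * X β.top) := by
      rw [deformedMinor]; ring
    rw [h1]
    refine add_mem (mem_lowIdeal_of_isHomogeneous_two (((isHomogeneous_X _ _).mul
      (isHomogeneous_X _ _)).sub ((isHomogeneous_X _ _).mul (isHomogeneous_X _ _))))
      (map_le_lowIdeal (sub_mem (Ideal.mul_mem_left _ _ (hC (zeta_isHomogeneous _ _)))
        (Ideal.mul_mem_right _ _ (hC (zeta_isHomogeneous _ _)))))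
  · refine add_mem (mem_lowIdeal_of_isHomogeneous_two ((D.eqn_homogeneous n m hm).map _))
      (map_le_lowIdeal (mem_map_C_iff.2 fun u => ?_))
    have := mem_originIdeal_pow (F.coeff_pert_isHomogeneous n m u)
    rwa [pow_one] at this

/-- Two ideals with the same restriction. -/
lemma exists_sub_mem_of_restrict_eq {N : Ideal D.Base}
    {I I' : Ideal (MvPolynomial (ZVar D.d) D.Base)}
    (h : restrict (Ideal.Quotient.mk N) I = restrict (Ideal.Quotient.mk N) I')
    {x : MvPolynomial (ZVar D.d) D.Base} (hx : x ∈ I') :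
    ∃ y ∈ I, y - x ∈ N.map (C : D.Base →+* MvPolynomial (ZVar D.d) D.Base) := by
  have hsurj : Function.Surjective (map (σ := ZVar D.d) (Ideal.Quotient.mk N)) :=
    map_surjective _ Ideal.Quotient.mk_surjective
  have h1 : map (Ideal.Quotient.mk N) x ∈ restrict (Ideal.Quotient.mk N) I := by
    rw [h]; exact Ideal.mem_map_of_mem _ hx
  obtain ⟨y, hy, hyx⟩ := (Ideal.mem_map_iff_of_surjective _ hsurj).1 h1
  refine ⟨y, hy, ?_⟩
  have h2 : y - x ∈ RingHom.ker (map (σ := ZVar D.d) (Ideal.Quotient.mk N)) := by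
    rw [RingHom.mem_ker, map_sub, hyx, sub_self]
  rwa [ker_map, Ideal.mk_ker] at h2

lemma IsExtension.le_lowIdeal (h : F.IsExtension J I) : I ≤ lowIdeal (ZVar D.d) D.originIdeal := by
  intro x hx
  obtain ⟨y, hy, hyx⟩ := exists_sub_mem_of_restrict_eq h.first_order.symm hx
  have h1 := equations_le_lowIdeal hy
  have h2 := map_le_lowIdeal (Ideal.map_mono first_order_le hyx)
  have h3 := sub_mem h1 h2
  rwa [sub_sub_cancel] at h3

/-- The consequence of flatness: relations between the equations lift. -/
lemma IsExtension.mem_lowIdeal (h : F.IsExtension J I) {x : MvPolynomial (ZVar D.d) D.Base}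
    (hx : x ∈ I ⊔ J.map C)
    (hN : x ∈ (D.liftingIdeal ⊔ D.originIdeal ^ 2).map
      (C : D.Base →+* MvPolynomial (ZVar D.d) D.Base)) :
    x ∈ lowIdeal (ZVar D.d) (J ⊔ D.originIdeal ^ 3) := by
  set π := Ideal.Quotient.mk J
  have hsurj : Function.Surjective (map (σ := ZVar D.d) π) :=
    map_surjective _ Ideal.Quotient.mk_surjective
  have h1 : map π x ∈ restrict π I := by
    obtain ⟨y, hy, z, hz, rfl⟩ := Submodule.mem_sup.1 hx
    rw [map_add, map_eq_zero_of_mem_map hz, add_zero]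
    exact Ideal.mem_map_of_mem _ hy
  have h2 : map π x ∈ ((D.originIdeal ^ 2).map π).map
      (C : D.Base ⧸ J →+* MvPolynomial (ZVar D.d) (D.Base ⧸ J)) := by
    rw [mem_map_C_iff] at hN ⊢
    intro u
    obtain ⟨y, hy, z, hz, hyz⟩ := Submodule.mem_sup.1 (hN u)
    rw [coeff_map, ← hyz, map_add, Ideal.Quotient.eq_zero_iff_mem.2 (h.lifting_le hy), zero_add]
    exact Ideal.mem_map_of_mem _ hz
  have h3 : restrict π I ≤ lowIdeal (ZVar D.d) (D.originIdeal.map π) := by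
    rw [restrict, Ideal.map_le_iff_le_comap]
    exact fun y hy => map_lowIdeal π (h.le_lowIdeal hy)
  -- Modulo `J`, flatness puts `x` in `𝔪² I`. Coefficients of `I` in degrees `0` and `1` lie in `𝔪`,
  -- so those of `x` lie in `𝔪³`.
  have h4 := map_mul_lowIdeal_le (Ideal.mul_mono_right h3 (mem_mul_of_flat h.flat h1 h2))
  rw [← Ideal.map_mul, ← pow_succ] at h4
  rw [mem_lowIdeal_iff] at h4 ⊢
  intro u hu
  have h5 := h4 u hu
  rw [coeff_map] at h5
  rw [sup_comm]
  exact (Ideal.mem_quotient_iff_mem_sup).1 h5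

/-- The linear relations between the first order terms of the equations of an extension. -/
lemma IsExtension.linear_relation_mem (h : F.IsExtension J I) (n : Fin l) (m : ℕ) (hm : m < D.b n)
    (β : Col D.d) (φ : Col D.d → MvPolynomial (ZVar D.d) D.Base)
    (e e' : MvPolynomial (ZVar D.d) D.Base)
    (hφ : ∀ α, φ α ∈ (D.liftingIdeal ⊔ D.originIdeal ^ 2).map C)
    (he : e ∈ (D.liftingIdeal ⊔ D.originIdeal ^ 2).map C)
    (he' : e' ∈ (D.liftingIdeal ⊔ D.originIdeal ^ 2).map C)
    (hφI : ∀ α, φ α + D.deformedMinor α β ∈ I) (heI : e + F.equation n m ∈ I)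
    (heI' : e' + F.equation n (m + 1) ∈ I) :
    C (F.baseEquation n (m + 1) - coeff 0 e') * X β.top + C (coeff 0 e) * X β.bot -
      ∑ α, C (coeff 0 (φ α)) * map C (D.roll n m α) ∈
      (J ⊔ D.originIdeal ^ 3).map (C : D.Base →+* MvPolynomial (ZVar D.d) D.Base) := by
  set N := D.liftingIdeal ⊔ D.originIdeal ^ 2 with hNdef
  set T := J ⊔ D.originIdeal ^ 3 with hT
  have hNm : N * D.originIdeal ≤ T := by
    rw [hNdef, Ideal.sup_mul, ← pow_succ]
    exact sup_le_sup_right (Ideal.mul_le_left.trans h.lifting_le) _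
  have hmul : ∀ x ∈ N.map (C : D.Base →+* MvPolynomial (ZVar D.d) D.Base), ∀ p : D.Base,
      p.IsHomogeneous 1 → x * C p ∈ lowIdeal (ZVar D.d) T := fun x hx p hp => by
    refine map_le_lowIdeal (Ideal.map_mono hNm ?_)
    rw [Ideal.map_mul]
    refine Ideal.mul_mem_mul hx (Ideal.mem_map_of_mem _ ?_)
    have := mem_originIdeal_pow hp
    rwa [pow_one] at this
  have hlin : ∀ x p : MvPolynomial (ZVar D.d) D.Base, p.IsHomogeneous 1 →
      x * p - C (coeff 0 x) * p ∈ lowIdeal (ZVar D.d) T := fun x p hp =>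
    Ideal.mem_sup_right (mul_sub_C_coeff_zero_mul_mem hp)
  have hroll : ∀ α, (map C (D.roll n m α) : MvPolynomial (ZVar D.d) D.Base).IsHomogeneous 1 :=
    fun α => (D.roll_homogeneous n m α hm).map _
  set q : Col D.d → MvPolynomial (ZVar D.d) D.Base := fun α =>
    map C (D.roll n m α) + C (F.pertRoll n m α)
  -- The rolling identity with all equations replaced by their lifts in `I`: the main terms cancel,
  -- and the errors `e`, `e'`, `φ` and the obstruction remain.
  set x := e * (X β.bot + C (D.zetaPt β.bot)) - e' * X β.top - ∑ α, φ α * q α +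
    C (F.baseEquation n (m + 1)) * X β.top with hx
  have hxN : x ∈ N.map (C : D.Base →+* MvPolynomial (ZVar D.d) D.Base) := by
    refine add_mem (sub_mem (sub_mem (Ideal.mul_mem_right _ _ he) (Ideal.mul_mem_right _ _ he'))
      (Ideal.sum_mem _ fun α _ => Ideal.mul_mem_right _ _ (hφ α))) (Ideal.mul_mem_right _ _
      (Ideal.mem_map_of_mem _ (Ideal.mem_sup_right (F.baseEquation_mem n (m + 1) hm))))
  have hxI : x ∈ I ⊔ J.map C := by
    have h1 : F.equation n m * (X β.bot + C (D.zetaPt β.bot)) - F.equation n (m + 1) * X β.top -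
        ∑ α, q α * D.deformedMinor α β - C (F.baseEquation n (m + 1)) * X β.top ∈
        J.map (C : D.Base →+* MvPolynomial (ZVar D.d) D.Base) :=
      Ideal.map_mono h.lifting_le (F.roll_mem n m hm β)
    have h2 : (e + F.equation n m) * (X β.bot + C (D.zetaPt β.bot)) -
        (e' + F.equation n (m + 1)) * X β.top - ∑ α, (φ α + D.deformedMinor α β) * q α ∈ I :=
      sub_mem (sub_mem (Ideal.mul_mem_right _ _ heI) (Ideal.mul_mem_right _ _ heI'))
        (Ideal.sum_mem _ fun α _ => Ideal.mul_mem_right _ _ (hφI α))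
    convert sub_mem (Ideal.mem_sup_left h2) (Ideal.mem_sup_right h1) using 1
    rw [hx]
    simp only [add_mul, Finset.sum_add_distrib, mul_comm (D.deformedMinor _ β)]
    ring
  have hlow := h.mem_lowIdeal hxI hxN
  refine mem_map_of_mem_lowIdeal (N := T) ?_ ?_
  · have hs : ∑ α, φ α * q α - ∑ α, C (coeff 0 (φ α)) * map C (D.roll n m α) ∈
        lowIdeal (ZVar D.d) T := by
      rw [← Finset.sum_sub_distrib]
      refine Ideal.sum_mem _ fun α _ => ?_
      convert add_mem (hlin (φ α) _ (hroll α)) (hmul (φ α) (hφ α) _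
        (F.coeff_pert_isHomogeneous n m (Finsupp.single α.top 1))) using 1
      simp only [q, pertRoll]
      ring
    convert add_mem (sub_mem (add_mem (sub_mem hlow (hlin e (X β.bot) (isHomogeneous_X _ _)))
      (hlin e' (X β.top) (isHomogeneous_X _ _)))
      (hmul e he (D.zetaPt β.bot) (zeta_isHomogeneous _ _))) hs using 1
    rw [hx, C_sub]
    ring
  · exact (((isHomogeneous_X _ _).C_mul _).add ((isHomogeneous_X _ _).C_mul _)).sub
      (IsHomogeneous.sum _ _ _ fun α _ => (hroll α).C_mul _)

/-- The base equations hold, up to third order terms, on the base of each extension. -/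
theorem IsExtension.baseIdeal_le (h : F.IsExtension J I) :
    F.baseIdeal ≤ J ⊔ D.originIdeal ^ 3 := by
  set T := J ⊔ D.originIdeal ^ 3 with hT
  have hminor : ∀ α β, ∃ y ∈ I, y - D.deformedMinor α β ∈ (D.liftingIdeal ⊔ D.originIdeal ^ 2).map
      (C : D.Base →+* MvPolynomial (ZVar D.d) D.Base) := fun α β =>
    exists_sub_mem_of_restrict_eq h.first_order (Ideal.subset_span (Or.inl ⟨α, β, rfl⟩))
  have hequation : ∀ n m, ∃ y, m ≤ D.b n → y ∈ I ∧ y - F.equation n m ∈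
      (D.liftingIdeal ⊔ D.originIdeal ^ 2).map
      (C : D.Base →+* MvPolynomial (ZVar D.d) D.Base) := fun n m => by
    by_cases hm : m ≤ D.b n
    · obtain ⟨y, hy⟩ := exists_sub_mem_of_restrict_eq h.first_order
        (Ideal.subset_span (Or.inr ⟨n, m, hm, rfl⟩))
      exact ⟨y, fun _ => hy⟩
    · exact ⟨0, fun hm' => absurd hm' hm⟩
  choose M hMI hMN using hminor
  choose E hE using hequation
  have hconst : ∀ x ∈ I, x ∈ (D.liftingIdeal ⊔ D.originIdeal ^ 2).map
      (C : D.Base →+* MvPolynomial (ZVar D.d) D.Base) → coeff 0 x ∈ T := fun x hx hN =>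
    mem_lowIdeal_iff.1 (h.mem_lowIdeal (Ideal.mem_sup_left hx) hN) 0 (by simp)
  -- As `f_{αβ} + f_{βα} = 0` and `f_{αα} = 0`, the corresponding sums of lifts are pure error terms
  -- in `I`, whose constant coefficients vanish modulo `T` by flatness.
  have hskew : ∀ α β, coeff 0 (M α β - D.deformedMinor α β) +
      coeff 0 (M β α - D.deformedMinor β α) ∈ T := fun α β => by
    rw [← coeff_add]
    refine hconst _ ?_ (add_mem (hMN α β) (hMN β α))
    convert add_mem (hMI α β) (hMI β α) using 1
    rw [deformedMinor, deformedMinor]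
    ring
  have halt : ∀ α, coeff 0 (M α α - D.deformedMinor α α) ∈ T := fun α => by
    refine hconst _ ?_ (hMN α α)
    convert hMI α α using 1
    rw [deformedMinor]
    ring
  have hroll : ∀ n m, m < D.b n →
      F.baseEquation n (m + 1) - coeff 0 (E n (m + 1) - F.equation n (m + 1)) ∈ T ∧
      coeff 0 (E n m - F.equation n m) ∈ T := by
    intro n m hm
    have h1 := eq_zero_of_alternating (D := D) (R := D.Base ⧸ T) n m hm
      (Ideal.Quotient.mk T (F.baseEquation n (m + 1) -
        coeff 0 (E n (m + 1) - F.equation n (m + 1))))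
      (Ideal.Quotient.mk T (coeff 0 (E n m - F.equation n m)))
      (fun α β => Ideal.Quotient.mk T (coeff 0 (M α β - D.deformedMinor α β)))
      (fun α β => by
        rw [← map_add]
        exact Ideal.Quotient.eq_zero_iff_mem.2 (hskew α β))
      (fun α => Ideal.Quotient.eq_zero_iff_mem.2 (halt α))
      (fun β => by
        have h2 := h.linear_relation_mem n m hm β (fun α => M α β - D.deformedMinor α β)
          (E n m - F.equation n m) (E n (m + 1) - F.equation n (m + 1)) (fun α => hMN α β)
          (hE n m hm.le).2 (hE n (m + 1) hm).2 (fun α => by rw [sub_add_cancel]; exact hMI α β)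
          (by rw [sub_add_cancel]; exact (hE n m hm.le).1)
          (by rw [sub_add_cancel]; exact (hE n (m + 1) hm).1)
        have h3 := map_eq_zero_of_mem_map h2
        rw [map_sub, map_sum, sub_eq_zero] at h3
        simp only [map_add, map_mul, map_C, map_X, map_map] at h3
        exact h3)
    exact ⟨Ideal.Quotient.eq_zero_iff_mem.1 h1.1, Ideal.Quotient.eq_zero_iff_mem.1 h1.2⟩
  refine sup_le (h.lifting_le.trans le_sup_left) (Ideal.span_le.2 ?_)
  rintro _ ⟨n, m, hm1, hm2, rfl⟩
  obtain ⟨m, rfl⟩ := Nat.exists_eq_add_of_le' hm1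
  -- Rolling into equation `m + 1` equates its obstruction with its constant error; rolling out of
  -- it makes this error vanish. The second roll exists only before the last index.
  have := add_mem (hroll n m (by omega)).1 (hroll n (m + 1) (by omega)).2
  rwa [sub_add_cancel] at this

theorem IsExtension.baseIdeal_le_of_homogeneous (h : F.IsExtension J I) (hJ : BaseHomogeneous J) :
    F.baseIdeal ≤ J := by
  refine sup_le h.lifting_le (Ideal.span_le.2 ?_)
  rintro _ ⟨n, m, hm1, hm2, rfl⟩
  have h1 : F.baseEquation n m ∈ F.baseIdeal :=
    Ideal.mem_sup_right (Ideal.subset_span ⟨n, m, hm1, hm2, rfl⟩)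
  obtain ⟨y, hy, v, hv, hyv⟩ := Submodule.mem_sup.1 (h.baseIdeal_le h1)
  -- The base equation is a quadric and `𝔪³` contains none, so the quadratic component of `y`, which
  -- lies in `J` by homogeneity, is the base equation itself.
  have h2 := congrArg (homogeneousComponent 2) hyv
  rw [map_add, homogeneousComponent_eq_zero_of_mem_pow hv (by omega), add_zero,
    homogeneousComponent_of_mem (F.baseEquation_isHomogeneous n m (by omega)), if_pos rfl] at h2
  rw [SetLike.mem_coe, ← h2, ← decomposition.decompose'_apply]
  let _ := MvPolynomial.gradedAlgebra (σ := D.ZetaIdx ⊕ D.RhoIdx) (R := K)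
  exact hJ 2 hy

end FirstOrderLift

end QuadricSystem

end RollingFactors

end

open RollingFactors QuadricSystem in
/-- The ideal of the lifting conditions and the base equations is the smallest homogeneous ideal
over whose quotient the infinitesimal deformation extends to a graded flat family; and any extension
whatsoever (graded or not) satisfies the base equations up to terms of order three. -/
theorem proposition3p2 {K : Type*} [Field K] {k l : ℕ} (D : QuadricSystem K k l)
    (F : D.FirstOrderLift) :
    IsLeast {J : Ideal D.Base | BaseHomogeneous J ∧
      ∃ I : Ideal (MvPolynomial (ZVar D.d) D.Base), FamilyHomogeneous I ∧ F.IsExtension J I}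
      F.baseIdeal ∧
    ∀ (J : Ideal D.Base) (I : Ideal (MvPolynomial (ZVar D.d) D.Base)),
      F.IsExtension J I → F.baseIdeal ≤ J ⊔ D.originIdeal ^ 3 :=
  ⟨⟨⟨F.baseHomogeneous_baseIdeal, F.extIdeal, F.familyHomogeneous_extIdeal,
    F.isExtension_extIdeal⟩, fun _ ⟨hJ, _, _, h⟩ => h.baseIdeal_le_of_homogeneous hJ⟩,
    fun _ _ h => h.baseIdeal_le⟩
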